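/- Let $(M,g)$ be a closed (compact, without boundary, not necessarily connected) oriented smooth Riemannian $3$-manifold and let $f\in C^\infty(M,\mathbb{R})$. For a global smooth $g$-orthonormal frame $S=(S_1,S_2,S_3)$ of $TM$, let $\omega_{ij}=\langle\nabla S_j,S_i\rangle_g$ be the connection $1$-form of the Levi-Civita connection $\nabla$ of $g$ in the frame $S$, let \[\mathfrak{cs}(M,g,S)=\mathrm{tr}\left(\omega\wedge d\omega+\tfrac23\,\omega\wedge\omega\wedge\omega\right),\qquad \mathfrak{CS}(M,g,S)=-\frac{1}{16\pi^2}\int_M\mathfrak{cs}(M,g,S)\in\mathbb{R},\] and let $\mathfrak{CS}(M,g)\in\mathbb{R}/\mathbb{Z}$ be the class of $\mathfrak{CS}(M,g,S)$ for any such frame $S$ (such frames exist, and the class does not depend on $S$). Then \[\mathfrak{CS}(M,g)=\mathfrak{CS}(M,e^{2f}g)\quad\text{in }\mathbb{R}/\mathbb{Z};\] that is, $\mathfrak{CS}(M,g,S)-\mathfrak{CS}(M,e^{2f}g,S')\in\mathbb{Z}$ for every $g$-orthonormal frame $S$ and every $e^{2f}g$-orthonormal frame $S'$. Moreover, for every $g$-orthonormal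 frame $S$, the frame $e^{-f}S=(e^{-f}S_1,e^{-f}S_2,e^{-f}S_3)$ is $e^{2f}g$-orthonormal, and there is a smooth $2$-form $\beta$ on $M$ with \[\mathfrak{cs}(M,e^{2f}g,e^{-f}S)=\mathfrak{cs}(M,g,S)+d\beta .\] -/

import Mathlib

open Bundle Set MeasureTheory Manifold
open scoped ContDiff Topology

noncomputable section

namespace ChernSimons

/-- Euclidean `3`-space, the model of our `3`-manifolds. -/
abbrev E3 := EuclideanSpace ℝ (Fin 3)

/-! ### Vector fields, metrics, forms -/

section
variable (M : Type*) [TopologicalSpace M] [ChartedSpace E3 M]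

/-- (Not necessarily smooth) vector fields on `M`. -/
abbrev VField : Type _ := ∀ x : M, TangentSpace (𝓡 3) x

/-- Smooth Riemannian metrics on `M`. -/
abbrev Metric [IsManifold (𝓡 3) ∞ M] : Type _ :=
  ContMDiffRiemannianMetric (𝓡 3) ∞ E3 (fun x : M ↦ TangentSpace (𝓡 3) x)

/-- (Not necessarily smooth) differential `k`-forms on `M`. -/
abbrev DiffForm (k : ℕ) : Type _ := ∀ x : M, TangentSpace (𝓡 3) x [⋀^Fin k]→L[ℝ] ℝ

end

variable {M : Type*} [TopologicalSpace M] [ChartedSpace E3 M]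

/-- A field of covectors, seen as a `1`-form. -/
def oneForm (α : ∀ x : M, TangentSpace (𝓡 3) x →L[ℝ] ℝ) : DiffForm M 1 := fun x ↦
  ContinuousAlternatingMap.ofSubsingleton ℝ (TangentSpace (𝓡 3) x) ℝ 0 (α x)

/-- The expression of a form in the preferred chart `φ` at `x₀`, i.e. its pull-back by `φ⁻¹`;
it is meaningful on the target of `φ`. -/
def inChart {k : ℕ} (η : DiffForm M k) (x₀ : M) (y : E3) : E3 [⋀^Fin k]→L[ℝ] ℝ :=
  (η ((extChartAt (𝓡 3) x₀).symm y)).compContinuousLinearMap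
    (mfderiv 𝓘(ℝ, E3) (𝓡 3) (extChartAt (𝓡 3) x₀).symm y)

/-- A form is smooth if its expressions in the preferred charts are. -/
def IsSmoothForm {k : ℕ} (η : DiffForm M k) : Prop :=
  ∀ x₀ : M, ContDiffOn ℝ ∞ (inChart η x₀) (extChartAt (𝓡 3) x₀).target

/-- The exterior derivative, computed at `x` in the preferred chart at `x`. -/
def extD {k : ℕ} (η : DiffForm M k) : DiffForm M (k + 1) := fun x ↦
  (extDeriv (inChart η x) (extChartAt (𝓡 3) x x)).compContinuousLinearMap
    (mfderiv (𝓡 3) 𝓘(ℝ, E3) (extChartAt (𝓡 3) x) x)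

/-- The wedge product of a `1`-form and a `k`-form,
`(α ∧ β)(v₀, …, v_k) = ∑ᵢ (-1)ⁱ α(vᵢ) β(v₀, …, v̂ᵢ, …, v_k)`, see `wedge_apply`. -/
def wedge {k : ℕ} (α : DiffForm M 1) (β : DiffForm M k) : DiffForm M (k + 1) := fun x ↦
  { AlternatingMap.alternatizeUncurryFin
      (LinearMap.smulRight
        ((AlternatingMap.ofSubsingleton ℝ (TangentSpace (𝓡 3) x) ℝ (0 : Fin 1)).symm
          (α x).toAlternatingMap)
        (β x).toAlternatingMap) with
    cont := by
      have h : Continuous fun v : Fin (k + 1) → TangentSpace (𝓡 3) x ↦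
          ∑ i : Fin (k + 1), (-1 : ℤ) ^ (i : ℕ) • (α x (fun _ ↦ v i) • β x (i.removeNth v)) := by
        refine continuous_finsetSum _ fun i _ ↦ Continuous.fun_const_smul (Continuous.fun_smul ?_ ?_) _
        · exact (α x).cont.comp (continuous_pi fun _ ↦ continuous_apply i)
        · exact (β x).cont.comp (continuous_pi fun j ↦ continuous_apply (i.succAbove j))
      convert h using 2 with v
      exact AlternatingMap.alternatizeUncurryFin_apply _ v }

theorem wedge_apply {k : ℕ} (α : DiffForm M 1) (β : DiffForm M k) (x : M)
    (v : Fin (k + 1) → TangentSpace (𝓡 3) x) :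
    wedge α β x v =
      ∑ i : Fin (k + 1), (-1 : ℝ) ^ (i : ℕ) * (α x (fun _ ↦ v i) * β x (i.removeNth v)) := by
  refine (AlternatingMap.alternatizeUncurryFin_apply _ v).trans ?_
  refine Finset.sum_congr rfl fun i _ ↦ ?_
  rw [zsmul_eq_mul]
  push_cast
  rfl

/-! ### The Chern-Simons form of a matrix of `1`-forms -/

section
variable {m : Type*} [Fintype m]

/-- The wedge product of matrix-valued forms. -/
def mwedge {k : ℕ} (A : Matrix m m (DiffForm M 1)) (B : Matrix m m (DiffForm M k)) :
    Matrix m m (DiffForm M (k + 1)) :=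
  Matrix.of fun i j ↦ ∑ l, wedge (A i l) (B l j)

/-- `cs(θ) = tr(θ ∧ dθ + (2/3) θ ∧ θ ∧ θ)`. -/
def csForm (θ : Matrix m m (DiffForm M 1)) : DiffForm M 3 :=
  Matrix.trace (mwedge θ (θ.map extD) + (2 / 3 : ℝ) • mwedge θ (mwedge θ θ))

end

/-! ### Orientations and integration -/

/-- The coordinate frame `∂₁, ∂₂, ∂₃` of the preferred chart `φ` at `x₀`, at the point `φ⁻¹(y)`. -/
def coordFrame (x₀ : M) (y : E3) : Fin 3 → TangentSpace (𝓡 3) ((extChartAt (𝓡 3) x₀).symm y) :=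
  fun i ↦ mfderiv 𝓘(ℝ, E3) (𝓡 3) (extChartAt (𝓡 3) x₀).symm y (EuclideanSpace.single i (1 : ℝ))

/-- `1` or `-1` according to whether the coordinate frame `∂₁, ∂₂, ∂₃` at `φ⁻¹(y)` is positive
or negative for the given orientations of the tangent spaces. An `Orientation` is a ray of
alternating `3`-forms; `someVector` is any element of the ray. -/
def coordSign (o : ∀ x : M, Orientation ℝ (TangentSpace (𝓡 3) x) (Fin 3)) (x₀ : M) (y : E3) : ℝ :=
  SignType.sign ((o ((extChartAt (𝓡 3) x₀).symm y)).someVector (coordFrame x₀ y))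

variable (M) in
/-- An orientation of `M`: an orientation of each tangent space, locally constant in charts. -/
structure MOrientation where
  orient (x : M) : Orientation ℝ (TangentSpace (𝓡 3) x) (Fin 3)
  continuousOn (x₀ : M) : ContinuousOn (coordSign orient x₀) (extChartAt (𝓡 3) x₀).target

variable [IsManifold (𝓡 3) ∞ M]

/-- A smooth partition of unity subordinate to the domains of the preferred charts. -/
def chartPartition [CompactSpace M] [T2Space M] : SmoothPartitionOfUnity M (𝓡 3) M univ :=
  (SmoothPartitionOfUnity.exists_isSubordinate_chartAt_source (𝓡 3) M).choose

/-- The integral of a `3`-form over a compact oriented `3`-manifold: cut the form by a partition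
of unity, and integrate each piece in a chart. -/
def integrateForm [CompactSpace M] [T2Space M] (o : MOrientation M) (η : DiffForm M 3) : ℝ :=
  ∑ᶠ x₀ : M, ∫ y in (extChartAt (𝓡 3) x₀).target,
    coordSign o.orient x₀ y * chartPartition x₀ ((extChartAt (𝓡 3) x₀).symm y)
      * η ((extChartAt (𝓡 3) x₀).symm y) (coordFrame x₀ y)

/-! ### The Levi-Civita connection -/

/-- Differentiability at a point of a vector field. -/
abbrev DiffAt (Y : VField M) (x : M) : Prop :=
  MDifferentiableAt (𝓡 3) (𝓡 3).tangent (fun p ↦ (⟨p, Y p⟩ : TangentBundle (𝓡 3) M)) x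

/-- `nabla` is torsion-free and compatible with `g`: `X⟨Y, Z⟩ = ⟨∇_X Y, Z⟩ + ⟨Y, ∇_X Z⟩`.
In Mathlib `nabla Y x (X x)` stands for `(∇_X Y)(x)`. -/
def IsLeviCivita (g : Metric M)
    (nabla : CovariantDerivative (𝓡 3) E3 (fun x : M ↦ TangentSpace (𝓡 3) x)) : Prop :=
  nabla.torsion = 0 ∧
    ∀ (X Y Z : VField M) (x : M), DiffAt Y x → DiffAt Z x →
      mvfderiv (𝓡 3) (fun p ↦ g.inner p (Y p) (Z p)) x (X x) =
        g.inner x (nabla Y x (X x)) (Z x) + g.inner x (Y x) (nabla Z x (X x))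

theorem mdifferentiableAt_inner (g : Metric M) {Y Z : VField M} {x : M}
    (hY : DiffAt Y x) (hZ : DiffAt Z x) :
    MDifferentiableAt (𝓡 3) 𝓘(ℝ, ℝ) (fun p ↦ g.inner p (Y p) (Z p)) x := by
  have h : MDifferentiableAt (𝓡 3) ((𝓡 3).prod 𝓘(ℝ))
      (fun p ↦ TotalSpace.mk' ℝ (E := Bundle.Trivial M ℝ) p (g.inner p (Y p) (Z p))) x := by
    apply MDifferentiableAt.clm_bundle_apply₂ (F₁ := E3) (F₂ := E3)
    · exact g.contMDiff.mdifferentiableAt (by simp)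
    · exact hY
    · exact hZ
  simp only [mdifferentiableAt_totalSpace] at h
  exact h.2

/-- The right-hand side of the Koszul formula. -/
def koszul (g : Metric M) (Y X Z : VField M) (x : M) : ℝ :=
  mvfderiv (𝓡 3) (fun p ↦ g.inner p (Y p) (Z p)) x (X x)
    + mvfderiv (𝓡 3) (fun p ↦ g.inner p (X p) (Z p)) x (Y x)
    - mvfderiv (𝓡 3) (fun p ↦ g.inner p (X p) (Y p)) x (Z x)
    + g.inner x (VectorField.mlieBracket (𝓡 3) X Y x) (Z x)
    + g.inner x (VectorField.mlieBracket (𝓡 3) Z X x) (Y x)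
    + g.inner x (VectorField.mlieBracket (𝓡 3) Z Y x) (X x)

theorem mvfderiv_inner_smul_left (g : Metric M) {f : M → ℝ} {Y Z : VField M} {x : M}
    (hf : MDifferentiableAt (𝓡 3) 𝓘(ℝ, ℝ) f x) (hY : DiffAt Y x) (hZ : DiffAt Z x)
    (v : TangentSpace (𝓡 3) x) :
    mvfderiv (𝓡 3) (fun p ↦ g.inner p ((f • Y) p) (Z p)) x v =
      f x * mvfderiv (𝓡 3) (fun p ↦ g.inner p (Y p) (Z p)) x v
        + mvfderiv (𝓡 3) f x v * g.inner x (Y x) (Z x) := by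
  have : (fun p ↦ g.inner p ((f • Y) p) (Z p)) = f * (fun p ↦ g.inner p (Y p) (Z p)) := by
    ext p; simp
  rw [this, mvfderiv_mul hf (mdifferentiableAt_inner g hY hZ)]
  simp; ring

theorem mvfderiv_inner_add_left (g : Metric M) {Y Y' Z : VField M} {x : M}
    (hY : DiffAt Y x) (hY' : DiffAt Y' x) (hZ : DiffAt Z x)
    (v : TangentSpace (𝓡 3) x) :
    mvfderiv (𝓡 3) (fun p ↦ g.inner p ((Y + Y') p) (Z p)) x v =
      mvfderiv (𝓡 3) (fun p ↦ g.inner p (Y p) (Z p)) x v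
        + mvfderiv (𝓡 3) (fun p ↦ g.inner p (Y' p) (Z p)) x v := by
  have : (fun p ↦ g.inner p ((Y + Y') p) (Z p)) =
      (fun p ↦ g.inner p (Y p) (Z p)) + (fun p ↦ g.inner p (Y' p) (Z p)) := by
    ext p; simp
  rw [this, mvfderiv_add (mdifferentiableAt_inner g hY hZ) (mdifferentiableAt_inner g hY' hZ)]
  simp

theorem inner_comm_fun (g : Metric M) (Y Z : VField M) :
    (fun p ↦ g.inner p (Y p) (Z p)) = fun p ↦ g.inner p (Z p) (Y p) := by
  ext p; exact g.symm p _ _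

theorem mvfderiv_inner_smul_right (g : Metric M) {f : M → ℝ} {Y Z : VField M} {x : M}
    (hf : MDifferentiableAt (𝓡 3) 𝓘(ℝ, ℝ) f x) (hY : DiffAt Y x) (hZ : DiffAt Z x)
    (v : TangentSpace (𝓡 3) x) :
    mvfderiv (𝓡 3) (fun p ↦ g.inner p (Y p) ((f • Z) p)) x v =
      f x * mvfderiv (𝓡 3) (fun p ↦ g.inner p (Y p) (Z p)) x v
        + mvfderiv (𝓡 3) f x v * g.inner x (Y x) (Z x) := by
  rw [inner_comm_fun, mvfderiv_inner_smul_left g hf hZ hY, inner_comm_fun, g.symm x]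

theorem mvfderiv_inner_add_right (g : Metric M) {Y Z Z' : VField M} {x : M}
    (hY : DiffAt Y x) (hZ : DiffAt Z x) (hZ' : DiffAt Z' x)
    (v : TangentSpace (𝓡 3) x) :
    mvfderiv (𝓡 3) (fun p ↦ g.inner p (Y p) ((Z + Z') p)) x v =
      mvfderiv (𝓡 3) (fun p ↦ g.inner p (Y p) (Z p)) x v
        + mvfderiv (𝓡 3) (fun p ↦ g.inner p (Y p) (Z' p)) x v := by
  rw [inner_comm_fun, mvfderiv_inner_add_left g hZ hZ' hY, inner_comm_fun, inner_comm_fun g Z']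

open VectorField in
theorem koszul_tensorial_left (g : Metric M) {Y Z : VField M} {x : M}
    (hY : DiffAt Y x) (hZ : DiffAt Z x) :
    TensorialAt (𝓡 3) E3 (fun X : VField M ↦ koszul g Y X Z x) x where
  smul {f X} hf hX := by
    simp only [koszul]
    rw [mvfderiv_inner_smul_left g hf hX hZ, mvfderiv_inner_smul_left g hf hX hY,
      mlieBracket_smul_left hf hX, mlieBracket_smul_right hf hX]
    simp only [Pi.smul_apply', map_add, map_smul, add_apply,
      smul_apply, smul_eq_mul]
    ring
  add {X X'} hX hX' := by
    simp only [koszul]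
    rw [mvfderiv_inner_add_left g hX hX' hZ, mvfderiv_inner_add_left g hX hX' hY,
      mlieBracket_add_left hX hX', mlieBracket_add_right hX hX']
    simp only [Pi.add_apply, map_add, add_apply]
    ring

open VectorField in
theorem koszul_tensorial_right (g : Metric M) {Y X : VField M} {x : M}
    (hY : DiffAt Y x) (hX : DiffAt X x) :
    TensorialAt (𝓡 3) E3 (fun Z : VField M ↦ koszul g Y X Z x) x where
  smul {f Z} hf hZ := by
    simp only [koszul]
    rw [mvfderiv_inner_smul_right g hf hX hZ, mvfderiv_inner_smul_right g hf hY hZ,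
      mlieBracket_smul_left hf hZ, mlieBracket_smul_left hf hZ]
    simp only [Pi.smul_apply', map_add, map_smul, add_apply,
      smul_apply, smul_eq_mul, neg_smul, map_neg,
      neg_apply]
    rw [g.symm x (Z x) (Y x), g.symm x (Z x) (X x)]
    ring
  add {Z Z'} hZ hZ' := by
    simp only [koszul]
    rw [mvfderiv_inner_add_right g hX hZ hZ', mvfderiv_inner_add_right g hY hZ hZ',
      mlieBracket_add_left hZ hZ', mlieBracket_add_left hZ hZ']
    simp only [Pi.add_apply, map_add, add_apply]
    ring

theorem exists_sharp (g : Metric M) (x : M)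
    (B : TangentSpace (𝓡 3) x →L[ℝ] TangentSpace (𝓡 3) x →L[ℝ] ℝ) :
    ∃ A : TangentSpace (𝓡 3) x →L[ℝ] TangentSpace (𝓡 3) x, ∀ v w, g.inner x (A v) w = B v w := by
  have : FiniteDimensional ℝ (TangentSpace (𝓡 3) x) := inferInstanceAs (FiniteDimensional ℝ E3)
  have : T2Space (TangentSpace (𝓡 3) x) := inferInstanceAs (T2Space E3)
  let G : TangentSpace (𝓡 3) x →ₗ[ℝ] Module.Dual ℝ (TangentSpace (𝓡 3) x) :=
    (ContinuousLinearMap.coeLM ℝ).comp (g.inner x).toLinearMap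
  let B' : TangentSpace (𝓡 3) x →ₗ[ℝ] Module.Dual ℝ (TangentSpace (𝓡 3) x) :=
    (ContinuousLinearMap.coeLM ℝ).comp B.toLinearMap
  have hG : Function.Injective G := by
    rw [injective_iff_map_eq_zero]
    intro v hv
    by_contra h
    have h1 := g.pos x v h
    have h2 : G v v = 0 := by rw [hv]; rfl
    exact absurd h2 h1.ne'
  let e := LinearEquiv.ofBijective G ⟨hG,
    (LinearMap.injective_iff_surjective_of_finrank_eq_finrank
      Subspace.dual_finrank_eq.symm).1 hG⟩
  refine ⟨LinearMap.toContinuousLinearMap (e.symm.toLinearMap.comp B'), fun v w ↦ ?_⟩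
  have : G (e.symm (B' v)) = B' v := e.apply_symm_apply _
  exact congr($this w)

theorem eq_of_inner_eq (g : Metric M) {x : M} {v w : TangentSpace (𝓡 3) x}
    (h : ∀ u, g.inner x v u = g.inner x w u) : v = w := by
  by_contra hne
  have h1 := g.pos x (v - w) (sub_ne_zero.2 hne)
  rw [show g.inner x (v - w) = g.inner x v - g.inner x w from map_sub _ _ _, sub_apply, h, sub_self] at h1
  exact lt_irrefl _ h1

open VectorField in
theorem koszul_add (g : Metric M) {Y Y' X Z : VField M} {x : M}
    (hY : DiffAt Y x) (hY' : DiffAt Y' x)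
    (hX : DiffAt X x) (hZ : DiffAt Z x) :
    koszul g (Y + Y') X Z x = koszul g Y X Z x + koszul g Y' X Z x := by
  simp only [koszul]
  rw [mvfderiv_inner_add_left g hY hY' hZ, mvfderiv_inner_add_right g hX hY hY',
    mlieBracket_add_right hY hY', mlieBracket_add_right hY hY']
  simp only [Pi.add_apply, map_add, add_apply]
  ring

open VectorField in
theorem koszul_smul (g : Metric M) {f : M → ℝ} {Y X Z : VField M} {x : M}
    (hf : MDifferentiableAt (𝓡 3) 𝓘(ℝ, ℝ) f x) (hY : DiffAt Y x)
    (hX : DiffAt X x) (hZ : DiffAt Z x) :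
    koszul g (f • Y) X Z x = f x * koszul g Y X Z x
      + 2 * (mvfderiv (𝓡 3) f x (X x) * g.inner x (Y x) (Z x)) := by
  simp only [koszul]
  rw [mvfderiv_inner_smul_left g hf hY hZ, mvfderiv_inner_smul_right g hf hX hY,
    mlieBracket_smul_right hf hY, mlieBracket_smul_right hf hY]
  simp only [Pi.smul_apply', map_add, map_smul, add_apply,
    smul_apply, smul_eq_mul]
  rw [g.symm x (Y x) (X x)]
  ring

theorem exists_koszul (g : Metric M) {Y : VField M} {x : M} (hY : DiffAt Y x) :
    ∃ A : TangentSpace (𝓡 3) x →L[ℝ] TangentSpace (𝓡 3) x, ∀ X Z : VField M,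
      DiffAt X x → DiffAt Z x →
        2 * g.inner x (A (X x)) (Z x) = koszul g Y X Z x := by
  obtain ⟨A, hA⟩ := exists_sharp g x ((1 / 2 : ℝ) •
    TensorialAt.mkHom₂ (F := E3) (F' := E3) (I := 𝓡 3) (fun X Z ↦ koszul g Y X Z x) x
      (fun Z hZ ↦ koszul_tensorial_left g hY hZ) (fun X hX ↦ koszul_tensorial_right g hY hX))
  refine ⟨A, fun X Z hX hZ ↦ ?_⟩
  rw [hA]
  simp only [smul_apply, smul_eq_mul]
  rw [TensorialAt.mkHom₂_apply _ _ hX hZ]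
  ring

theorem eq_of_koszul (g : Metric M) {x : M}
    {A B : TangentSpace (𝓡 3) x →L[ℝ] TangentSpace (𝓡 3) x}
    (h : ∀ X Z : VField M, DiffAt X x → DiffAt Z x →
      2 * g.inner x (A (X x)) (Z x) = 2 * g.inner x (B (X x)) (Z x)) : A = B := by
  ext1 v
  refine eq_of_inner_eq g fun u ↦ ?_
  have := h (FiberBundle.extend E3 v) (FiberBundle.extend E3 u)
    (FiberBundle.mdifferentiableAt_extend ..) (FiberBundle.mdifferentiableAt_extend ..)
  simpa using this

theorem koszul_sub_swap (g : Metric M) (X Y Z : VField M) (x : M) :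
    koszul g Y X Z x - koszul g X Y Z x
      = 2 * g.inner x (VectorField.mlieBracket (𝓡 3) X Y x) (Z x) := by
  simp only [koszul]
  rw [inner_comm_fun g Y X, VectorField.mlieBracket_swap_apply (V := Y) (W := X), map_neg,
    neg_apply]
  ring

theorem koszul_add_swap (g : Metric M) (X Y Z : VField M) (x : M) :
    koszul g Y X Z x + koszul g Z X Y x
      = 2 * mvfderiv (𝓡 3) (fun p ↦ g.inner p (Y p) (Z p)) x (X x) := by
  simp only [koszul]
  rw [inner_comm_fun g Z Y, VectorField.mlieBracket_swap_apply (V := Y) (W := X),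
    VectorField.mlieBracket_swap_apply (V := Y) (W := Z),
    VectorField.mlieBracket_swap_apply (V := Z) (W := X)]
  simp only [map_neg, neg_apply]
  ring

theorem exists_extension {x : M} (v : TangentSpace (𝓡 3) x) :
    ∃ X : VField M, DiffAt X x ∧ X x = v :=
  ⟨FiberBundle.extend E3 v, FiberBundle.mdifferentiableAt_extend .., by simp⟩

theorem exists_isLeviCivita (g : Metric M) :
    ∃ nabla : CovariantDerivative (𝓡 3) E3 (fun x : M ↦ TangentSpace (𝓡 3) x),
      IsLeviCivita g nabla := by
  classical
  obtain ⟨D, hD⟩ : ∃ D : VField M → (∀ x : M, TangentSpace (𝓡 3) x →L[ℝ] TangentSpace (𝓡 3) x),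
      ∀ (Y X Z : VField M) (x : M), DiffAt Y x → DiffAt X x → DiffAt Z x →
        2 * g.inner x (D Y x (X x)) (Z x) = koszul g Y X Z x := by
    refine ⟨fun Y x ↦ if h : DiffAt Y x then (exists_koszul g h).choose else 0, ?_⟩
    intro Y X Z x hY hX hZ
    simp only [dif_pos hY]
    exact (exists_koszul g hY).choose_spec X Z hX hZ
  have hcov : IsCovariantDerivativeOn E3 D univ := by
    refine ⟨?_, ?_⟩
    · intro Y Y' x hY hY' _
      refine eq_of_koszul g fun X Z hX hZ ↦ ?_
      rw [hD _ _ _ _ (mdifferentiableAt_add_section hY hY') hX hZ, koszul_add g hY hY' hX hZ,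
        add_apply, map_add, add_apply, mul_add, hD _ _ _ _ hY hX hZ, hD _ _ _ _ hY' hX hZ]
    · intro Y f x hY hf _
      refine eq_of_koszul g fun X Z hX hZ ↦ ?_
      rw [hD _ _ _ _ (hf.smul_section hY) hX hZ, koszul_smul g hf hY hX hZ,
        ← hD _ _ _ _ hY hX hZ, add_apply, map_add, add_apply, smul_apply, map_smul, smul_apply,
        ContinuousLinearMap.smulRight_apply, map_smul, smul_apply, smul_eq_mul, smul_eq_mul]
      ring
  have htors : ∀ (X Y : VField M) (x : M), DiffAt X x → DiffAt Y x →
      D Y x (X x) - D X x (Y x) = VectorField.mlieBracket (𝓡 3) X Y x := by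
    intro X Y x hX hY
    refine eq_of_inner_eq g fun u ↦ ?_
    obtain ⟨Z, hZ, rfl⟩ := exists_extension u
    have h := koszul_sub_swap g X Y Z x
    rw [← hD _ _ _ _ hY hX hZ, ← hD _ _ _ _ hX hY hZ, ← mul_sub] at h
    have h' := mul_left_cancel₀ two_ne_zero h
    rw [← h', map_sub, sub_apply]
  have hmet : ∀ (X Y Z : VField M) (x : M), DiffAt Y x → DiffAt Z x →
      mvfderiv (𝓡 3) (fun p ↦ g.inner p (Y p) (Z p)) x (X x) =
        g.inner x (D Y x (X x)) (Z x) + g.inner x (Y x) (D Z x (X x)) := by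
    intro X Y Z x hY hZ
    obtain ⟨X', hX', hXX'⟩ := exists_extension (X x)
    have h := koszul_add_swap g X' Y Z x
    rw [← hD _ _ _ _ hY hX' hZ, ← hD _ _ _ _ hZ hX' hY, ← mul_add] at h
    have h' := mul_left_cancel₀ two_ne_zero h
    rw [← hXX', ← h', g.symm x (Y x)]
  exact ⟨⟨D, hcov⟩, (CovariantDerivative.torsion_eq_zero_iff _).2
    fun {X Y x} hX hY ↦ htors X Y x hX hY, hmet⟩

/-- The Levi-Civita connection. (Its values on differentiable vector fields are unique, by the
Koszul formula.) -/
def leviCivita (g : Metric M) :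
    CovariantDerivative (𝓡 3) E3 (fun x : M ↦ TangentSpace (𝓡 3) x) :=
  (exists_isLeviCivita g).choose

theorem leviCivita_spec (g : Metric M) : IsLeviCivita g (leviCivita g) :=
  (exists_isLeviCivita g).choose_spec

/-! ### The Chern-Simons invariant -/

/-- `S = (S₁, S₂, S₃)` is a global smooth `g`-orthonormal frame. -/
def IsOrthonormalFrame (g : Metric M) (S : Fin 3 → VField M) : Prop :=
  (∀ i, ContMDiff (𝓡 3) (𝓡 3).tangent ∞ fun x ↦ (⟨x, S i x⟩ : TangentBundle (𝓡 3) M)) ∧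
    ∀ (x : M) (i j : Fin 3), g.inner x (S i x) (S j x) = if i = j then 1 else 0

/-- The connection `1`-form `ω` of the Levi-Civita connection in the frame `S`:
`ω_{ij}(v) = ⟨S_i, ∇_v S_j⟩`. -/
def connectionForm (g : Metric M) (S : Fin 3 → VField M) : Matrix (Fin 3) (Fin 3) (DiffForm M 1) :=
  Matrix.of fun i j ↦ oneForm fun x ↦ (g.inner x (S i x)).comp (leviCivita g (S j) x)

/-- The Chern-Simons form `cs(M, g, S) = tr(ω ∧ dω + (2/3) ω ∧ ω ∧ ω)`. -/
def chernSimonsForm (g : Metric M) (S : Fin 3 → VField M) : DiffForm M 3 :=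
  csForm (connectionForm g S)

/-- `CS(M, g, S) = -1/(16π²) ∫_M cs(M, g, S)`, a real number. -/
def chernSimonsNumber [CompactSpace M] [T2Space M] (o : MOrientation M) (g : Metric M)
    (S : Fin 3 → VField M) : ℝ :=
  -(1 / (16 * Real.pi ^ 2)) * integrateForm o (chernSimonsForm g S)

open Classical in
/-- The Chern-Simons invariant `CS(M, g) ∈ ℝ/ℤ`: the class of `CS(M, g, S)`, for any global
orthonormal frame `S`. (A closed oriented `3`-manifold is parallelizable, so that the second
branch does not occur, and the class does not depend on `S`.) -/
def chernSimonsInvariant [CompactSpace M] [T2Space M] (o : MOrientation M) (g : Metric M) :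
    UnitAddCircle :=
  if h : ∃ S, IsOrthonormalFrame g S then (chernSimonsNumber o g h.choose : UnitAddCircle) else 0

set_option synthInstance.maxHeartbeats 400000 in
/-- The conformal metric `e^{2f} g`. -/
def conformalChange (f : C^∞⟮𝓡 3, M; 𝓘(ℝ, ℝ), ℝ⟯) (g : Metric M) :
    Metric M where
  inner x := Real.exp (2 * f x) • g.inner x
  symm x v w := by simp [g.symm x v w]
  pos x v hv := by
    simpa using mul_pos (Real.exp_pos _) (g.pos x v hv)
  isVonNBounded x := by
    have hb := (g.isVonNBounded x).image
      (Real.exp (- f x) • ContinuousLinearMap.id ℝ (TangentSpace (𝓡 3) x))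
    refine Bornology.IsVonNBounded.subset (fun v hv ↦ ?_) hb
    refine ⟨Real.exp (f x) • v, ?_, by simp [smul_smul, ← Real.exp_add]⟩
    have hv' : Real.exp (2 * f x) * g.inner x v v < 1 := hv
    rw [two_mul, Real.exp_add] at hv'
    simpa [mul_assoc] using hv'
  contMDiff := by
    have h1 : ContMDiff (𝓡 3) 𝓘(ℝ, ℝ) ∞ fun x ↦ Real.exp (2 * f x) :=
      Real.contDiff_exp.contMDiff.comp (contMDiff_const.mul f.contMDiff)
    exact h1.smul_section g.contMDiff

/-- The frame `e^{-f} S`. -/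
def rescaleFrame (f : C^∞⟮𝓡 3, M; 𝓘(ℝ, ℝ), ℝ⟯) (S : Fin 3 → VField M) : Fin 3 → VField M :=
  fun i x ↦ Real.exp (-f x) • S i x

end ChernSimons

end

open Bundle Set MeasureTheory Manifold
open scoped ContDiff Topology

noncomputable section

namespace ChernSimons

set_option linter.unusedSectionVars false

section
variable {M : Type*} [TopologicalSpace M] [ChartedSpace E3 M]

/-- The derivative of the inverse of the preferred chart at `x₀`. -/
def dSymm (x₀ : M) (y : E3) : E3 →L[ℝ] TangentSpace (𝓡 3) ((extChartAt (𝓡 3) x₀).symm y) :=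
  mfderiv 𝓘(ℝ, E3) (𝓡 3) (extChartAt (𝓡 3) x₀).symm y

/-- The derivative of the preferred chart at `x₀`. -/
def dChart (x₀ q : M) : TangentSpace (𝓡 3) q →L[ℝ] E3 :=
  mfderiv (𝓡 3) 𝓘(ℝ, E3) (extChartAt (𝓡 3) x₀) q

theorem inChart_apply {k : ℕ} (η : DiffForm M k) (x₀ : M) (y : E3) (v : Fin k → E3) :
    inChart η x₀ y v = η ((extChartAt (𝓡 3) x₀).symm y) (fun i ↦ dSymm x₀ y (v i)) := rfl

theorem extD_apply {k : ℕ} (η : DiffForm M k) (x : M) (v : Fin (k + 1) → TangentSpace (𝓡 3) x) :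
    extD η x v = extDeriv (inChart η x) (extChartAt (𝓡 3) x x) (fun i ↦ dChart x x (v i)) := rfl

theorem wedge_one_one (α β : DiffForm M 1) (x : M) (u v : TangentSpace (𝓡 3) x) :
    wedge α β x ![u, v] = α x ![u] * β x ![v] - α x ![v] * β x ![u] := by
  rw [wedge_apply, Fin.sum_univ_two]
  have h0 : Fin.removeNth 0 ![u, v] = ![v] := by ext i; fin_cases i; rfl
  have h1 : Fin.removeNth 1 ![u, v] = ![u] := by ext i; fin_cases i; rfl
  have h (w : TangentSpace (𝓡 3) x) : (fun _ : Fin 1 ↦ w) = ![w] := by ext i; fin_cases i; rfl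
  simp only [h0, h1, h]
  simp
  ring

theorem wedge_one_two (α : DiffForm M 1) (β : DiffForm M 2) (x : M)
    (u v w : TangentSpace (𝓡 3) x) :
    wedge α β x ![u, v, w] =
      α x ![u] * β x ![v, w] - α x ![v] * β x ![u, w] + α x ![w] * β x ![u, v] := by
  rw [wedge_apply, Fin.sum_univ_three]
  have h0 : Fin.removeNth 0 ![u, v, w] = ![v, w] := by ext i; fin_cases i <;> rfl
  have h1 : Fin.removeNth 1 ![u, v, w] = ![u, w] := by ext i; fin_cases i <;> rfl
  have h2 : Fin.removeNth 2 ![u, v, w] = ![u, v] := by ext i; fin_cases i <;> rfl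
  have h (w : TangentSpace (𝓡 3) x) : (fun _ : Fin 1 ↦ w) = ![w] := by ext i; fin_cases i; rfl
  simp only [h0, h1, h2, h]
  simp
  ring

theorem inChart_add {k : ℕ} (η ζ : DiffForm M k) (x₀ : M) :
    inChart (η + ζ) x₀ = inChart η x₀ + inChart ζ x₀ := rfl

/-- The product of a function and a form. -/
def fsmul {k : ℕ} (h : M → ℝ) (η : DiffForm M k) : DiffForm M k := fun x ↦ h x • η x

theorem inChart_fsmul {k : ℕ} (h : M → ℝ) (η : DiffForm M k) (x₀ : M) :
    inChart (fsmul h η) x₀ = fun y ↦ h ((extChartAt (𝓡 3) x₀).symm y) • inChart η x₀ y := rfl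

/-- Evaluation of alternating forms on all tuples of standard basis vectors. -/
def basisEval (k : ℕ) : (E3 [⋀^Fin k]→L[ℝ] ℝ) →ₗ[ℝ] ((Fin k → Fin 3) → ℝ) where
  toFun η s := η fun i ↦ EuclideanSpace.single (s i) (1 : ℝ)
  map_add' _ _ := rfl
  map_smul' _ _ := rfl

theorem basisEval_injective (k : ℕ) : Function.Injective (basisEval k) := by
  intro η ζ h
  have : η.toAlternatingMap = ζ.toAlternatingMap := by
    refine Module.Basis.ext_alternating (EuclideanSpace.basisFun (Fin 3) ℝ).toBasis fun v _ ↦ ?_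
    have := congrFun h v
    simpa [basisEval] using this
  exact ContinuousAlternatingMap.toAlternatingMap_injective this

theorem contDiffOn_form_iff {k : ℕ} {n : ℕ∞ω} {F : E3 → E3 [⋀^Fin k]→L[ℝ] ℝ} {s : Set E3} :
    ContDiffOn ℝ n F s ↔ ∀ v : Fin k → E3, ContDiffOn ℝ n (fun y ↦ F y v) s := by
  constructor
  · intro h v
    exact (ContinuousAlternatingMap.apply ℝ E3 ℝ v).contDiff.comp_contDiffOn h
  · intro h
    obtain ⟨r, hr⟩ := (basisEval k).exists_leftInverse_of_injective
      (LinearMap.ker_eq_bot.2 (basisEval_injective k))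
    have h1 : ContDiffOn ℝ n (fun y ↦ basisEval k (F y)) s :=
      contDiffOn_pi.2 fun t ↦ h _
    have h2 := (LinearMap.toContinuousLinearMap r).contDiff.comp_contDiffOn h1
    refine h2.congr fun y _ ↦ ?_
    exact (LinearMap.congr_fun hr (F y)).symm

end

section
variable {M : Type*} [TopologicalSpace M] [ChartedSpace E3 M] [IsManifold (𝓡 3) ∞ M]

theorem dSymm_dChart (x₀ : M) {q : M} (hq : q ∈ (extChartAt (𝓡 3) x₀).source) (v : E3) :
    (dSymm x₀ (extChartAt (𝓡 3) x₀ q) (dChart x₀ q v) : E3) = v := by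
  have : IsManifold (𝓡 3) 1 M := IsManifold.of_le (n := ∞) (by simp)
  have := mfderivWithin_extChartAt_symm_comp_mfderiv_extChartAt' (I := 𝓡 3) (x := x₀) hq
  simp only [modelWithCornersSelf_coe, range_id, mfderivWithin_univ] at this
  exact congr($this v)

theorem dChart_dSymm (x₀ : M) {y : E3} (hy : y ∈ (extChartAt (𝓡 3) x₀).target) (v : E3) :
    dChart x₀ ((extChartAt (𝓡 3) x₀).symm y) (dSymm x₀ y v) = v := by
  have : IsManifold (𝓡 3) 1 M := IsManifold.of_le (n := ∞) (by simp)
  have := mfderiv_extChartAt_comp_mfderivWithin_extChartAt_symm (I := 𝓡 3) (x := x₀) hy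
  simp only [modelWithCornersSelf_coe, range_id, mfderivWithin_univ] at this
  exact congr($this v)

omit [IsManifold (𝓡 3) ∞ M] in
theorem form_congr_point {k : ℕ} (η : DiffForm M k) {p q : M} (h : p = q) (v : Fin k → E3) :
    (η p : E3 [⋀^Fin k]→L[ℝ] ℝ) v = (η q : E3 [⋀^Fin k]→L[ℝ] ℝ) v := by
  rw [h]

theorem inChart_dChart {k : ℕ} (η : DiffForm M k) (x₀ : M) {q : M}
    (hq : q ∈ (extChartAt (𝓡 3) x₀).source) (u : Fin k → TangentSpace (𝓡 3) q) :
    inChart η x₀ (extChartAt (𝓡 3) x₀ q) (fun i ↦ dChart x₀ q (u i)) = η q u := by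
  rw [inChart_apply]
  have h := (extChartAt (𝓡 3) x₀).left_inv hq
  refine Eq.trans (congrArg (η _) (funext fun i ↦ dSymm_dChart x₀ hq (u i))) ?_
  exact form_congr_point η h u

omit [IsManifold (𝓡 3) ∞ M] in
theorem chart_target_mem_nhds (x₀ : M) {y : E3} (hy : y ∈ (extChartAt (𝓡 3) x₀).target) :
    (extChartAt (𝓡 3) x₀).target ∈ 𝓝 y := (isOpen_extChartAt_target x₀).mem_nhds hy

theorem mdifferentiableAt_chart_symm (x₀ : M) {y : E3} (hy : y ∈ (extChartAt (𝓡 3) x₀).target) :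
    MDifferentiableAt 𝓘(ℝ, E3) (𝓡 3) (extChartAt (𝓡 3) x₀).symm y :=
  ((contMDiffOn_extChartAt_symm (n := ∞) x₀).contMDiffAt
    (chart_target_mem_nhds x₀ hy)).mdifferentiableAt (by simp)

theorem mdifferentiableAt_chart (x₀ : M) {q : M} (hq : q ∈ (extChartAt (𝓡 3) x₀).source) :
    MDifferentiableAt (𝓡 3) 𝓘(ℝ, E3) (extChartAt (𝓡 3) x₀) q :=
  (contMDiffAt_extChartAt' (n := ∞) (by simpa using hq)).mdifferentiableAt (by simp)

/-- The change of charts. -/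
def transition (x₀ x₁ : M) (y : E3) : E3 := extChartAt (𝓡 3) x₁ ((extChartAt (𝓡 3) x₀).symm y)

theorem contDiffAt_transition (x₀ x₁ : M) {y : E3} (hy : y ∈ (extChartAt (𝓡 3) x₀).target)
    (hy' : (extChartAt (𝓡 3) x₀).symm y ∈ (extChartAt (𝓡 3) x₁).source) :
    ContDiffAt ℝ ∞ (transition x₀ x₁) y := by
  have h1 := (contMDiffOn_extChartAt_symm (I := 𝓡 3) (n := ∞) x₀).contMDiffAt
    (chart_target_mem_nhds x₀ hy)
  have h2 := contMDiffAt_extChartAt' (I := 𝓡 3) (n := ∞) (x := x₁) (by simpa using hy')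
  exact (h2.comp y h1).contDiffAt

theorem fderiv_transition (x₀ x₁ : M) {y : E3} (hy : y ∈ (extChartAt (𝓡 3) x₀).target)
    (hy' : (extChartAt (𝓡 3) x₀).symm y ∈ (extChartAt (𝓡 3) x₁).source) (v : E3) :
    fderiv ℝ (transition x₀ x₁) y v =
      dChart x₁ ((extChartAt (𝓡 3) x₀).symm y) (dSymm x₀ y v) := by
  have := mfderiv_comp y (mdifferentiableAt_chart x₁ hy') (mdifferentiableAt_chart_symm x₀ hy)
  rw [← mfderiv_eq_fderiv]
  exact congr($this v)

theorem inChart_transition {k : ℕ} (η : DiffForm M k) (x₀ x₁ : M) {y : E3}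
    (hy : y ∈ (extChartAt (𝓡 3) x₀).target)
    (hy' : (extChartAt (𝓡 3) x₀).symm y ∈ (extChartAt (𝓡 3) x₁).source) :
    inChart η x₀ y = (inChart η x₁ (transition x₀ x₁ y)).compContinuousLinearMap
      (fderiv ℝ (transition x₀ x₁) y) := by
  ext v
  rw [inChart_apply, ← inChart_dChart η x₁ hy']
  simp only [ContinuousAlternatingMap.compContinuousLinearMap_apply]
  congr 1
  ext1 i
  exact (fderiv_transition x₀ x₁ hy hy' (v i)).symm

theorem overlap_mem_nhds (x₀ x₁ : M) {y : E3} (hy : y ∈ (extChartAt (𝓡 3) x₀).target)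
    (hy' : (extChartAt (𝓡 3) x₀).symm y ∈ (extChartAt (𝓡 3) x₁).source) :
    ∀ᶠ z in 𝓝 y, z ∈ (extChartAt (𝓡 3) x₀).target ∧
      (extChartAt (𝓡 3) x₀).symm z ∈ (extChartAt (𝓡 3) x₁).source := by
  refine Filter.Eventually.and (chart_target_mem_nhds x₀ hy) ?_
  exact (mdifferentiableAt_chart_symm x₀ hy).continuousAt
    ((isOpen_extChartAt_source x₁).mem_nhds hy')

omit [IsManifold (𝓡 3) ∞ M] in
theorem IsSmoothForm.contDiffAt {k : ℕ} {η : DiffForm M k} (h : IsSmoothForm η) (x₀ : M) {y : E3}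
    (hy : y ∈ (extChartAt (𝓡 3) x₀).target) : ContDiffAt ℝ ∞ (inChart η x₀) y :=
  (h x₀).contDiffAt (chart_target_mem_nhds x₀ hy)

/-- The exterior derivative can be computed in any chart. -/
theorem inChart_extD {k : ℕ} {η : DiffForm M k} (h : IsSmoothForm η) (x₀ : M) {y : E3}
    (hy : y ∈ (extChartAt (𝓡 3) x₀).target) :
    inChart (extD η) x₀ y = extDeriv (inChart η x₀) y := by
  set p := (extChartAt (𝓡 3) x₀).symm y with hp
  have hy' : p ∈ (extChartAt (𝓡 3) p).source := mem_extChartAt_source p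
  have hev : inChart η x₀ =ᶠ[𝓝 y] fun z ↦ (inChart η p (transition x₀ p z)).compContinuousLinearMap
      (fderiv ℝ (transition x₀ p) z) := by
    filter_upwards [overlap_mem_nhds x₀ p hy hy'] with z hz
    exact inChart_transition η x₀ p hz.1 hz.2
  rw [hev.extDeriv_eq, extDeriv_pullback (r := ∞) _ (contDiffAt_transition x₀ p hy hy')
    (by simpa using ENat.LEInfty.out)]
  · ext v
    rw [inChart_apply, extD_apply]
    simp only [ContinuousAlternatingMap.compContinuousLinearMap_apply]
    congr 1
    ext1 i
    exact (fderiv_transition x₀ p hy hy' (v i)).symm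
  · exact (h.contDiffAt p ((extChartAt (𝓡 3) p).map_source hy')).differentiableAt (by simp)

end

section
variable {M : Type*} [TopologicalSpace M] [ChartedSpace E3 M]

theorem isSmoothForm_iff {k : ℕ} {η : DiffForm M k} : IsSmoothForm η ↔
    ∀ x₀ : M, ∀ v : Fin k → E3,
      ContDiffOn ℝ ∞ (fun y ↦ inChart η x₀ y v) (extChartAt (𝓡 3) x₀).target :=
  forall_congr' fun _ ↦ contDiffOn_form_iff

theorem IsSmoothForm.apply {k : ℕ} {η : DiffForm M k} (h : IsSmoothForm η) (x₀ : M)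
    (v : Fin k → E3) :
    ContDiffOn ℝ ∞ (fun y ↦ inChart η x₀ y v) (extChartAt (𝓡 3) x₀).target :=
  isSmoothForm_iff.1 h x₀ v

theorem IsSmoothForm.differentiableAt_apply {k : ℕ} {η : DiffForm M k} (h : IsSmoothForm η)
    {x₀ : M} {y : E3} (hy : y ∈ (extChartAt (𝓡 3) x₀).target) (v : Fin k → E3) :
    DifferentiableAt ℝ (fun y ↦ inChart η x₀ y v) y :=
  ((h.apply x₀ v).contDiffAt (chart_target_mem_nhds x₀ hy)).differentiableAt (by simp)

theorem IsSmoothForm.differentiableAt {k : ℕ} {η : DiffForm M k} (h : IsSmoothForm η)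
    {x₀ : M} {y : E3} (hy : y ∈ (extChartAt (𝓡 3) x₀).target) :
    DifferentiableAt ℝ (inChart η x₀) y :=
  (h.contDiffAt x₀ hy).differentiableAt (by simp)

theorem IsSmoothForm.add {k : ℕ} {η ζ : DiffForm M k} (h : IsSmoothForm η) (h' : IsSmoothForm ζ) :
    IsSmoothForm (η + ζ) := fun x₀ ↦ (h x₀).add (h' x₀)

theorem IsSmoothForm.neg {k : ℕ} {η : DiffForm M k} (h : IsSmoothForm η) :
    IsSmoothForm (-η) := fun x₀ ↦ (h x₀).neg

theorem IsSmoothForm.sub {k : ℕ} {η ζ : DiffForm M k} (h : IsSmoothForm η) (h' : IsSmoothForm ζ) :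
    IsSmoothForm (η - ζ) := fun x₀ ↦ (h x₀).sub (h' x₀)

theorem IsSmoothForm.const_smul {k : ℕ} {η : DiffForm M k} (h : IsSmoothForm η) (c : ℝ) :
    IsSmoothForm (c • η) := fun x₀ ↦ (h x₀).const_smul c

theorem IsSmoothForm.zero {k : ℕ} : IsSmoothForm (0 : DiffForm M k) :=
  fun _ ↦ (contDiffOn_const (c := 0))

theorem IsSmoothForm.sum {k : ℕ} {ι : Type*} (s : Finset ι) {η : ι → DiffForm M k}
    (h : ∀ i ∈ s, IsSmoothForm (η i)) : IsSmoothForm (∑ i ∈ s, η i) := by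
  classical
  induction s using Finset.induction_on with
  | empty => simpa using IsSmoothForm.zero
  | insert a s ha ih =>
    rw [Finset.sum_insert ha]
    exact (h a (by simp)).add (ih fun i hi ↦ h i (by simp [hi]))

theorem inChart_wedge_apply {k : ℕ} (α : DiffForm M 1) (β : DiffForm M k) (x₀ : M) (y : E3)
    (v : Fin (k + 1) → E3) :
    inChart (wedge α β) x₀ y v = ∑ i : Fin (k + 1), (-1 : ℝ) ^ (i : ℕ) *
      (inChart α x₀ y (fun _ ↦ v i) * inChart β x₀ y (i.removeNth v)) := by
  rw [inChart_apply, wedge_apply]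
  rfl

theorem IsSmoothForm.wedge {k : ℕ} {α : DiffForm M 1} {β : DiffForm M k} (h : IsSmoothForm α)
    (h' : IsSmoothForm β) : IsSmoothForm (wedge α β) := by
  refine isSmoothForm_iff.2 fun x₀ v ↦ ?_
  simp only [inChart_wedge_apply]
  exact ContDiffOn.sum fun i _ ↦ contDiffOn_const.mul ((h.apply x₀ _).mul (h'.apply x₀ _))

/-- Smooth functions. -/
abbrev SmoothFun (h : M → ℝ) : Prop := ContMDiff (𝓡 3) 𝓘(ℝ, ℝ) ∞ h

end
section
variable {M : Type*} [TopologicalSpace M] [ChartedSpace E3 M] [IsManifold (𝓡 3) ∞ M]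

theorem SmoothFun.contDiffOn {h : M → ℝ} (hh : SmoothFun h) (x₀ : M) :
    ContDiffOn ℝ ∞ (fun y ↦ h ((extChartAt (𝓡 3) x₀).symm y)) (extChartAt (𝓡 3) x₀).target :=
  (hh.comp_contMDiffOn (contMDiffOn_extChartAt_symm x₀)).contDiffOn

theorem SmoothFun.differentiableAt {h : M → ℝ} (hh : SmoothFun h) {x₀ : M} {y : E3}
    (hy : y ∈ (extChartAt (𝓡 3) x₀).target) :
    DifferentiableAt ℝ (fun y ↦ h ((extChartAt (𝓡 3) x₀).symm y)) y :=
  ((SmoothFun.contDiffOn hh x₀).contDiffAt (chart_target_mem_nhds x₀ hy)).differentiableAt (by simp)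

theorem IsSmoothForm.fsmul {k : ℕ} {η : DiffForm M k} {f : M → ℝ} (hf : SmoothFun f)
    (h : IsSmoothForm η) : IsSmoothForm (fsmul f η) := fun x₀ ↦
  (SmoothFun.contDiffOn hf x₀).smul (h x₀)

/-- The differential of a function. -/
def dfun (h : M → ℝ) : DiffForm M 1 := oneForm fun x ↦ mvfderiv (𝓡 3) h x

omit [IsManifold (𝓡 3) ∞ M] in
theorem oneForm_apply (α : ∀ x : M, TangentSpace (𝓡 3) x →L[ℝ] ℝ) (x : M)
    (v : Fin 1 → TangentSpace (𝓡 3) x) : oneForm α x v = α x (v 0) := rfl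

theorem inChart_dfun {h : M → ℝ} (hh : SmoothFun h) {x₀ : M} {y : E3}
    (hy : y ∈ (extChartAt (𝓡 3) x₀).target) (v : Fin 1 → E3) :
    inChart (dfun h) x₀ y v = fderiv ℝ (fun y ↦ h ((extChartAt (𝓡 3) x₀).symm y)) y (v 0) := by
  rw [inChart_apply, dfun, oneForm_apply]
  have := mfderiv_comp y (hh.mdifferentiableAt (by simp)) (mdifferentiableAt_chart_symm x₀ hy)
  rw [← mfderiv_eq_fderiv]
  exact congr($this (v 0)).symm

theorem IsSmoothForm.dfun {h : M → ℝ} (hh : SmoothFun h) : IsSmoothForm (dfun h) := by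
  refine isSmoothForm_iff.2 fun x₀ v ↦ ?_
  refine ContDiffOn.congr (f := fun y ↦
    fderiv ℝ (fun y ↦ h ((extChartAt (𝓡 3) x₀).symm y)) y (v 0)) ?_ fun y hy ↦ inChart_dfun hh hy v
  exact ((SmoothFun.contDiffOn hh x₀).fderiv_of_isOpen (isOpen_extChartAt_target x₀)
    (by simp)).clm_apply contDiffOn_const

theorem IsSmoothForm.extD {k : ℕ} {η : DiffForm M k} (h : IsSmoothForm η) :
    IsSmoothForm (extD η) := by
  refine isSmoothForm_iff.2 fun x₀ v ↦ ?_
  refine ContDiffOn.congr (f := fun y ↦ ∑ i : Fin (k + 1), (-1 : ℤ) ^ (i : ℕ) •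
    fderiv ℝ (fun y ↦ inChart η x₀ y (i.removeNth v)) y (v i)) ?_ fun y hy ↦ ?_
  · refine ContDiffOn.sum fun i _ ↦ ContDiffOn.const_smul _ ?_
    exact ((h.apply x₀ _).fderiv_of_isOpen (isOpen_extChartAt_target x₀)
      (by simp)).clm_apply contDiffOn_const
  · rw [inChart_extD h x₀ hy, extDeriv_apply (h.differentiableAt hy)]

/-- Two forms agree if they do in the charts. -/
theorem form_ext {k : ℕ} {η ζ : DiffForm M k}
    (h : ∀ x₀ : M, ∀ y ∈ (extChartAt (𝓡 3) x₀).target, ∀ v, inChart η x₀ y v = inChart ζ x₀ y v) :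
    η = ζ := by
  funext x
  ext v
  rw [← inChart_dChart η x (mem_extChartAt_source x), ← inChart_dChart ζ x (mem_extChartAt_source x)]
  exact h x _ (mem_extChartAt_target x) _

theorem extD_add {k : ℕ} {η ζ : DiffForm M k} (h : IsSmoothForm η) (h' : IsSmoothForm ζ) :
    extD (η + ζ) = extD η + extD ζ := by
  refine form_ext fun x₀ y hy v ↦ ?_
  rw [inChart_extD (h.add h') x₀ hy, inChart_add, inChart_add,
    extDeriv_add (h.differentiableAt hy) (h'.differentiableAt hy), Pi.add_apply,
    inChart_extD h x₀ hy, inChart_extD h' x₀ hy]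

theorem extD_const_smul {k : ℕ} {η : DiffForm M k} (h : IsSmoothForm η) (c : ℝ) :
    extD (c • η) = c • extD η := by
  refine form_ext fun x₀ y hy v ↦ ?_
  have h1 (ζ : DiffForm M k) : inChart (c • ζ) x₀ = c • inChart ζ x₀ := rfl
  have h2 (ζ : DiffForm M (k + 1)) : inChart (c • ζ) x₀ = c • inChart ζ x₀ := rfl
  rw [inChart_extD (h.const_smul c) x₀ hy, h1, h2, extDeriv_smul, Pi.smul_apply,
    inChart_extD h x₀ hy]

theorem extD_neg {k : ℕ} {η : DiffForm M k} (h : IsSmoothForm η) :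
    extD (-η) = - extD η := by
  have e {k : ℕ} (ζ : DiffForm M k) : -ζ = (-1 : ℝ) • ζ := by
    funext x
    ext v
    exact (neg_one_mul _).symm
  rw [e, e, extD_const_smul h]

theorem extD_sub {k : ℕ} {η ζ : DiffForm M k} (h : IsSmoothForm η) (h' : IsSmoothForm ζ) :
    extD (η - ζ) = extD η - extD ζ := by
  rw [sub_eq_add_neg, extD_add h h'.neg, extD_neg h', sub_eq_add_neg]

theorem extD_zero {k : ℕ} : extD (0 : DiffForm M k) = 0 := by
  have := extD_const_smul (IsSmoothForm.zero (M := M) (k := k)) 0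
  simpa using this

theorem extD_sum {k : ℕ} {ι : Type*} (s : Finset ι) {η : ι → DiffForm M k}
    (h : ∀ i ∈ s, IsSmoothForm (η i)) : extD (∑ i ∈ s, η i) = ∑ i ∈ s, extD (η i) := by
  classical
  induction s using Finset.induction_on with
  | empty => simpa using extD_zero
  | insert a s ha ih =>
    rw [Finset.sum_insert ha, Finset.sum_insert ha, extD_add (h a (by simp))
      (IsSmoothForm.sum s fun i hi ↦ h i (by simp [hi])), ih fun i hi ↦ h i (by simp [hi])]

theorem extD_extD {k : ℕ} {η : DiffForm M k} (h : IsSmoothForm η) : extD (extD η) = 0 := by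
  refine form_ext fun x₀ y hy v ↦ ?_
  rw [inChart_extD h.extD x₀ hy]
  have : inChart (extD η) x₀ =ᶠ[𝓝 y] extDeriv (inChart η x₀) := by
    filter_upwards [chart_target_mem_nhds x₀ hy] with z hz
    exact inChart_extD h x₀ hz
  rw [this.extDeriv_eq, extDeriv_extDeriv_apply (h.contDiffAt x₀ hy)
    (by simpa using ENat.LEInfty.out)]
  rfl

theorem extD_dfun {h : M → ℝ} (hh : SmoothFun h) : extD (dfun h) = 0 := by
  refine form_ext fun x₀ y hy v ↦ ?_
  rw [inChart_extD (IsSmoothForm.dfun hh) x₀ hy]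
  have : inChart (dfun h) x₀ =ᶠ[𝓝 y] extDeriv fun y ↦
      ContinuousAlternatingMap.constOfIsEmpty ℝ E3 (Fin 0) (h ((extChartAt (𝓡 3) x₀).symm y)) := by
    filter_upwards [chart_target_mem_nhds x₀ hy] with z hz
    rw [extDeriv_constOfIsEmpty]
    ext v
    exact inChart_dfun hh hz v
  have hs : ContDiffAt ℝ ∞ (fun y ↦
      ContinuousAlternatingMap.constOfIsEmpty ℝ E3 (Fin 0) (h ((extChartAt (𝓡 3) x₀).symm y))) y :=
    (contDiffOn_form_iff.2 fun _ ↦ SmoothFun.contDiffOn hh x₀).contDiffAt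
      (chart_target_mem_nhds x₀ hy)
  rw [this.extDeriv_eq, extDeriv_extDeriv_apply hs (by simpa using ENat.LEInfty.out)]
  rfl

theorem extD_fsmul {k : ℕ} {η : DiffForm M k} {f : M → ℝ} (hf : SmoothFun f)
    (h : IsSmoothForm η) : extD (fsmul f η) = wedge (dfun f) η + fsmul f (extD η) := by
  refine form_ext fun x₀ y hy v ↦ ?_
  rw [inChart_extD (h.fsmul hf) x₀ hy, extDeriv_apply ((h.fsmul hf).differentiableAt hy),
    inChart_add, Pi.add_apply, ContinuousAlternatingMap.add_apply, inChart_wedge_apply,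
    inChart_fsmul]
  simp only [inChart_fsmul, ContinuousAlternatingMap.smul_apply]
  rw [inChart_extD h x₀ hy, extDeriv_apply (h.differentiableAt hy), Finset.smul_sum,
    ← Finset.sum_add_distrib]
  refine Finset.sum_congr rfl fun i _ ↦ ?_
  simp only [smul_eq_mul]
  rw [fderiv_fun_mul (SmoothFun.differentiableAt hf hy) (h.differentiableAt_apply hy _),
    inChart_dfun hf hy]
  simp only [add_apply, smul_apply, smul_eq_mul,
    zsmul_eq_mul]
  push_cast
  ring

theorem extDeriv_one_apply {η : E3 → E3 [⋀^Fin 1]→L[ℝ] ℝ} {y : E3} (h : DifferentiableAt ℝ η y)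
    (a b : E3) : extDeriv η y ![a, b] =
      fderiv ℝ (fun z ↦ η z ![b]) y a - fderiv ℝ (fun z ↦ η z ![a]) y b := by
  rw [extDeriv_apply h, Fin.sum_univ_two]
  have h0 : Fin.removeNth 0 ![a, b] = ![b] := by ext i; fin_cases i; rfl
  have h1 : Fin.removeNth 1 ![a, b] = ![a] := by ext i; fin_cases i; rfl
  rw [h0, h1]
  simp
  ring

theorem extDeriv_two_apply {η : E3 → E3 [⋀^Fin 2]→L[ℝ] ℝ} {y : E3} (h : DifferentiableAt ℝ η y)
    (a b c : E3) : extDeriv η y ![a, b, c] =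
      fderiv ℝ (fun z ↦ η z ![b, c]) y a - fderiv ℝ (fun z ↦ η z ![a, c]) y b
        + fderiv ℝ (fun z ↦ η z ![a, b]) y c := by
  rw [extDeriv_apply h, Fin.sum_univ_three]
  have h0 : Fin.removeNth 0 ![a, b, c] = ![b, c] := by ext1 i; fin_cases i <;> rfl
  have h1 : Fin.removeNth 1 ![a, b, c] = ![a, c] := by ext1 i; fin_cases i <;> rfl
  have h2 : Fin.removeNth 2 ![a, b, c] = ![a, b] := by ext1 i; fin_cases i <;> rfl
  rw [h0, h1, h2]
  simp
  ring

omit [IsManifold (𝓡 3) ∞ M] in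
theorem inChart_wedge_one_one (α β : DiffForm M 1) (x₀ : M) (y u v : E3) :
    inChart (wedge α β) x₀ y ![u, v] = inChart α x₀ y ![u] * inChart β x₀ y ![v]
      - inChart α x₀ y ![v] * inChart β x₀ y ![u] := by
  have h1 (a : E3) : (fun i ↦ dSymm x₀ y (![a] i)) = ![dSymm x₀ y a] := by
    ext1 i; fin_cases i; rfl
  have h2 : (fun i ↦ dSymm x₀ y (![u, v] i)) = ![dSymm x₀ y u, dSymm x₀ y v] := by
    ext1 i; fin_cases i <;> rfl
  simp only [inChart_apply, h1, h2, wedge_one_one]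

omit [IsManifold (𝓡 3) ∞ M] in
theorem inChart_wedge_one_two (α : DiffForm M 1) (β : DiffForm M 2) (x₀ : M) (y u v w : E3) :
    inChart (wedge α β) x₀ y ![u, v, w] = inChart α x₀ y ![u] * inChart β x₀ y ![v, w]
      - inChart α x₀ y ![v] * inChart β x₀ y ![u, w]
      + inChart α x₀ y ![w] * inChart β x₀ y ![u, v] := by
  have h1 (a : E3) : (fun i ↦ dSymm x₀ y (![a] i)) = ![dSymm x₀ y a] := by
    ext1 i; fin_cases i; rfl
  have h2 (u v : E3) : (fun i ↦ dSymm x₀ y (![u, v] i)) = ![dSymm x₀ y u, dSymm x₀ y v] := by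
    ext1 i; fin_cases i <;> rfl
  have h3 : (fun i ↦ dSymm x₀ y (![u, v, w] i)) =
      ![dSymm x₀ y u, dSymm x₀ y v, dSymm x₀ y w] := by
    ext1 i; fin_cases i <;> rfl
  simp only [inChart_apply, h1, h2, h3, wedge_one_two]

theorem extD_wedge {α β : DiffForm M 1} (h : IsSmoothForm α) (h' : IsSmoothForm β) :
    extD (wedge α β) = wedge β (extD α) - wedge α (extD β) := by
  refine form_ext fun x₀ y hy v ↦ ?_
  have e : inChart (wedge β (extD α) - wedge α (extD β)) x₀ =
    inChart (wedge β (extD α)) x₀ - inChart (wedge α (extD β)) x₀ := rfl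
  obtain ⟨a, b, c, rfl⟩ : ∃ a b c, v = ![a, b, c] :=
    ⟨v 0, v 1, v 2, by ext1 i; fin_cases i <;> rfl⟩
  rw [inChart_extD (h.wedge h') x₀ hy, extDeriv_two_apply ((h.wedge h').differentiableAt hy), e,
    Pi.sub_apply, ContinuousAlternatingMap.sub_apply, inChart_wedge_one_two, inChart_wedge_one_two]
  simp only [inChart_wedge_one_one, inChart_extD h x₀ hy, inChart_extD h' x₀ hy,
    extDeriv_one_apply (h.differentiableAt hy), extDeriv_one_apply (h'.differentiableAt hy)]
  have d1 (u : Fin 1 → E3) := h.differentiableAt_apply hy u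
  have d2 (u : Fin 1 → E3) := h'.differentiableAt_apply hy u
  have key (a b c : E3) : fderiv ℝ (fun z ↦ inChart α x₀ z ![a] * inChart β x₀ z ![b]
      - inChart α x₀ z ![b] * inChart β x₀ z ![a]) y c =
      inChart α x₀ y ![a] * fderiv ℝ (fun z ↦ inChart β x₀ z ![b]) y c
      + inChart β x₀ y ![b] * fderiv ℝ (fun z ↦ inChart α x₀ z ![a]) y c
      - inChart α x₀ y ![b] * fderiv ℝ (fun z ↦ inChart β x₀ z ![a]) y c
      - inChart β x₀ y ![a] * fderiv ℝ (fun z ↦ inChart α x₀ z ![b]) y c := by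
    rw [fderiv_fun_sub ((d1 _).fun_mul (d2 _)) ((d1 _).fun_mul (d2 _)),
      fderiv_fun_mul (d1 _) (d2 _), fderiv_fun_mul (d1 _) (d2 _)]
    simp
    ring
  rw [key, key, key]
  ring

end

/-- The standard basis of Euclidean `3`-space. -/
abbrev stdB (i : Fin 3) : E3 := EuclideanSpace.single i (1 : ℝ)

theorem alternating_comp_stdB (f : E3 [⋀^Fin 3]→ₗ[ℝ] ℝ) (A : E3 →ₗ[ℝ] E3) :
    f (fun i ↦ A (stdB i)) = LinearMap.det A * f stdB := by
  set e := (EuclideanSpace.basisFun (Fin 3) ℝ).toBasis with he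
  have hb : (e : Fin 3 → E3) = stdB := by ext1 i; simp [he]
  have h1 := f.eq_smul_basis_det e
  have h2 : f (A ∘ e) = LinearMap.det A * f e := by
    rw [h1, AlternatingMap.smul_apply, AlternatingMap.smul_apply, e.det_comp, e.det_self]
    simp [mul_comm]
  rw [hb] at h2
  exact h2

theorem integrableOn_of_compact_zero {F : E3 → ℝ} {T K : Set E3}
    (hT : IsOpen T) (hF : ContinuousOn F T) (hK : IsCompact K) (hKT : K ⊆ T) (h0 : ∀ y ∈ T, y ∉ K → F y = 0) :
    IntegrableOn F T :=
  ((hF.mono hKT).integrableOn_compact hK).of_forall_sdiff_eq_zero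
    hT.measurableSet fun y hy ↦ h0 y hy.1 hy.2

theorem integral_fderiv_apply_eq_zero {F : E3 → ℝ} (hF : ContDiff ℝ 1 F) (hc : HasCompactSupport F)
    (v : E3) : ∫ y, fderiv ℝ F y v = 0 := by
  have hi : Integrable F := hF.continuous.integrable_of_hasCompactSupport hc
  have hi' : Integrable (fun y ↦ fderiv ℝ F y v) := by
    refine Continuous.integrable_of_hasCompactSupport ?_ ?_
    · exact (hF.continuous_fderiv (by simp)).clm_apply continuous_const
    · exact hc.fderiv_apply (𝕜 := ℝ) v
  have := integral_mul_fderiv_eq_neg_fderiv_mul_of_integrable (μ := volume)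
    (f := fun _ : E3 ↦ (1 : ℝ)) (g := F) (v := v) (by simp) (by simpa using hi')
    (by simpa using hi) (by simp) (fun x _ ↦ (hF.differentiable (by simp)) x)
  simpa using this

section
variable {M : Type*} [TopologicalSpace M] [ChartedSpace E3 M]

/-- The density of a `3`-form in the preferred chart at `x₀`. -/
def density (o : MOrientation M) (η : DiffForm M 3) (x₀ : M) (y : E3) : ℝ :=
  coordSign o.orient x₀ y * inChart η x₀ y stdB

/-- The orientation, as a field of alternating forms. -/
def orientVec (o : MOrientation M) (x : M) : E3 [⋀^Fin 3]→ₗ[ℝ] ℝ := (o.orient x).someVector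

theorem coordSign_eq (o : MOrientation M) (x₀ : M) (y : E3) :
    coordSign o.orient x₀ y = SignType.sign (orientVec o ((extChartAt (𝓡 3) x₀).symm y)
      (fun i ↦ dSymm x₀ y (stdB i))) := rfl

end

section
variable {M : Type*} [TopologicalSpace M] [ChartedSpace E3 M] [IsManifold (𝓡 3) ∞ M]

theorem dSymm_transition (x₀ x₁ : M) {y : E3} (hy : y ∈ (extChartAt (𝓡 3) x₀).target)
    (hy' : (extChartAt (𝓡 3) x₀).symm y ∈ (extChartAt (𝓡 3) x₁).source) (v : E3) :
    (dSymm x₀ y v : E3) = (dSymm x₁ (transition x₀ x₁ y) (fderiv ℝ (transition x₀ x₁) y v) : E3) := by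
  rw [fderiv_transition x₀ x₁ hy hy']
  exact (dSymm_dChart x₁ hy' _).symm

theorem symm_transition (x₀ x₁ : M) {y : E3}
    (hy' : (extChartAt (𝓡 3) x₀).symm y ∈ (extChartAt (𝓡 3) x₁).source) :
    (extChartAt (𝓡 3) x₁).symm (transition x₀ x₁ y) = (extChartAt (𝓡 3) x₀).symm y :=
  (extChartAt (𝓡 3) x₁).left_inv hy'

theorem alternating_transition (w : M → E3 [⋀^Fin 3]→ₗ[ℝ] ℝ) (x₀ x₁ : M) {y : E3}
    (hy : y ∈ (extChartAt (𝓡 3) x₀).target)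
    (hy' : (extChartAt (𝓡 3) x₀).symm y ∈ (extChartAt (𝓡 3) x₁).source) :
    w ((extChartAt (𝓡 3) x₀).symm y) (fun i ↦ dSymm x₀ y (stdB i)) =
      (fderiv ℝ (transition x₀ x₁) y).det *
        w ((extChartAt (𝓡 3) x₁).symm (transition x₀ x₁ y))
          (fun i ↦ dSymm x₁ (transition x₀ x₁ y) (stdB i)) := by
  rw [symm_transition x₀ x₁ hy']
  have := alternating_comp_stdB ((w ((extChartAt (𝓡 3) x₀).symm y)).compLinearMap
    (show E3 →ₗ[ℝ] E3 from (dSymm x₁ (transition x₀ x₁ y)).toLinearMap))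
    (fderiv ℝ (transition x₀ x₁) y).toLinearMap
  refine Eq.trans ?_ this
  exact congrArg (w _) (funext fun i ↦ dSymm_transition x₀ x₁ hy hy' (stdB i))

theorem inChart_stdB_transition (η : DiffForm M 3) (x₀ x₁ : M) {y : E3}
    (hy : y ∈ (extChartAt (𝓡 3) x₀).target)
    (hy' : (extChartAt (𝓡 3) x₀).symm y ∈ (extChartAt (𝓡 3) x₁).source) :
    inChart η x₀ y stdB = (fderiv ℝ (transition x₀ x₁) y).det *
      inChart η x₁ (transition x₀ x₁ y) stdB :=
  alternating_transition
    (fun x ↦ (show E3 [⋀^Fin 3]→L[ℝ] ℝ from η x).toAlternatingMap) x₀ x₁ hy hy'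

theorem coordSign_transition (o : MOrientation M) (x₀ x₁ : M) {y : E3}
    (hy : y ∈ (extChartAt (𝓡 3) x₀).target)
    (hy' : (extChartAt (𝓡 3) x₀).symm y ∈ (extChartAt (𝓡 3) x₁).source) :
    coordSign o.orient x₀ y = SignType.sign (fderiv ℝ (transition x₀ x₁) y).det *
      coordSign o.orient x₁ (transition x₀ x₁ y) := by
  rw [coordSign_eq, alternating_transition (orientVec o) x₀ x₁ hy hy', sign_mul, coordSign_eq]
  simp

theorem density_transition (o : MOrientation M) (η : DiffForm M 3) (x₀ x₁ : M) {y : E3}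
    (hy : y ∈ (extChartAt (𝓡 3) x₀).target)
    (hy' : (extChartAt (𝓡 3) x₀).symm y ∈ (extChartAt (𝓡 3) x₁).source) :
    density o η x₀ y = |(fderiv ℝ (transition x₀ x₁) y).det| *
      density o η x₁ (transition x₀ x₁ y) := by
  rw [density, density, coordSign_transition o x₀ x₁ hy hy', inChart_stdB_transition η x₀ x₁ hy hy',
    ← sign_mul_self (fderiv ℝ (transition x₀ x₁) y).det]
  ring

theorem coordSign_mul_self (o : MOrientation M) (x₀ : M) {y : E3}
    (hy : y ∈ (extChartAt (𝓡 3) x₀).target) :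
    coordSign o.orient x₀ y = 1 ∨ coordSign o.orient x₀ y = -1 := by
  have hne : orientVec o ((extChartAt (𝓡 3) x₀).symm y) (fun i ↦ dSymm x₀ y (stdB i)) ≠ 0 := by
    intro h0
    have hw : orientVec o ((extChartAt (𝓡 3) x₀).symm y) ≠ 0 := (o.orient _).someVector_ne_zero
    apply hw
    set p := (extChartAt (𝓡 3) x₀).symm y with hp
    let A : E3 →ₗ[ℝ] E3 := (show E3 →L[ℝ] E3 from dSymm x₀ y).toLinearMap
    let B : E3 →ₗ[ℝ] E3 := (show E3 →L[ℝ] E3 from dChart x₀ p).toLinearMap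
    have hBA : B ∘ₗ A = LinearMap.id := LinearMap.ext fun v ↦ dChart_dSymm x₀ hy v
    have hAB : A ∘ₗ B = LinearMap.id := (LinearMap.comp_eq_id_comm _ _).1 hBA
    have h1 := alternating_comp_stdB ((orientVec o p).compLinearMap A) B
    have h2 : ((orientVec o p).compLinearMap A) stdB = 0 := h0
    rw [h2, mul_zero] at h1
    have h3 : orientVec o p stdB = 0 := by
      refine Eq.trans ?_ h1
      exact congrArg (orientVec o p) (funext fun i ↦ (LinearMap.congr_fun hAB (stdB i)).symm)
    have h4 := (orientVec o p).eq_smul_basis_det (EuclideanSpace.basisFun (Fin 3) ℝ).toBasis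
    have hb : ((EuclideanSpace.basisFun (Fin 3) ℝ).toBasis : Fin 3 → E3) = stdB := by
      ext1 i; simp
    rw [hb, h3, zero_smul] at h4
    exact h4
  rw [coordSign_eq]
  rcases lt_or_gt_of_ne hne with h | h
  · right; rw [sign_neg h]; simp
  · left; rw [sign_pos h]; simp

theorem coordSign_eventually_eq (o : MOrientation M) (x₀ : M) {y : E3}
    (hy : y ∈ (extChartAt (𝓡 3) x₀).target) :
    ∀ᶠ z in 𝓝 y, coordSign o.orient x₀ z = coordSign o.orient x₀ y := by
  have hc := (o.continuousOn x₀).continuousAt (chart_target_mem_nhds x₀ hy)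
  have := hc.eventually (Metric.ball_mem_nhds (coordSign o.orient x₀ y) one_pos)
  filter_upwards [this, chart_target_mem_nhds x₀ hy] with z hz hz'
  replace hz : dist _ _ < (1 : ℝ) := hz
  rw [Real.dist_eq, abs_lt] at hz
  rcases coordSign_mul_self o x₀ hy with h | h <;> rcases coordSign_mul_self o x₀ hz' with h' | h' <;>
    rw [h, h'] at hz ⊢ <;> norm_num at hz

variable [CompactSpace M] [T2Space M]

theorem tsupport_chartPartition (x₀ : M) :
    tsupport (chartPartition (M := M) x₀) ⊆ (extChartAt (𝓡 3) x₀).source := by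
  rw [extChartAt_source]
  exact (SmoothPartitionOfUnity.exists_isSubordinate_chartAt_source (𝓡 3) M).choose_spec x₀

theorem finite_chartPartition_ne_zero :
    {x₀ : M | ∃ x, chartPartition (M := M) x₀ x ≠ 0}.Finite :=
  (chartPartition (M := M)).locallyFinite.finite_nonempty_of_compact

/-- The indices of the nonzero functions of the partition of unity. -/
def partitionIndices (M : Type*) [TopologicalSpace M] [ChartedSpace E3 M] [IsManifold (𝓡 3) ∞ M]
    [CompactSpace M] [T2Space M] : Finset M := (finite_chartPartition_ne_zero (M := M)).toFinset

theorem chartPartition_eq_zero {x₀ : M} (h : x₀ ∉ partitionIndices M) (x : M) :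
    chartPartition x₀ x = 0 := by
  by_contra h0
  exact h ((finite_chartPartition_ne_zero (M := M)).mem_toFinset.2 ⟨x, h0⟩)

theorem sum_chartPartition (x : M) : ∑ x₀ ∈ partitionIndices M, chartPartition x₀ x = 1 := by
  rw [← (chartPartition (M := M)).sum_eq_one (mem_univ x)]
  refine (finsum_eq_sum_of_support_subset _ fun x₀ hx₀ ↦ ?_).symm
  by_contra h
  exact hx₀ (chartPartition_eq_zero h x)

theorem integrateForm_eq_sum (o : MOrientation M) (η : DiffForm M 3) :
    integrateForm o η = ∑ x₀ ∈ partitionIndices M, ∫ y in (extChartAt (𝓡 3) x₀).target,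
      chartPartition x₀ ((extChartAt (𝓡 3) x₀).symm y) * density o η x₀ y := by
  have h : integrateForm o η = ∑ᶠ x₀ : M, ∫ y in (extChartAt (𝓡 3) x₀).target,
      chartPartition x₀ ((extChartAt (𝓡 3) x₀).symm y) * density o η x₀ y := by
    refine finsum_congr fun x₀ ↦ integral_congr_ae (Filter.Eventually.of_forall fun y ↦ ?_)
    have : density o η x₀ y = coordSign o.orient x₀ y *
      η ((extChartAt (𝓡 3) x₀).symm y) (coordFrame x₀ y) := rfl
    simp only [this]
    ring
  rw [h]
  refine finsum_eq_sum_of_support_subset _ fun x₀ hx₀ ↦ ?_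
  by_contra h
  exact hx₀ (by simp [chartPartition_eq_zero h])

/-- Continuity of a `3`-form. -/
def IsContForm (η : DiffForm M 3) : Prop :=
  ∀ x₀ : M, ContinuousOn (fun y ↦ inChart η x₀ y stdB) (extChartAt (𝓡 3) x₀).target

omit [IsManifold (𝓡 3) ∞ M] [CompactSpace M] [T2Space M] in
theorem IsSmoothForm.isContForm {η : DiffForm M 3} (h : IsSmoothForm η) : IsContForm η :=
  fun x₀ ↦ (h.apply x₀ _).continuousOn

omit [IsManifold (𝓡 3) ∞ M] [CompactSpace M] [T2Space M] in
theorem IsContForm.add {η ζ : DiffForm M 3} (h : IsContForm η) (h' : IsContForm ζ) :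
    IsContForm (η + ζ) := fun x₀ ↦ (h x₀).add (h' x₀)

omit [IsManifold (𝓡 3) ∞ M] [CompactSpace M] [T2Space M] in
theorem continuousOn_comp_symm {f : M → ℝ} (hf : Continuous f) (x₀ : M) :
    ContinuousOn (fun y ↦ f ((extChartAt (𝓡 3) x₀).symm y)) (extChartAt (𝓡 3) x₀).target :=
  hf.comp_continuousOn (continuousOn_extChartAt_symm x₀)

omit [IsManifold (𝓡 3) ∞ M] [CompactSpace M] [T2Space M] in
theorem IsContForm.fsmul {η : DiffForm M 3} {f : M → ℝ} (hf : Continuous f) (h : IsContForm η) :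
    IsContForm (fsmul f η) := fun x₀ ↦ (continuousOn_comp_symm hf x₀).mul (h x₀)

omit [IsManifold (𝓡 3) ∞ M] [CompactSpace M] [T2Space M] in
theorem IsContForm.density {η : DiffForm M 3} (h : IsContForm η) (o : MOrientation M) (x₀ : M) :
    ContinuousOn (density o η x₀) (extChartAt (𝓡 3) x₀).target :=
  (o.continuousOn x₀).mul (h x₀)

/-- A continuous function on a chart domain, vanishing off a compact subset, is integrable
in the chart. -/
theorem integrableOn_chart {F : E3 → ℝ} {x₀ : M} (hF : ContinuousOn F (extChartAt (𝓡 3) x₀).target)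
    {K : Set M} (hK : IsClosed K) (hKs : K ⊆ (extChartAt (𝓡 3) x₀).source)
    (h0 : ∀ y ∈ (extChartAt (𝓡 3) x₀).target, (extChartAt (𝓡 3) x₀).symm y ∉ K → F y = 0) :
    IntegrableOn F (extChartAt (𝓡 3) x₀).target := by
  refine integrableOn_of_compact_zero (isOpen_extChartAt_target x₀) hF (K := extChartAt (𝓡 3) x₀ '' K)
    (hK.isCompact.image_of_continuousOn ((continuousOn_extChartAt x₀).mono hKs)) ?_ ?_
  · rintro _ ⟨x, hx, rfl⟩
    exact (extChartAt (𝓡 3) x₀).map_source (hKs hx)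
  · intro y hy hyK
    refine h0 y hy fun hK' ↦ hyK ⟨_, hK', (extChartAt (𝓡 3) x₀).right_inv hy⟩

theorem integrableOn_partition (o : MOrientation M) {η : DiffForm M 3} (h : IsContForm η) (x₀ : M) :
    IntegrableOn (fun y ↦ chartPartition x₀ ((extChartAt (𝓡 3) x₀).symm y) * density o η x₀ y)
      (extChartAt (𝓡 3) x₀).target := by
  refine integrableOn_chart (K := tsupport (chartPartition (M := M) x₀)) ?_ (isClosed_tsupport _)
    (tsupport_chartPartition x₀) ?_
  · exact (continuousOn_comp_symm (chartPartition x₀).contMDiff.continuous x₀).mul (h.density o x₀)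
  · intro y _ hK
    rw [image_eq_zero_of_notMem_tsupport hK, zero_mul]

theorem integrateForm_add (o : MOrientation M) {η ζ : DiffForm M 3} (h : IsContForm η)
    (h' : IsContForm ζ) : integrateForm o (η + ζ) = integrateForm o η + integrateForm o ζ := by
  simp only [integrateForm_eq_sum, ← Finset.sum_add_distrib]
  refine Finset.sum_congr rfl fun x₀ _ ↦ ?_
  rw [← integral_add (integrableOn_partition o h x₀) (integrableOn_partition o h' x₀)]
  refine integral_congr_ae (Filter.Eventually.of_forall fun y ↦ ?_)
  simp only [density, inChart_add, Pi.add_apply, ContinuousAlternatingMap.add_apply]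
  ring

theorem integrateForm_smul (o : MOrientation M) (c : ℝ) (η : DiffForm M 3) :
    integrateForm o (c • η) = c * integrateForm o η := by
  simp only [integrateForm_eq_sum, Finset.mul_sum]
  refine Finset.sum_congr rfl fun x₀ _ ↦ ?_
  rw [← integral_const_mul]
  refine integral_congr_ae (Filter.Eventually.of_forall fun y ↦ ?_)
  have : inChart (c • η) x₀ y = c • inChart η x₀ y := rfl
  simp only [density, this, ContinuousAlternatingMap.smul_apply, smul_eq_mul]
  ring

omit [IsManifold (𝓡 3) ∞ M] [CompactSpace M] [T2Space M] in
theorem IsContForm.zero : IsContForm (0 : DiffForm M 3) := fun _ ↦ continuousOn_const (c := 0)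

omit [IsManifold (𝓡 3) ∞ M] [CompactSpace M] [T2Space M] in
theorem IsContForm.sum {ι : Type*} (s : Finset ι) {η : ι → DiffForm M 3}
    (h : ∀ i ∈ s, IsContForm (η i)) : IsContForm (∑ i ∈ s, η i) := by
  classical
  induction s using Finset.induction_on with
  | empty => simpa using IsContForm.zero
  | insert a s ha ih =>
    rw [Finset.sum_insert ha]
    exact (h a (by simp)).add (ih fun i hi ↦ h i (by simp [hi]))

theorem integrateForm_sum (o : MOrientation M) {ι : Type*} (s : Finset ι) {η : ι → DiffForm M 3}
    (h : ∀ i ∈ s, IsContForm (η i)) :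
    integrateForm o (∑ i ∈ s, η i) = ∑ i ∈ s, integrateForm o (η i) := by
  classical
  induction s using Finset.induction_on with
  | empty =>
    have := integrateForm_smul o 0 (0 : DiffForm M 3)
    simpa using this
  | insert a s ha ih =>
    rw [Finset.sum_insert ha, Finset.sum_insert ha, integrateForm_add o (h a (by simp))
      (IsContForm.sum s fun i hi ↦ h i (by simp [hi])), ih fun i hi ↦ h i (by simp [hi])]

/-- The integral of a continuous form supported in the domain of a chart. -/
theorem integrateForm_eq_chart (o : MOrientation M) {η : DiffForm M 3} (hη : IsContForm η) (x₁ : M)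
    {K : Set M} (hK : IsClosed K) (hKs : K ⊆ (extChartAt (𝓡 3) x₁).source)
    (h0 : ∀ x ∉ K, η x = 0) :
    integrateForm o η = ∫ y in (extChartAt (𝓡 3) x₁).target, density o η x₁ y := by
  have hd0 (x₀ : M) (y : E3) (h : (extChartAt (𝓡 3) x₀).symm y ∉ K) : density o η x₀ y = 0 := by
    rw [density, inChart_apply, h0 _ h]
    exact mul_zero _
  have hterm (x₀ : M) : ∫ y in (extChartAt (𝓡 3) x₀).target,
        chartPartition x₀ ((extChartAt (𝓡 3) x₀).symm y) * density o η x₀ y =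
      ∫ y in (extChartAt (𝓡 3) x₁).target,
        chartPartition x₀ ((extChartAt (𝓡 3) x₁).symm y) * density o η x₁ y := by
    set S : Set E3 := (extChartAt (𝓡 3) x₀).target ∩
      (extChartAt (𝓡 3) x₀).symm ⁻¹' (extChartAt (𝓡 3) x₁).source with hS
    have hSo : IsOpen S := (continuousOn_extChartAt_symm x₀).isOpen_inter_preimage
      (isOpen_extChartAt_target x₀) (isOpen_extChartAt_source x₁)
    have himg : transition x₀ x₁ '' S = (extChartAt (𝓡 3) x₁).target ∩
        (extChartAt (𝓡 3) x₁).symm ⁻¹' (extChartAt (𝓡 3) x₀).source := by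
      ext z
      constructor
      · rintro ⟨y, ⟨hy, hy'⟩, rfl⟩
        refine ⟨(extChartAt (𝓡 3) x₁).map_source hy', ?_⟩
        rw [mem_preimage, symm_transition x₀ x₁ hy']
        exact (extChartAt (𝓡 3) x₀).map_target hy
      · rintro ⟨hz, hz'⟩
        have h1 := symm_transition x₁ x₀ hz'
        refine ⟨transition x₁ x₀ z, ⟨(extChartAt (𝓡 3) x₀).map_source hz', ?_⟩, ?_⟩
        · rw [mem_preimage, h1]
          exact (extChartAt (𝓡 3) x₁).map_target hz
        · rw [transition, h1]
          exact (extChartAt (𝓡 3) x₁).right_inv hz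
    have hinj : InjOn (transition x₀ x₁) S := by
      intro y hy z hz h
      have h' := congrArg (extChartAt (𝓡 3) x₁).symm h
      rw [symm_transition x₀ x₁ hy.2, symm_transition x₀ x₁ hz.2] at h'
      exact (extChartAt (𝓡 3) x₀).symm.injOn hy.1 hz.1 h'
    rw [setIntegral_eq_of_subset_of_forall_sdiff_eq_zero (s := S)
        (isOpen_extChartAt_target x₀).measurableSet inter_subset_left,
      setIntegral_eq_of_subset_of_forall_sdiff_eq_zero (t := (extChartAt (𝓡 3) x₁).target)
        (s := transition x₀ x₁ '' S) (isOpen_extChartAt_target x₁).measurableSet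
        (himg ▸ inter_subset_left),
      integral_image_eq_integral_abs_det_fderiv_smul volume hSo.measurableSet
        (fun y hy ↦ (((contDiffAt_transition x₀ x₁ hy.1 hy.2).differentiableAt
          (by simp)).hasFDerivAt).hasFDerivWithinAt) hinj]
    · refine setIntegral_congr_fun hSo.measurableSet fun y hy ↦ ?_
      simp only [smul_eq_mul]
      rw [density_transition o η x₀ x₁ hy.1 hy.2, symm_transition x₀ x₁ hy.2]
      ring
    · intro z hz
      rw [himg] at hz
      have : chartPartition x₀ ((extChartAt (𝓡 3) x₁).symm z) = 0 := by
        refine image_eq_zero_of_notMem_tsupport fun h ↦ hz.2 ⟨hz.1, ?_⟩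
        exact tsupport_chartPartition x₀ h
      rw [this, zero_mul]
    · intro y hy
      rw [hd0 x₀ y fun h ↦ hy.2 ⟨hy.1, hKs h⟩, mul_zero]
  rw [integrateForm_eq_sum, Finset.sum_congr rfl fun x₀ _ ↦ hterm x₀, ← integral_finsetSum]
  · refine integral_congr_ae (Filter.Eventually.of_forall fun y ↦ ?_)
    simp only [← Finset.sum_mul, sum_chartPartition, one_mul]
  · intro x₀ _
    refine integrableOn_chart (K := K) ?_ hK hKs fun y _ h ↦ by rw [hd0 x₁ y h, mul_zero]
    exact (continuousOn_comp_symm (chartPartition x₀).contMDiff.continuous x₁).mul (hη.density o x₁)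


theorem integral_density_extD_eq_zero (o : MOrientation M) {β : DiffForm M 2} (hβ : IsSmoothForm β)
    (x₁ : M) {K : Set M} (hK : IsClosed K) (hKs : K ⊆ (extChartAt (𝓡 3) x₁).source)
    (h0 : ∀ x ∉ K, β x = 0) :
    ∫ y in (extChartAt (𝓡 3) x₁).target, density o (extD β) x₁ y = 0 := by
  set T := (extChartAt (𝓡 3) x₁).target with hT
  have hTo : IsOpen T := isOpen_extChartAt_target x₁
  set K' : Set E3 := extChartAt (𝓡 3) x₁ '' K with hK'
  have hK'c : IsCompact K' :=
    hK.isCompact.image_of_continuousOn ((continuousOn_extChartAt x₁).mono hKs)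
  have hK'T : K' ⊆ T := by
    rintro _ ⟨x, hx, rfl⟩
    exact (extChartAt (𝓡 3) x₁).map_source (hKs hx)
  have hz (y : E3) (hy : y ∈ T) (hyK : y ∉ K') : inChart β x₁ y = 0 := by
    ext v
    rw [inChart_apply, h0 _ fun h ↦ hyK ⟨_, h, (extChartAt (𝓡 3) x₁).right_inv hy⟩]
    rfl
  let F (v : Fin 2 → E3) : E3 → ℝ := T.indicator fun y ↦ coordSign o.orient x₁ y * inChart β x₁ y v
  have hF0 (v : Fin 2 → E3) (y : E3) (hy : y ∉ K') : F v y = 0 := by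
    by_cases hyT : y ∈ T
    · simp only [F, indicator_of_mem hyT, hz y hyT hy]
      exact mul_zero _
    · simp only [F, indicator_of_notMem hyT]
  have hFT (v : Fin 2 → E3) (y : E3) (hy : y ∈ T) :
      F v =ᶠ[𝓝 y] fun z ↦ coordSign o.orient x₁ y * inChart β x₁ z v := by
    filter_upwards [hTo.mem_nhds hy, coordSign_eventually_eq o x₁ hy] with z hz hz'
    simp only [F, indicator_of_mem hz, hz']
  have hFs (v : Fin 2 → E3) : ContDiff ℝ 1 (F v) := by
    refine contDiff_iff_contDiffAt.2 fun y ↦ ?_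
    by_cases hy : y ∈ K'
    · have hy' := hK'T hy
      refine ContDiffAt.congr_of_eventuallyEq ?_ (hFT v y hy')
      exact contDiffAt_const.mul
        (((hβ.apply x₁ v).contDiffAt (hTo.mem_nhds hy')).of_le (by simp))
    · refine (contDiffAt_const (c := (0 : ℝ))).congr_of_eventuallyEq ?_
      filter_upwards [hK'c.isClosed.isOpen_compl.mem_nhds hy] with z hz
      exact hF0 v z hz
  have hFc (v : Fin 2 → E3) : HasCompactSupport (F v) :=
    HasCompactSupport.intro hK'c fun y hy ↦ hF0 v y hy
  have hd (v : Fin 2 → E3) (y : E3) (hy : y ∈ T) (w : E3) : fderiv ℝ (F v) y w =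
      coordSign o.orient x₁ y * fderiv ℝ (fun z ↦ inChart β x₁ z v) y w := by
    rw [(hFT v y hy).fderiv_eq, fderiv_const_mul (hβ.differentiableAt_apply hy v)]
    rfl
  have hd0 (v : Fin 2 → E3) (y : E3) (hy : y ∉ T) : fderiv ℝ (F v) y = 0 := by
    have : F v =ᶠ[𝓝 y] fun _ ↦ 0 := by
      filter_upwards [hK'c.isClosed.isOpen_compl.mem_nhds fun h ↦ hy (hK'T h)] with z hz
      exact hF0 v z hz
    rw [this.fderiv_eq]
    simp
  let G : E3 → ℝ := fun y ↦ fderiv ℝ (F ![stdB 1, stdB 2]) y (stdB 0)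
      - fderiv ℝ (F ![stdB 0, stdB 2]) y (stdB 1) + fderiv ℝ (F ![stdB 0, stdB 1]) y (stdB 2)
  have e : (stdB : Fin 3 → E3) = ![stdB 0, stdB 1, stdB 2] := by
    ext1 i; fin_cases i <;> rfl
  have h1 : ∫ y in T, density o (extD β) x₁ y = ∫ y in T, G y := by
    refine setIntegral_congr_fun hTo.measurableSet fun y hy ↦ ?_
    simp only [density, G, hd _ y hy]
    rw [inChart_extD hβ x₁ hy, e, extDeriv_two_apply (hβ.differentiableAt hy)]
    simp only [Matrix.cons_val_zero, Matrix.cons_val_one, Matrix.cons_val_two, Matrix.tail_cons,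
      Matrix.head_cons]
    ring
  have hi (v : Fin 2 → E3) (w : E3) : Integrable fun y ↦ fderiv ℝ (F v) y w :=
    Continuous.integrable_of_hasCompactSupport
      (((hFs v).continuous_fderiv (by simp)).clm_apply continuous_const)
      ((hFc v).fderiv_apply (𝕜 := ℝ) w)
  rw [h1, setIntegral_eq_integral_of_forall_compl_eq_zero fun y hy ↦ by simp [G, hd0 _ y hy]]
  simp only [G]
  have hi2 (v w : Fin 2 → E3) (a b : E3) :
      Integrable fun y ↦ fderiv ℝ (F v) y a - fderiv ℝ (F w) y b := (hi _ _).sub (hi _ _)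
  rw [integral_add (hi2 _ _ _ _) (hi _ _), integral_sub (hi _ _) (hi _ _),
    integral_fderiv_apply_eq_zero (hFs _) (hFc _), integral_fderiv_apply_eq_zero (hFs _) (hFc _),
    integral_fderiv_apply_eq_zero (hFs _) (hFc _)]
  simp

theorem smoothFun_chartPartition (x₀ : M) : SmoothFun (chartPartition (M := M) x₀) :=
  (chartPartition x₀).contMDiff

/-- **Stokes' theorem** on a closed manifold. -/
theorem integrateForm_extD (o : MOrientation M) {β : DiffForm M 2} (hβ : IsSmoothForm β) :
    integrateForm o (extD β) = 0 := by
  have hs (x₀ : M) := IsSmoothForm.fsmul (smoothFun_chartPartition x₀) hβ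
  have hsum : β = ∑ x₀ ∈ partitionIndices M, fsmul (chartPartition x₀) β := by
    funext x
    simp only [Finset.sum_apply, fsmul, ← Finset.sum_smul, sum_chartPartition, one_smul]
  have h0 (x₀ x : M) (hx : x ∉ tsupport (chartPartition (M := M) x₀)) :
      fsmul (chartPartition x₀) β x = 0 := by
    simp [fsmul, image_eq_zero_of_notMem_tsupport hx]
  rw [hsum, extD_sum _ fun x₀ _ ↦ hs x₀, integrateForm_sum o _ fun x₀ _ ↦ (hs x₀).extD.isContForm]
  refine Finset.sum_eq_zero fun x₀ _ ↦ ?_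
  rw [integrateForm_eq_chart o (hs x₀).extD.isContForm x₀ (isClosed_tsupport _)
    (tsupport_chartPartition x₀)]
  · exact integral_density_extD_eq_zero o (hs x₀) x₀ (isClosed_tsupport _)
      (tsupport_chartPartition x₀) (h0 x₀)
  · intro x hx
    have hc : ContinuousAt (extChartAt (𝓡 3) x).symm (extChartAt (𝓡 3) x x) :=
      continuousAt_extChartAt_symm x
    have hev : inChart (fsmul (chartPartition x₀) β) x =ᶠ[𝓝 (extChartAt (𝓡 3) x x)] fun _ ↦ 0 := by
      have hx' : (tsupport (chartPartition (M := M) x₀))ᶜ ∈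
          𝓝 ((extChartAt (𝓡 3) x).symm (extChartAt (𝓡 3) x x)) := by
        rw [extChartAt_to_inv]
        exact (isClosed_tsupport _).isOpen_compl.mem_nhds hx
      filter_upwards [hc.preimage_mem_nhds hx'] with z hz
      ext v
      rw [inChart_apply, h0 x₀ _ hz]
      rfl
    ext v
    rw [extD_apply, hev.extDeriv_eq, extDeriv_apply (differentiableAt_const _)]
    simp

end

section
variable {M : Type*} [TopologicalSpace M] [ChartedSpace E3 M] [IsManifold (𝓡 3) ∞ M]

/-- Smooth vector fields. -/
abbrev SmoothField (Y : VField M) : Prop :=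
  ContMDiff (𝓡 3) (𝓡 3).tangent ∞ fun x ↦ (⟨x, Y x⟩ : TangentBundle (𝓡 3) M)

theorem SmoothField.diffAt {Y : VField M} (h : SmoothField Y) (x : M) : DiffAt Y x :=
  h.mdifferentiableAt (by simp)

set_option synthInstance.maxHeartbeats 400000 in
theorem smoothFun_inner (g : Metric M) {Y Z : VField M} (hY : SmoothField Y) (hZ : SmoothField Z) :
    SmoothFun fun p ↦ g.inner p (Y p) (Z p) := by
  have h : ContMDiff (𝓡 3) ((𝓡 3).prod 𝓘(ℝ)) ∞
      (fun p ↦ TotalSpace.mk' ℝ (E := Bundle.Trivial M ℝ) p (g.inner p (Y p) (Z p))) := by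
    apply ContMDiff.clm_bundle_apply₂ (F₁ := E3) (F₂ := E3)
    · exact g.contMDiff
    · exact hY
    · exact hZ
  intro x
  exact ((contMDiffAt_totalSpace.1 (h x)).2 :)

/-- The coframe dual to an orthonormal frame. -/
def coframe (g : Metric M) (S : Fin 3 → VField M) (i : Fin 3) : DiffForm M 1 :=
  oneForm fun x ↦ g.inner x (S i x)

theorem contMDiffOn_dSymm (x₀ : M) (v : E3) :
    ContMDiffOn 𝓘(ℝ, E3) (𝓡 3).tangent ∞
      (fun y ↦ (⟨(extChartAt (𝓡 3) x₀).symm y, dSymm x₀ y v⟩ : TangentBundle (𝓡 3) M))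
      (extChartAt (𝓡 3) x₀).target := by
  have : IsManifold (𝓡 3) 1 M := IsManifold.of_le (n := ∞) (by simp)
  have hT : UniqueMDiffOn 𝓘(ℝ, E3) (extChartAt (𝓡 3) x₀).target :=
    (isOpen_extChartAt_target x₀).uniqueMDiffOn
  have h1 := (contMDiffOn_extChartAt_symm (I := 𝓡 3) (n := ∞) x₀).contMDiffOn_tangentMapWithin
    (m := ∞) (by simp) hT
  have h2 : ContMDiff 𝓘(ℝ, E3) (𝓘(ℝ, E3)).tangent ∞
      (fun y : E3 ↦ (⟨y, v⟩ : TangentBundle 𝓘(ℝ, E3) E3)) := by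
    intro y
    rw [contMDiffAt_totalSpace]
    refine ⟨contMDiffAt_id, ?_⟩
    simpa using contMDiffAt_const
  refine (h1.comp h2.contMDiffOn fun y hy ↦ hy).congr fun y hy ↦ ?_
  simp only [Function.comp_apply, tangentMapWithin]
  rw [mfderivWithin_of_mem_nhds (chart_target_mem_nhds x₀ hy)]
  rfl

set_option synthInstance.maxHeartbeats 400000 in
theorem isSmoothForm_coframe (g : Metric M) {S : Fin 3 → VField M} (i : Fin 3)
    (hS : SmoothField (S i)) : IsSmoothForm (coframe g S i) := by
  refine isSmoothForm_iff.2 fun x₀ v ↦ ?_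
  have hφ := contMDiffOn_extChartAt_symm (I := 𝓡 3) (n := ∞) x₀
  have h : ContMDiffOn 𝓘(ℝ, E3) ((𝓡 3).prod 𝓘(ℝ)) ∞
      (fun y ↦ TotalSpace.mk' ℝ (E := Bundle.Trivial M ℝ) ((extChartAt (𝓡 3) x₀).symm y)
        (g.inner ((extChartAt (𝓡 3) x₀).symm y) (S i ((extChartAt (𝓡 3) x₀).symm y))
          (dSymm x₀ y (v 0)))) (extChartAt (𝓡 3) x₀).target := by
    apply ContMDiffOn.clm_bundle_apply₂ (F₁ := E3) (F₂ := E3)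
    · exact g.contMDiff.comp_contMDiffOn hφ
    · exact hS.comp_contMDiffOn hφ
    · exact contMDiffOn_dSymm x₀ (v 0)
  refine ContMDiffOn.contDiffOn fun y hy ↦ ?_
  exact ((contMDiffWithinAt_totalSpace.1 (h y hy)).2 :)

variable {g : Metric M} {S : Fin 3 → VField M}

theorem coframe_frame (hS : IsOrthonormalFrame g S) (i j : Fin 3) (x : M) :
    coframe g S i x ![S j x] = if i = j then 1 else 0 := hS.2 x i j

theorem frame_linearIndependent (hS : IsOrthonormalFrame g S) (x : M) :
    LinearIndependent ℝ fun i ↦ S i x := by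
  rw [Fintype.linearIndependent_iff]
  intro c hc i
  have := congrArg (g.inner x (S i x)) hc
  simpa [hS.2] using this

/-- The basis of a tangent space given by an orthonormal frame. -/
def frameBasis (hS : IsOrthonormalFrame g S) (x : M) :
    Module.Basis (Fin 3) ℝ (TangentSpace (𝓡 3) x) :=
  basisOfLinearIndependentOfCardEqFinrank (frame_linearIndependent hS x)
    ((finrank_euclideanSpace_fin (𝕜 := ℝ) (n := 3)).symm)

theorem frameBasis_apply (hS : IsOrthonormalFrame g S) (x : M) (i : Fin 3) :
    frameBasis hS x i = S i x :=
  congrFun (coe_basisOfLinearIndependentOfCardEqFinrank (frame_linearIndependent hS x) _) i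

theorem sum_coframe_smul (hS : IsOrthonormalFrame g S) (x : M) (v : TangentSpace (𝓡 3) x) :
    ∑ i, g.inner x (S i x) v • S i x = v := by
  have h := (frameBasis hS x).sum_repr v
  have h2 (i : Fin 3) : g.inner x (S i x) v = (frameBasis hS x).repr v i := by
    conv_lhs => rw [← h]
    simp [frameBasis_apply, hS.2]
  simp only [h2]
  simpa only [frameBasis_apply] using h

/-- Forms agreeing on all tuples of frame vectors are equal. -/
theorem form_ext_frame (hS : IsOrthonormalFrame g S) {k : ℕ} {η ζ : DiffForm M k}
    (h : ∀ (x : M) (s : Fin k → Fin 3), η x (fun i ↦ S (s i) x) = ζ x (fun i ↦ S (s i) x)) :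
    η = ζ := by
  funext x
  apply ContinuousAlternatingMap.toAlternatingMap_injective
  refine Module.Basis.ext_alternating (frameBasis hS x) fun s _ ↦ ?_
  simp only [frameBasis_apply]
  exact h x s

theorem one_form_ext (hS : IsOrthonormalFrame g S) {η ζ : DiffForm M 1}
    (h : ∀ (x : M) (i : Fin 3), η x ![S i x] = ζ x ![S i x]) : η = ζ := by
  refine form_ext_frame hS fun x s ↦ ?_
  have : (fun i ↦ S (s i) x) = ![S (s 0) x] := by ext1 i; fin_cases i; rfl
  rw [this]
  exact h x _

theorem three_form_ext (hS : IsOrthonormalFrame g S) {η ζ : DiffForm M 3}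
    (h : ∀ x : M, η x ![S 0 x, S 1 x, S 2 x] = ζ x ![S 0 x, S 1 x, S 2 x]) : η = ζ := by
  funext x
  apply ContinuousAlternatingMap.toAlternatingMap_injective
  have e : (frameBasis hS x : Fin 3 → _) = ![S 0 x, S 1 x, S 2 x] := by
    ext1 i; rw [frameBasis_apply]; fin_cases i <;> rfl
  rw [(η x).toAlternatingMap.eq_smul_basis_det (frameBasis hS x),
    (ζ x).toAlternatingMap.eq_smul_basis_det (frameBasis hS x), e]
  congr 1
  exact h x

theorem one_form_eq_sum (hS : IsOrthonormalFrame g S) {α : DiffForm M 1} {c : Fin 3 → M → ℝ}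
    (hc : ∀ i x, α x ![S i x] = c i x) : α = ∑ i, fsmul (c i) (coframe g S i) := by
  refine one_form_ext hS fun x j ↦ ?_
  rw [hc, Finset.sum_apply]
  have : (∑ i, fsmul (c i) (coframe g S i) x) ![S j x] =
      ∑ i, (fsmul (c i) (coframe g S i) x) ![S j x] := by
    simp
  rw [this]
  have h2 (i : Fin 3) : fsmul (c i) (coframe g S i) x ![S j x] =
      c i x * coframe g S i x ![S j x] := rfl
  simp [h2, coframe_frame hS]

/-- A `1`-form is smooth if its components in a smooth frame are. -/
theorem isSmoothForm_of_frame (hS : IsOrthonormalFrame g S) {α : DiffForm M 1}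
    (h : ∀ i, SmoothFun fun x ↦ α x ![S i x]) : IsSmoothForm α := by
  rw [one_form_eq_sum hS (c := fun i x ↦ α x ![S i x]) fun _ _ ↦ rfl]
  exact IsSmoothForm.sum _ fun i _ ↦ IsSmoothForm.fsmul (h i) (isSmoothForm_coframe g i (hS.1 i))

/-! ### The structure equation -/

/-- The expression of a vector field in the chart at `x`. -/
def fieldInChart (Y : VField M) (x : M) : E3 → E3 :=
  VectorField.mpullbackWithin 𝓘(ℝ, E3) (𝓡 3) (extChartAt (𝓡 3) x).symm Y (range (𝓡 3))

theorem dSymm_fieldInChart (Y : VField M) (x : M) {y : E3}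
    (hy : y ∈ (extChartAt (𝓡 3) x).target) :
    dSymm x y (fieldInChart Y x y) = Y ((extChartAt (𝓡 3) x).symm y) := by
  have : IsManifold (𝓡 3) 1 M := IsManifold.of_le (n := ∞) (by simp)
  have hi := isInvertible_mfderivWithin_extChartAt_symm (I := 𝓡 3) hy
  rw [fieldInChart, VectorField.mpullbackWithin_apply]
  have e : dSymm x y = mfderivWithin 𝓘(ℝ, E3) (𝓡 3) (extChartAt (𝓡 3) x).symm (range (𝓡 3)) y := by
    simp only [modelWithCornersSelf_coe, range_id, mfderivWithin_univ]
    rfl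
  rw [e]
  exact hi.self_apply_inverse _

theorem differentiableAt_fieldInChart {Y : VField M} (hY : SmoothField Y) (x : M) :
    DifferentiableAt ℝ (fieldInChart Y x) (extChartAt (𝓡 3) x x) := by
  have : IsManifold (𝓡 3) 2 M := IsManifold.of_le (n := ∞) (by simpa using ENat.LEInfty.out)
  have := (SmoothField.diffAt hY x).mdifferentiableWithinAt (s := univ)
    |>.differentiableWithinAt_mpullbackWithin_vectorField
  rw [show (extChartAt (𝓡 3) x).symm ⁻¹' univ ∩ range (𝓡 3) = univ by simp] at this
  exact differentiableWithinAt_univ.1 this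

theorem dChart_mlieBracket (Y Z : VField M) (x : M) :
    dChart x x (VectorField.mlieBracket (𝓡 3) Y Z x) =
      VectorField.lieBracket ℝ (fieldInChart Y x) (fieldInChart Z x) (extChartAt (𝓡 3) x x) := by
  have : IsManifold (𝓡 3) 1 M := IsManifold.of_le (n := ∞) (by simp)
  rw [← VectorField.mlieBracketWithin_univ, VectorField.mlieBracketWithin_apply]
  have hi : (mfderiv (𝓡 3) 𝓘(ℝ, E3) (extChartAt (𝓡 3) x) x).IsInvertible :=
    isInvertible_mfderiv_extChartAt (mem_extChartAt_source x)
  have := hi.self_apply_inverse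
    (VectorField.lieBracket ℝ (fieldInChart Y x) (fieldInChart Z x) (extChartAt (𝓡 3) x x))
  refine Eq.trans ?_ this
  rw [show (extChartAt (𝓡 3) x).symm ⁻¹' univ ∩ range (𝓡 3) = univ by simp]
  have e := congrFun (VectorField.lieBracketWithin_univ (𝕜 := ℝ) (V := fieldInChart Y x)
    (W := fieldInChart Z x)) (extChartAt (𝓡 3) x x)
  exact congrArg (fun v ↦ dChart x x ((mfderiv (𝓡 3) 𝓘(ℝ, E3) (extChartAt (𝓡 3) x) x).inverse v)) e

theorem inChart_fieldInChart (α : DiffForm M 1) (Y : VField M) (x : M) {y : E3}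
    (hy : y ∈ (extChartAt (𝓡 3) x).target) :
    inChart α x y ![fieldInChart Y x y] =
      α ((extChartAt (𝓡 3) x).symm y) ![Y ((extChartAt (𝓡 3) x).symm y)] := by
  rw [inChart_apply, ← dSymm_fieldInChart Y x hy]
  congr 1
  ext1 i
  fin_cases i
  rfl

theorem dChart_self (Y : VField M) (x : M) :
    dChart x x (Y x) = fieldInChart Y x (extChartAt (𝓡 3) x x) := by
  have hy := mem_extChartAt_target (I := 𝓡 3) x
  rw [← dChart_dSymm x hy (fieldInChart Y x (extChartAt (𝓡 3) x x)), dSymm_fieldInChart Y x hy]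
  have (p : M) (h : p = x) : dChart x x (Y x) = dChart x p (Y p) := by rw [h]
  exact this _ (extChartAt_to_inv x)

theorem extD_apply_fields {α : DiffForm M 1} (hα : IsSmoothForm α) {Y Z : VField M}
    (hY : SmoothField Y) (hZ : SmoothField Z) {a b : ℝ} (ha : ∀ x, α x ![Y x] = a)
    (hb : ∀ x, α x ![Z x] = b) (x : M) :
    extD α x ![Y x, Z x] = - α x ![VectorField.mlieBracket (𝓡 3) Y Z x] := by
  have hy := mem_extChartAt_target (I := 𝓡 3) x
  set y := extChartAt (𝓡 3) x x with hydef
  have e1 : (fun i ↦ dChart x x (![Y x, Z x] i)) =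
      fun i : Fin 2 ↦ (![fieldInChart Y x, fieldInChart Z x] i) y := by
    ext1 i
    fin_cases i
    · exact dChart_self Y x
    · exact dChart_self Z x
  have hd : ∀ i : Fin 2, DifferentiableAt ℝ (![fieldInChart Y x, fieldInChart Z x] i) y := by
    intro i
    fin_cases i
    · exact differentiableAt_fieldInChart hY x
    · exact differentiableAt_fieldInChart hZ x
  rw [extD_apply, e1, extDeriv_apply_vectorField (hα.differentiableAt hy) hd, Fin.sum_univ_two]
  have r0 : (fun z ↦ inChart α x z (Fin.removeNth 0 fun i : Fin 2 ↦
      (![fieldInChart Y x, fieldInChart Z x] i) z)) =ᶠ[𝓝 y] fun _ ↦ b := by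
    filter_upwards [chart_target_mem_nhds x hy] with z hz
    have : (Fin.removeNth 0 fun i : Fin 2 ↦ (![fieldInChart Y x, fieldInChart Z x] i) z) =
        ![fieldInChart Z x z] := by ext1 i; fin_cases i; rfl
    rw [this, inChart_fieldInChart α Z x hz, hb]
  have r1 : (fun z ↦ inChart α x z (Fin.removeNth 1 fun i : Fin 2 ↦
      (![fieldInChart Y x, fieldInChart Z x] i) z)) =ᶠ[𝓝 y] fun _ ↦ a := by
    filter_upwards [chart_target_mem_nhds x hy] with z hz
    have : (Fin.removeNth 1 fun i : Fin 2 ↦ (![fieldInChart Y x, fieldInChart Z x] i) z) =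
        ![fieldInChart Y x z] := by ext1 i; fin_cases i; rfl
    rw [this, inChart_fieldInChart α Y x hz, ha]
  rw [r0.fderiv_eq, r1.fderiv_eq]
  have hb' : α x ![VectorField.mlieBracket (𝓡 3) Y Z x] = inChart α x y
      ![VectorField.lieBracket ℝ (fieldInChart Y x) (fieldInChart Z x) y] := by
    rw [← inChart_dChart α x (mem_extChartAt_source x), ← dChart_mlieBracket]
    congr 1
    ext1 i
    fin_cases i
    rfl
  rw [hb']
  have hs (F : Fin 1 → ℝ) : ∑ j ≥ (0 : Fin 1), F j = F 0 := by
    rw [show (Finset.Ici (0 : Fin 1)) = {0} from rfl, Finset.sum_singleton]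
  rw [Fin.sum_univ_one, hs]
  simp only [fderiv_fun_const, Pi.zero_apply, zero_apply, smul_zero, add_zero, zero_sub]
  congr 1
  simp only [Fin.val_zero, add_zero, pow_zero, one_smul]
  congr 1
  ext1 i
  fin_cases i
  rfl

theorem connectionForm_apply (g : Metric M) (S : Fin 3 → VField M) (i j : Fin 3) (x : M)
    (v : TangentSpace (𝓡 3) x) :
    connectionForm g S i j x ![v] = g.inner x (S i x) (leviCivita g (S j) x v) := rfl

theorem connectionForm_antisymm (hS : IsOrthonormalFrame g S) (i j : Fin 3) :
    connectionForm g S i j = - connectionForm g S j i := by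
  refine one_form_ext hS fun x k ↦ ?_
  have h := (leviCivita_spec g).2 (S k) (S j) (S i) x (SmoothField.diffAt (hS.1 j) x) (SmoothField.diffAt (hS.1 i) x)
  have hc : (fun p ↦ g.inner p (S j p) (S i p)) = fun _ ↦ if j = i then 1 else 0 := by
    funext p; exact hS.2 p j i
  rw [hc, g.symm x (leviCivita g (S j) x (S k x))] at h
  have h0 : mvfderiv (𝓡 3) (fun _ : M ↦ (if j = i then 1 else 0 : ℝ)) x (S k x) = 0 := by
    rw [mvfderiv_const]
    rfl
  rw [h0] at h
  have e : (-connectionForm g S j i) x ![S k x] = - connectionForm g S j i x ![S k x] := rfl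
  rw [e, connectionForm_apply, connectionForm_apply]
  linarith

theorem extD_coframe_bracket (hS : IsOrthonormalFrame g S) (i j k : Fin 3) (x : M) :
    extD (coframe g S i) x ![S j x, S k x] =
      - g.inner x (S i x) (VectorField.mlieBracket (𝓡 3) (S j) (S k) x) :=
  extD_apply_fields (isSmoothForm_coframe g i (hS.1 i)) (hS.1 j) (hS.1 k)
    (fun x ↦ coframe_frame hS i j x) (fun x ↦ coframe_frame hS i k x) x

/-- Cartan's first structure equation. -/
theorem extD_coframe (hS : IsOrthonormalFrame g S) (i j k : Fin 3) (x : M) :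
    extD (coframe g S i) x ![S j x, S k x] =
      connectionForm g S i j x ![S k x] - connectionForm g S i k x ![S j x] := by
  have : IsManifold (𝓡 3) 2 M := IsManifold.of_le (n := ∞) (by simpa using ENat.LEInfty.out)
  rw [extD_coframe_bracket hS,
    ← (CovariantDerivative.torsion_eq_zero_iff _).1 (leviCivita_spec g).1
      (SmoothField.diffAt (hS.1 j) x) (SmoothField.diffAt (hS.1 k) x), connectionForm_apply, connectionForm_apply, map_sub]
  ring

theorem smoothField_mlieBracket {Y Z : VField M} (hY : SmoothField Y) (hZ : SmoothField Z) :
    SmoothField (VectorField.mlieBracket (𝓡 3) Y Z) := by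
  have : IsManifold (𝓡 3) (minSmoothness ℝ 2) M :=
    IsManifold.of_le (n := ∞) (by simpa using ENat.LEInfty.out)
  have : IsManifold (𝓡 3) ((⊤ : ℕ∞) + 1) M := IsManifold.of_le (n := ∞) (by simp)
  intro x
  exact ContMDiffAt.mlieBracket_vectorField (n := ⊤) (m := ⊤) (hY x) (hZ x) (by simp)

theorem smoothFun_extD_coframe (hS : IsOrthonormalFrame g S) (i j k : Fin 3) :
    SmoothFun fun x ↦ extD (coframe g S i) x ![S j x, S k x] := by
  simp only [extD_coframe_bracket hS]
  exact (smoothFun_inner g (hS.1 i) (smoothField_mlieBracket (hS.1 j) (hS.1 k))).neg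

/-- An antisymmetric matrix of `1`-forms satisfying the structure equation is determined by it. -/
theorem connection_koszul {W : Fin 3 → Fin 3 → Fin 3 → ℝ} {T : Fin 3 → Fin 3 → Fin 3 → ℝ}
    (h1 : ∀ i j k, W i j k = - W j i k) (h2 : ∀ i j k, T i j k = W i j k - W i k j)
    (i j k : Fin 3) : W i j k = (T i j k + T j k i - T k i j) / 2 := by
  rw [h2, h2, h2, h1 j i k, h1 k i j, h1 k j i]
  ring

theorem isSmoothForm_connectionForm (hS : IsOrthonormalFrame g S) (i j : Fin 3) :
    IsSmoothForm (connectionForm g S i j) := by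
  refine isSmoothForm_of_frame hS fun k ↦ ?_
  have (x : M) := connection_koszul
    (W := fun i j k ↦ connectionForm g S i j x ![S k x])
    (T := fun i j k ↦ extD (coframe g S i) x ![S j x, S k x])
    (fun i j k ↦ by rw [connectionForm_antisymm hS i j]; rfl) (fun i j k ↦ extD_coframe hS i j k x)
    i j k
  simp only [this]
  have h (i j k : Fin 3) := smoothFun_extD_coframe hS i j k
  have h3 := ((h i j k).add (h j k i)).sub (h k i j)
  have h4 : SmoothFun fun x : M ↦ (1 / 2 : ℝ) := contMDiff_const
  refine (h4.mul h3).congr fun x ↦ ?_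
  simp
  ring

end

/-- The wedge product of two covectors, in components. -/
def w11 (a b : Fin 3 → ℝ) : Fin 3 → Fin 3 → ℝ := fun k l ↦ a k * b l - a l * b k

/-- The wedge product of a covector and a `2`-form, in components. -/
def w12 (a : Fin 3 → ℝ) (D : Fin 3 → Fin 3 → ℝ) : ℝ := a 0 * D 1 2 - a 1 * D 0 2 + a 2 * D 0 1

/-- The Chern-Simons polynomial of an antisymmetric matrix of covectors. -/
def cs3 (a b c : Fin 3 → ℝ) (A B C : Fin 3 → Fin 3 → ℝ) : ℝ :=
  -2 * (w12 a A + w12 b B + w12 c C) + 4 * w12 a (w11 b c)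

theorem gauge_identity (a b c u v w : Fin 3 → ℝ) (A B C : Fin 3 → Fin 3 → ℝ) :
    cs3 (a + u) (b + v) (c + w)
      (A + (w11 b w - w11 c v) + w11 v w)
      (B + (w11 c u - w11 a w) - w11 u w)
      (C + (w11 a v - w11 b u) + w11 u v) =
    cs3 a b c A B C - 2 * w12 u (w11 v w) +
    -2 * ((w12 u (A + (w11 b w - w11 c v)) - w12 a (w11 v w)) +
      (w12 v (B + (w11 c u - w11 a w)) + w12 b (w11 u w)) +
      (w12 w (C + (w11 a v - w11 b u)) - w12 c (w11 u v))) := by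
  simp only [cs3, w12, w11, Pi.add_apply, Pi.sub_apply]
  ring

/-- The components of the standard coframe. -/
def e3 (i : Fin 3) : Fin 3 → ℝ := fun k ↦ if i = k then 1 else 0

theorem conformal_identity (a b c f : Fin 3 → ℝ) (A B C : Fin 3 → Fin 3 → ℝ)
    (h : Fin 3 → Fin 3 → ℝ) (T : Fin 3 → Fin 3 → Fin 3 → ℝ)
    (hT0 : T 0 = -(w11 a (e3 1) + w11 b (e3 2)))
    (hT1 : T 1 = w11 a (e3 0) - w11 c (e3 2))
    (hT2 : T 2 = w11 b (e3 0) + w11 c (e3 1))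
    (B0 : w12 (e3 1) A - w12 a (T 1) + w12 (e3 2) B - w12 b (T 2) = 0)
    (B1 : -(w12 (e3 0) A - w12 a (T 0)) + w12 (e3 2) C - w12 c (T 2) = 0)
    (B2 : -(w12 (e3 0) B - w12 b (T 0)) - (w12 (e3 1) C - w12 c (T 1)) = 0)
    (hc : w12 f (w11 (h 0) (e3 0) + f 0 • T 0 + w11 (h 1) (e3 1) + f 1 • T 1
      + w11 (h 2) (e3 2) + f 2 • T 2) = 0) :
    cs3 (a + (f 1 • e3 0 - f 0 • e3 1)) (b + (f 2 • e3 0 - f 0 • e3 2))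
      (c + (f 2 • e3 1 - f 1 • e3 2))
      (A + (w11 (h 1) (e3 0) + f 1 • T 0 - (w11 (h 0) (e3 1) + f 0 • T 1)))
      (B + (w11 (h 2) (e3 0) + f 2 • T 0 - (w11 (h 0) (e3 2) + f 0 • T 2)))
      (C + (w11 (h 2) (e3 1) + f 2 • T 1 - (w11 (h 1) (e3 2) + f 1 • T 2))) =
    cs3 a b c A B C +
      2 * (w12 (f 1 • e3 0 - f 0 • e3 1) A
          - w12 a (w11 (h 1) (e3 0) + f 1 • T 0 - (w11 (h 0) (e3 1) + f 0 • T 1))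
        + (w12 (f 2 • e3 0 - f 0 • e3 2) B
          - w12 b (w11 (h 2) (e3 0) + f 2 • T 0 - (w11 (h 0) (e3 2) + f 0 • T 2)))
        + (w12 (f 2 • e3 1 - f 1 • e3 2) C
          - w12 c (w11 (h 2) (e3 1) + f 2 • T 1 - (w11 (h 1) (e3 2) + f 1 • T 2)))) := by
  simp only [hT0, hT1, hT2] at *
  simp only [cs3, w12, w11, e3, Pi.add_apply, Pi.sub_apply, Pi.smul_apply, Pi.neg_apply,
    smul_eq_mul, Fin.isValue, reduceIte, Fin.reduceEq] at *
  linear_combination 4 * f 0 * B0 + 4 * f 1 * B1 + 4 * f 2 * B2 - 2 * hc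


section
variable {M : Type*} [TopologicalSpace M] [ChartedSpace E3 M] [IsManifold (𝓡 3) ∞ M]
variable {g : Metric M} {S : Fin 3 → VField M}

/-- Components of a `1`-form in a frame. -/
def ev1 (S : Fin 3 → VField M) (x : M) (α : DiffForm M 1) : Fin 3 → ℝ := fun k ↦ α x ![S k x]

/-- Components of a `2`-form in a frame. -/
def ev2 (S : Fin 3 → VField M) (x : M) (α : DiffForm M 2) : Fin 3 → Fin 3 → ℝ :=
  fun k l ↦ α x ![S k x, S l x]

/-- The component of a `3`-form in a frame. -/
def ev3 (S : Fin 3 → VField M) (x : M) (α : DiffForm M 3) : ℝ := α x ![S 0 x, S 1 x, S 2 x]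

theorem ev1_add (x : M) (α β : DiffForm M 1) : ev1 S x (α + β) = ev1 S x α + ev1 S x β := rfl
theorem ev1_sub (x : M) (α β : DiffForm M 1) : ev1 S x (α - β) = ev1 S x α - ev1 S x β := rfl
theorem ev1_neg (x : M) (α : DiffForm M 1) : ev1 S x (-α) = -ev1 S x α := rfl
theorem ev1_fsmul (x : M) (f : M → ℝ) (α : DiffForm M 1) :
    ev1 S x (fsmul f α) = f x • ev1 S x α := rfl
theorem ev2_add (x : M) (α β : DiffForm M 2) : ev2 S x (α + β) = ev2 S x α + ev2 S x β := rfl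
theorem ev2_sub (x : M) (α β : DiffForm M 2) : ev2 S x (α - β) = ev2 S x α - ev2 S x β := rfl
theorem ev2_neg (x : M) (α : DiffForm M 2) : ev2 S x (-α) = -ev2 S x α := rfl
theorem ev2_fsmul (x : M) (f : M → ℝ) (α : DiffForm M 2) :
    ev2 S x (fsmul f α) = f x • ev2 S x α := rfl
theorem ev2_wedge (x : M) (α β : DiffForm M 1) :
    ev2 S x (wedge α β) = w11 (ev1 S x α) (ev1 S x β) := by
  funext k l
  exact wedge_one_one α β x _ _
theorem ev3_add (x : M) (α β : DiffForm M 3) : ev3 S x (α + β) = ev3 S x α + ev3 S x β := rfl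
theorem ev3_sub (x : M) (α β : DiffForm M 3) : ev3 S x (α - β) = ev3 S x α - ev3 S x β := rfl
theorem ev3_smul (x : M) (c : ℝ) (α : DiffForm M 3) : ev3 S x (c • α) = c * ev3 S x α := rfl
theorem ev3_zero (x : M) : ev3 S x 0 = 0 := rfl
theorem ev3_wedge (x : M) (α : DiffForm M 1) (β : DiffForm M 2) :
    ev3 S x (wedge α β) = w12 (ev1 S x α) (ev2 S x β) :=
  wedge_one_two α β x _ _ _
theorem ev3_sum {ι : Type*} (s : Finset ι) (x : M) (η : ι → DiffForm M 3) :
    ev3 S x (∑ i ∈ s, η i) = ∑ i ∈ s, ev3 S x (η i) := by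
  simp [ev3]
theorem ev2_sum {ι : Type*} (s : Finset ι) (x : M) (η : ι → DiffForm M 2) :
    ev2 S x (∑ i ∈ s, η i) = ∑ i ∈ s, ev2 S x (η i) := by
  funext k l
  simp [ev2]
theorem ev1_sum {ι : Type*} (s : Finset ι) (x : M) (η : ι → DiffForm M 1) :
    ev1 S x (∑ i ∈ s, η i) = ∑ i ∈ s, ev1 S x (η i) := by
  funext k
  simp [ev1]

theorem one_form_ext_ev (hS : IsOrthonormalFrame g S) {η ζ : DiffForm M 1}
    (h : ∀ x, ev1 S x η = ev1 S x ζ) : η = ζ :=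
  one_form_ext hS fun x i ↦ congrFun (h x) i

theorem two_form_ext_ev (hS : IsOrthonormalFrame g S) {η ζ : DiffForm M 2}
    (h : ∀ x, ev2 S x η = ev2 S x ζ) : η = ζ := by
  refine form_ext_frame hS fun x s ↦ ?_
  have : (fun i ↦ S (s i) x) = ![S (s 0) x, S (s 1) x] := by ext1 i; fin_cases i <;> rfl
  rw [this]
  exact congrFun (congrFun (h x) _) _

theorem ev1_coframe (hS : IsOrthonormalFrame g S) (i : Fin 3) (x : M) :
    ev1 S x (coframe g S i) = e3 i := by
  funext k
  exact coframe_frame hS i k x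

theorem csForm_antisymm {θ : Matrix (Fin 3) (Fin 3) (DiffForm M 1)} (h : ∀ i j, θ i j = -θ j i)
    (hs : ∀ i j, IsSmoothForm (θ i j)) (x : M) :
    ev3 S x (csForm θ) = cs3 (ev1 S x (θ 0 1)) (ev1 S x (θ 0 2)) (ev1 S x (θ 1 2))
      (ev2 S x (extD (θ 0 1))) (ev2 S x (extD (θ 0 2))) (ev2 S x (extD (θ 1 2))) := by
  have hd (i : Fin 3) : ev1 S x (θ i i) = 0 := by
    have h1 := congrArg (ev1 S x) (h i i)
    rw [ev1_neg] at h1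
    exact self_eq_neg.1 h1
  have h10 : ev1 S x (θ 1 0) = -ev1 S x (θ 0 1) := by rw [h 1 0, ev1_neg]
  have h20 : ev1 S x (θ 2 0) = -ev1 S x (θ 0 2) := by rw [h 2 0, ev1_neg]
  have h21 : ev1 S x (θ 2 1) = -ev1 S x (θ 1 2) := by rw [h 2 1, ev1_neg]
  have g10 : ev2 S x (extD (θ 1 0)) = -ev2 S x (extD (θ 0 1)) := by
    rw [h 1 0, extD_neg (hs _ _), ev2_neg]
  have g20 : ev2 S x (extD (θ 2 0)) = -ev2 S x (extD (θ 0 2)) := by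
    rw [h 2 0, extD_neg (hs _ _), ev2_neg]
  have g21 : ev2 S x (extD (θ 2 1)) = -ev2 S x (extD (θ 1 2)) := by
    rw [h 2 1, extD_neg (hs _ _), ev2_neg]
  have e : csForm θ = ∑ i, ((∑ l, wedge (θ i l) (extD (θ l i))) +
      (2 / 3 : ℝ) • ∑ l, wedge (θ i l) (∑ m, wedge (θ l m) (θ m i))) := rfl
  rw [e]
  simp only [ev3_sum, ev3_add, ev3_smul, ev3_wedge, ev2_sum, ev2_wedge]
  simp only [Fin.sum_univ_three, hd, h10, h20, h21, g10, g20, g21]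
  simp only [cs3, w12, w11, Pi.add_apply, Pi.neg_apply, Pi.zero_apply]
  ring

theorem smoothFun_mvfderiv {f : M → ℝ} (hf : SmoothFun f) {Y : VField M} (hY : SmoothField Y) :
    SmoothFun fun x ↦ mvfderiv (𝓡 3) f x (Y x) := by
  have : IsManifold (𝓡 3) 1 M := IsManifold.of_le (n := ∞) (by simp)
  have h1 := (hf.contMDiff_tangentMap (m := ∞) (by simp)).comp hY
  exact (contMDiff_snd_tangentBundle_modelSpace ℝ 𝓘(ℝ, ℝ)).comp h1

theorem dfun_eq_sum (hS : IsOrthonormalFrame g S) (f : M → ℝ) :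
    dfun f = ∑ i, fsmul (fun x ↦ mvfderiv (𝓡 3) f x (S i x)) (coframe g S i) :=
  one_form_eq_sum hS fun _ _ ↦ rfl

/-! ### Conformal change -/

theorem smoothField_smul {f : M → ℝ} (hf : SmoothFun f) {Y : VField M} (hY : SmoothField Y) :
    SmoothField fun x ↦ f x • Y x := hf.smul_section hY

theorem smoothFun_exp (f : C^∞⟮𝓡 3, M; 𝓘(ℝ, ℝ), ℝ⟯) : SmoothFun fun x ↦ Real.exp (f x) :=
  Real.contDiff_exp.contMDiff.comp f.contMDiff

theorem conformalChange_inner (f : C^∞⟮𝓡 3, M; 𝓘(ℝ, ℝ), ℝ⟯) (g : Metric M) (x : M)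
    (v w : TangentSpace (𝓡 3) x) :
    (conformalChange f g).inner x v w = Real.exp (2 * f x) * g.inner x v w := rfl

theorem isOrthonormalFrame_rescaleFrame (f : C^∞⟮𝓡 3, M; 𝓘(ℝ, ℝ), ℝ⟯)
    (hS : IsOrthonormalFrame g S) :
    IsOrthonormalFrame (conformalChange f g) (rescaleFrame f S) := by
  refine ⟨fun i ↦ smoothField_smul (f := fun x ↦ Real.exp (-f x)) ?_ (hS.1 i), fun x i j ↦ ?_⟩
  · exact smoothFun_exp (-f)
  · simp only [conformalChange_inner, rescaleFrame, map_smul, smul_apply, smul_eq_mul, hS.2]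
    rw [← mul_assoc, ← mul_assoc, ← Real.exp_add, ← Real.exp_add]
    ring_nf
    simp

theorem coframe_conformal (f : C^∞⟮𝓡 3, M; 𝓘(ℝ, ℝ), ℝ⟯) (i : Fin 3) :
    coframe (conformalChange f g) (rescaleFrame f S) i =
      fsmul (fun x ↦ Real.exp (f x)) (coframe g S i) := by
  funext x
  ext v
  change Real.exp (2 * f x) * g.inner x (Real.exp (-f x) • S i x) (v 0) =
    Real.exp (f x) * g.inner x (S i x) (v 0)
  rw [map_smul, smul_apply, smul_eq_mul, ← mul_assoc, ← Real.exp_add]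
  ring_nf

theorem ev1_dfun_comp {φ : ℝ → ℝ} {f : M → ℝ} (hf : SmoothFun f) (x : M)
    (hφ : DifferentiableAt ℝ φ (f x)) :
    ev1 S x (dfun fun x ↦ φ (f x)) = deriv φ (f x) • ev1 S x (dfun f) := by
  funext k
  have h := (hφ.hasDerivAt.hasFDerivAt.hasMFDerivAt.comp x
    (hf.mdifferentiableAt (by simp)).hasMFDerivAt).mfderiv
  refine congr($h (S k x)).trans ?_
  change ev1 S x (dfun f) k * deriv φ (f x) = deriv φ (f x) * ev1 S x (dfun f) k
  exact mul_comm _ _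

theorem ev1_dfun_exp (f : C^∞⟮𝓡 3, M; 𝓘(ℝ, ℝ), ℝ⟯) (x : M) :
    ev1 S x (dfun fun x ↦ Real.exp (f x)) = Real.exp (f x) • ev1 S x (dfun f) := by
  rw [ev1_dfun_comp f.contMDiff x Real.differentiableAt_exp, Real.deriv_exp]

/-- The change of the connection form under a conformal change of the metric. -/
theorem connectionForm_conformal (f : C^∞⟮𝓡 3, M; 𝓘(ℝ, ℝ), ℝ⟯) (hS : IsOrthonormalFrame g S)
    (i j : Fin 3) :
    connectionForm (conformalChange f g) (rescaleFrame f S) i j = connectionForm g S i j +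
      (fsmul (fun x ↦ mvfderiv (𝓡 3) f x (S j x)) (coframe g S i)
        - fsmul (fun x ↦ mvfderiv (𝓡 3) f x (S i x)) (coframe g S j)) := by
  have hS' := isOrthonormalFrame_rescaleFrame f hS
  refine one_form_ext hS fun x k ↦ ?_
  set W := fun i j k ↦ connectionForm g S i j x ![S k x] with hW
  set T := fun i j k ↦ extD (coframe g S i) x ![S j x, S k x] with hT
  set W' := fun i j k ↦ connectionForm (conformalChange f g) (rescaleFrame f S) i j x ![S k x]
    with hW'
  set T' := fun i j k ↦ Real.exp (-f x) *
    extD (coframe (conformalChange f g) (rescaleFrame f S) i) x ![S j x, S k x] with hT'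
  set d := fun k ↦ mvfderiv (𝓡 3) f x (S k x) with hd
  have r1 (α : DiffForm M 1) (k : Fin 3) :
      α x ![rescaleFrame f S k x] = Real.exp (-f x) * α x ![S k x] := by
    have h1 : ![rescaleFrame f S k x] = fun i ↦ (fun _ : Fin 1 ↦ Real.exp (-f x)) i • ![S k x] i := by
      ext1 i; fin_cases i; rfl
    rw [h1, ContinuousAlternatingMap.map_smul_univ]
    simp
  have r2 (η : DiffForm M 2) (k l : Fin 3) : η x ![rescaleFrame f S k x, rescaleFrame f S l x] =
      Real.exp (-f x) * (Real.exp (-f x) * η x ![S k x, S l x]) := by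
    have h1 : ![rescaleFrame f S k x, rescaleFrame f S l x] =
        fun i ↦ (fun _ : Fin 2 ↦ Real.exp (-f x)) i • ![S k x, S l x] i := by
      ext1 i; fin_cases i <;> rfl
    rw [h1, ContinuousAlternatingMap.map_smul_univ]
    simp [mul_assoc, pow_two]
  have k1 := connection_koszul (W := W) (T := T)
    (fun i j k ↦ by simp only [hW]; rw [connectionForm_antisymm hS i j]; rfl)
    (fun i j k ↦ extD_coframe hS i j k x) i j k
  have k2 := connection_koszul (W := W') (T := T')
    (fun i j k ↦ by simp only [hW']; rw [connectionForm_antisymm hS' i j]; rfl)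
    (fun i j k ↦ by
      have := extD_coframe hS' i j k x
      rw [r1, r1, r2, ← mul_sub] at this
      exact mul_left_cancel₀ (Real.exp_ne_zero _) this) i j k
  have hTT (i j k : Fin 3) : T' i j k = T i j k + d j * e3 i k - d k * e3 i j := by
    have h1 := congrFun (congrFun (congrArg (ev2 S x) (extD_fsmul (smoothFun_exp f)
      (isSmoothForm_coframe g i (hS.1 i)))) j) k
    rw [ev2_add, ev2_wedge, ev2_fsmul, ev1_dfun_exp, ev1_coframe hS] at h1
    have h2 : Real.exp (-f x) * Real.exp (f x) = 1 := by rw [← Real.exp_add]; simp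
    have h3 : T' i j k = Real.exp (-f x) * ev2 S x (extD (fsmul (fun x ↦ Real.exp (f x))
      (coframe g S i))) j k := by rw [hT', ← coframe_conformal f]; rfl
    rw [h3, h1]
    have h4 : T i j k = ev2 S x (extD (coframe g S i)) j k := rfl
    have h5 (k : Fin 3) : d k = ev1 S x (dfun f) k := rfl
    simp only [w11, Pi.add_apply, Pi.smul_apply, smul_eq_mul, h4, h5]
    linear_combination (ev2 S x (extD (coframe g S i)) j k + ev1 S x (dfun f) j * e3 i k
      - ev1 S x (dfun f) k * e3 i j) * h2
  have hfin : (connectionForm g S i j + (fsmul (fun x ↦ mvfderiv (𝓡 3) f x (S j x)) (coframe g S i)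
        - fsmul (fun x ↦ mvfderiv (𝓡 3) f x (S i x)) (coframe g S j))) x ![S k x] =
      W i j k + (d j * e3 i k - d i * e3 j k) := by
    rw [← ev1_coframe hS i x, ← ev1_coframe hS j x]
    rfl
  rw [hfin, k1]
  refine k2.trans ?_
  rw [hTT, hTT, hTT]
  have hsym (i j : Fin 3) : e3 i j = e3 j i := by simp only [e3, eq_comm]
  rw [hsym k i, hsym k j, hsym j i]
  ring

theorem extD_coframe_eq (hS : IsOrthonormalFrame g S) (i : Fin 3) :
    extD (coframe g S i) = - ∑ j, wedge (connectionForm g S i j) (coframe g S j) := by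
  refine two_form_ext_ev hS fun x ↦ ?_
  rw [ev2_neg, ev2_sum]
  simp only [ev2_wedge, ev1_coframe hS]
  funext k l
  refine (extD_coframe hS i k l x).trans ?_
  have h : ∀ k j, ev1 S x (connectionForm g S i j) k = connectionForm g S i j x ![S k x] :=
    fun _ _ ↦ rfl
  simp only [← h]
  fin_cases k <;> fin_cases l <;> simp [Fin.sum_univ_three, w11, e3] <;> ring

theorem bianchi (hS : IsOrthonormalFrame g S) (i : Fin 3) (x : M) :
    ∑ j, (w12 (e3 j) (ev2 S x (extD (connectionForm g S i j)))
      - w12 (ev1 S x (connectionForm g S i j)) (ev2 S x (extD (coframe g S j)))) = 0 := by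
  have hω (i j : Fin 3) := isSmoothForm_connectionForm hS i j
  have he (i : Fin 3) := isSmoothForm_coframe g i (hS.1 i)
  have h1 := extD_extD (he i)
  rw [extD_coframe_eq hS i, extD_neg (IsSmoothForm.sum _ fun j _ ↦ (hω i j).wedge (he j)),
    extD_sum _ fun j _ ↦ (hω i j).wedge (he j), neg_eq_zero] at h1
  have h2 := congrArg (ev3 S x) h1
  rw [ev3_sum, ev3_zero] at h2
  rw [← h2]
  refine Finset.sum_congr rfl fun j _ ↦ ?_
  rw [extD_wedge (hω i j) (he j), ev3_sub, ev3_wedge, ev3_wedge, ev1_coframe hS]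

/-- For corresponding frames of conformal metrics, the Chern-Simons forms differ by an exact
form. -/
theorem exists_chernSimonsForm_conformal (f : C^∞⟮𝓡 3, M; 𝓘(ℝ, ℝ), ℝ⟯)
    (hS : IsOrthonormalFrame g S) : ∃ β : DiffForm M 2, IsSmoothForm β ∧
      chernSimonsForm (conformalChange f g) (rescaleFrame f S) =
        chernSimonsForm g S + extD β := by
  have hS' := isOrthonormalFrame_rescaleFrame f hS
  set F : Fin 3 → M → ℝ := fun k x ↦ mvfderiv (𝓡 3) f x (S k x) with hF
  have hFs (k : Fin 3) : SmoothFun (F k) := smoothFun_mvfderiv f.contMDiff (hS.1 k)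
  have he (i : Fin 3) := isSmoothForm_coframe g i (hS.1 i)
  have hω (i j : Fin 3) := isSmoothForm_connectionForm hS i j
  have hfe (i j : Fin 3) := IsSmoothForm.fsmul (hFs i) (he j)
  set A : Fin 3 → Fin 3 → DiffForm M 1 := fun i j ↦
    fsmul (F j) (coframe g S i) - fsmul (F i) (coframe g S j) with hA
  have hAs (i j : Fin 3) : IsSmoothForm (A i j) := (hfe j i).sub (hfe i j)
  have hconn (i j : Fin 3) : connectionForm (conformalChange f g) (rescaleFrame f S) i j =
      connectionForm g S i j + A i j := connectionForm_conformal f hS i j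
  have hw (i j : Fin 3) := (hω i j).wedge (hAs i j)
  refine ⟨(2 : ℝ) • (wedge (connectionForm g S 0 1) (A 0 1) + wedge (connectionForm g S 0 2) (A 0 2)
    + wedge (connectionForm g S 1 2) (A 1 2)), (((hw _ _).add (hw _ _)).add (hw _ _)).const_smul 2,
    three_form_ext hS fun x ↦ ?_⟩
  change ev3 S x _ = ev3 S x _
  rw [ev3_add, extD_const_smul (((hw _ _).add (hw _ _)).add (hw _ _)), ev3_smul,
    extD_add ((hw _ _).add (hw _ _)) (hw _ _), extD_add (hw _ _) (hw _ _), ev3_add, ev3_add,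
    chernSimonsForm, chernSimonsForm, csForm_antisymm (connectionForm_antisymm hS) hω,
    csForm_antisymm (connectionForm_antisymm hS') (isSmoothForm_connectionForm hS')]
  simp only [hconn]
  rw [extD_add (hω _ _) (hAs _ _), extD_add (hω _ _) (hAs _ _), extD_add (hω _ _) (hAs _ _),
    extD_wedge (hω _ _) (hAs _ _), extD_wedge (hω _ _) (hAs _ _), extD_wedge (hω _ _) (hAs _ _)]
  have e1 (i j : Fin 3) : ev1 S x (A i j) = F j x • e3 i - F i x • e3 j := by
    rw [hA, ev1_sub, ev1_fsmul, ev1_fsmul, ev1_coframe hS, ev1_coframe hS]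
  have e2 (i j : Fin 3) : ev2 S x (extD (A i j)) =
      w11 (ev1 S x (dfun (F j))) (e3 i) + F j x • ev2 S x (extD (coframe g S i)) -
      (w11 (ev1 S x (dfun (F i))) (e3 j) + F i x • ev2 S x (extD (coframe g S j))) := by
    rw [hA, extD_sub (hfe j i) (hfe i j), extD_fsmul (hFs j) (he i), extD_fsmul (hFs i) (he j),
      ev2_sub, ev2_add, ev2_add, ev2_wedge, ev2_wedge, ev2_fsmul, ev2_fsmul, ev1_coframe hS,
      ev1_coframe hS]
  simp only [ev3_sub, ev3_wedge, ev1_add, ev2_add, e1, e2]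
  have hd (i : Fin 3) : connectionForm g S i i = 0 := by
    refine one_form_ext hS fun x k ↦ ?_
    have := congrArg (fun η ↦ η x ![S k x]) (connectionForm_antisymm hS i i)
    exact self_eq_neg.1 this
  have z1 : ev1 S x (0 : DiffForm M 1) = 0 := rfl
  have z2 : ev2 S x (0 : DiffForm M 2) = 0 := rfl
  have hT (i : Fin 3) : ev2 S x (extD (coframe g S i)) =
      -∑ j, w11 (ev1 S x (connectionForm g S i j)) (e3 j) := by
    rw [extD_coframe_eq hS, ev2_neg, ev2_sum]
    simp only [ev2_wedge, ev1_coframe hS]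
  have n10 : connectionForm g S 1 0 = -connectionForm g S 0 1 := connectionForm_antisymm hS 1 0
  have n20 : connectionForm g S 2 0 = -connectionForm g S 0 2 := connectionForm_antisymm hS 2 0
  have n21 : connectionForm g S 2 1 = -connectionForm g S 1 2 := connectionForm_antisymm hS 2 1
  have hB (i : Fin 3) := bianchi hS i x
  have hclosed := congrArg (ev2 S x) (extD_dfun f.contMDiff)
  rw [dfun_eq_sum hS, extD_sum _ fun i _ ↦ hfe i i, ev2_sum] at hclosed
  have e3' (i : Fin 3) : ev2 S x (extD (fsmul (F i) (coframe g S i))) =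
      w11 (ev1 S x (dfun (F i))) (e3 i) + F i x • ev2 S x (extD (coframe g S i)) := by
    rw [extD_fsmul (hFs i) (he i), ev2_add, ev2_wedge, ev2_fsmul, ev1_coframe hS]
  have B0 := hB 0
  have B1 := hB 1
  have B2 := hB 2
  have hT0 := hT 0
  have hT1 := hT 1
  have hT2 := hT 2
  have w0 (D : Fin 3 → Fin 3 → ℝ) : w12 0 D = 0 := by simp [w12]
  have w0' (D : Fin 3 → ℝ) : w12 D 0 = 0 := by simp [w12]
  have w1 (D : Fin 3 → ℝ) : w11 0 D = 0 := by funext k l; simp [w11]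
  have w1n (D E : Fin 3 → ℝ) : w11 (-D) E = -w11 D E := by
    funext k l
    simp only [w11, Pi.neg_apply]
    ring
  have w2n (D : Fin 3 → ℝ) (E : Fin 3 → Fin 3 → ℝ) : w12 (-D) E = -w12 D E := by
    simp only [w12, Pi.neg_apply]
    ring
  have w2n' (D : Fin 3 → ℝ) (E : Fin 3 → Fin 3 → ℝ) : w12 D (-E) = -w12 D E := by
    simp only [w12, Pi.neg_apply]
    ring
  simp only [Fin.sum_univ_three, hd, extD_zero, z1, z2, w0, w0', w1, n10, n20, n21, ev1_neg,
    extD_neg (hω _ _), ev2_neg, w1n, w2n, w2n'] at B0 B1 B2 hT0 hT1 hT2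
  refine conformal_identity (ev1 S x (connectionForm g S 0 1)) (ev1 S x (connectionForm g S 0 2))
    (ev1 S x (connectionForm g S 1 2)) (fun i ↦ F i x) _ _ _ (fun i ↦ ev1 S x (dfun (F i)))
    (fun i ↦ ev2 S x (extD (coframe g S i))) ?_ ?_ ?_ ?_ ?_ ?_ ?_
  · rw [hT0]; abel
  · rw [hT1]; abel
  · rw [hT2]; abel
  · linear_combination B0
  · linear_combination B1
  · linear_combination B2
  · simp only [Fin.sum_univ_three, e3', ← add_assoc] at hclosed
    rw [hclosed, z2, w0']

end

section
variable {M : Type*} [TopologicalSpace M] [ChartedSpace E3 M] [IsManifold (𝓡 3) ∞ M]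
variable {g : Metric M} {S S' : Fin 3 → VField M}

/-! ### Matrix-valued functions -/

/-- Smooth matrix-valued functions. -/
abbrev SmoothMat (a : M → Matrix (Fin 3) (Fin 3) ℝ) : Prop := ∀ i j, SmoothFun fun x ↦ a x i j

theorem SmoothFun.mul {f h : M → ℝ} (hf : SmoothFun f) (hh : SmoothFun h) :
    SmoothFun fun x ↦ f x * h x := ContMDiff.mul hf hh

theorem SmoothFun.add {f h : M → ℝ} (hf : SmoothFun f) (hh : SmoothFun h) :
    SmoothFun fun x ↦ f x + h x := ContMDiff.add hf hh

theorem SmoothFun.const (c : ℝ) : SmoothFun fun _ : M ↦ c := contMDiff_const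

theorem SmoothFun.sum {ι : Type*} (s : Finset ι) {f : ι → M → ℝ} (h : ∀ i, SmoothFun (f i)) :
    SmoothFun fun x ↦ ∑ i ∈ s, f i x := contMDiff_finsetSum fun i _ ↦ h i

theorem mvfderiv_mul_fun {f h : M → ℝ} (hf : SmoothFun f) (hh : SmoothFun h) (x : M)
    (v : TangentSpace (𝓡 3) x) : mvfderiv (𝓡 3) (fun y ↦ f y * h y) x v =
      f x * mvfderiv (𝓡 3) h x v + mvfderiv (𝓡 3) f x v * h x := by
  have := mvfderiv_mul (hf.mdifferentiableAt (x := x) (by simp))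
    (hh.mdifferentiableAt (x := x) (by simp))
  refine congr($this v).trans ?_
  simp [mul_comm]

theorem mvfderiv_sum_fun {ι : Type*} (s : Finset ι) {f : ι → M → ℝ}
    (hf : ∀ i, SmoothFun (f i)) (x : M) (v : TangentSpace (𝓡 3) x) :
    mvfderiv (𝓡 3) (fun y ↦ ∑ i ∈ s, f i y) x v = ∑ i ∈ s, mvfderiv (𝓡 3) (f i) x v := by
  classical
  induction s using Finset.induction_on with
  | empty =>
    simp only [Finset.sum_empty]
    rw [mvfderiv_const]; rfl
  | insert i s hi ih =>
    simp only [Finset.sum_insert hi]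
    rw [← ih]
    have := mvfderiv_add ((hf i).mdifferentiableAt (x := x) (by simp))
      ((SmoothFun.sum s hf).mdifferentiableAt (x := x) (by simp))
    exact congr($this v)

theorem mvfderiv_const_fun (c : ℝ) (x : M) (v : TangentSpace (𝓡 3) x) :
    mvfderiv (𝓡 3) (fun _ : M ↦ c) x v = 0 := by
  rw [mvfderiv_const]; rfl

/-- The derivative of a matrix-valued function in the direction of the vector field `S p`. -/
def dMat (S : Fin 3 → VField M) (a : M → Matrix (Fin 3) (Fin 3) ℝ) (x : M) (p : Fin 3) :
    Matrix (Fin 3) (Fin 3) ℝ := Matrix.of fun i j ↦ mvfderiv (𝓡 3) (fun y ↦ a y i j) x (S p x)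

theorem dMat_mul {a b : M → Matrix (Fin 3) (Fin 3) ℝ} (ha : SmoothMat a) (hb : SmoothMat b)
    (x : M) (p : Fin 3) :
    dMat S (fun y ↦ a y * b y) x p = dMat S a x p * b x + a x * dMat S b x p := by
  ext i j
  simp only [dMat, Matrix.of_apply, Matrix.mul_apply, Matrix.add_apply]
  rw [mvfderiv_sum_fun _ fun k ↦ (ha i k).mul (hb k j), ← Finset.sum_add_distrib]
  refine Finset.sum_congr rfl fun k _ ↦ ?_
  rw [mvfderiv_mul_fun (ha i k) (hb k j), add_comm]

theorem dMat_transpose (a : M → Matrix (Fin 3) (Fin 3) ℝ) (x : M) (p : Fin 3) :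
    dMat S (fun y ↦ (a y).transpose) x p = (dMat S a x p).transpose := rfl

theorem dMat_const (a : Matrix (Fin 3) (Fin 3) ℝ) (x : M) (p : Fin 3) :
    dMat S (fun _ ↦ a) x p = 0 := by
  ext i j
  exact mvfderiv_const_fun _ _ _

open Matrix

/-- The components of `aᵀ da`. -/
def mcMat (S : Fin 3 → VField M) (a : M → Matrix (Fin 3) (Fin 3) ℝ) (x : M) (p : Fin 3) :
    Matrix (Fin 3) (Fin 3) ℝ := (a x)ᵀ * dMat S a x p

theorem mcMat_transpose {a : M → Matrix (Fin 3) (Fin 3) ℝ} (ha : SmoothMat a)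
    (h1 : ∀ x, (a x)ᵀ * a x = 1) (x : M) (p : Fin 3) : (mcMat S a x p)ᵀ = - mcMat S a x p := by
  have h := dMat_mul (S := S) (a := fun y ↦ (a y)ᵀ) (fun i j ↦ ha j i) ha x p
  simp only [h1] at h
  rw [dMat_const, dMat_transpose] at h
  rw [mcMat, transpose_mul, transpose_transpose]
  exact eq_neg_of_add_eq_zero_left h.symm

/-- The matrix of `1`-forms `aᵀ da`. -/
def mcForm (a : M → Matrix (Fin 3) (Fin 3) ℝ) (i j : Fin 3) : DiffForm M 1 :=
  ∑ k, fsmul (fun x ↦ a x k i) (dfun fun x ↦ a x k j)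

theorem isSmoothForm_mcForm {a : M → Matrix (Fin 3) (Fin 3) ℝ} (ha : SmoothMat a) (i j : Fin 3) :
    IsSmoothForm (mcForm a i j) :=
  IsSmoothForm.sum _ fun k _ ↦ IsSmoothForm.fsmul (ha k i) (IsSmoothForm.dfun (ha k j))

theorem ev1_mcForm (a : M → Matrix (Fin 3) (Fin 3) ℝ) (i j : Fin 3) (x : M) (p : Fin 3) :
    ev1 S x (mcForm a i j) p = mcMat S a x p i j := by
  rw [mcForm, ev1_sum, mcMat, mul_apply, Finset.sum_apply]
  rfl

theorem ev2_extD_mcForm {a : M → Matrix (Fin 3) (Fin 3) ℝ} (ha : SmoothMat a)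
    (h1 : ∀ x, (a x)ᵀ * a x = 1) (i j : Fin 3) (x : M) (p q : Fin 3) :
    ev2 S x (extD (mcForm a i j)) p q = ((mcMat S a x p)ᵀ * mcMat S a x q
      - (mcMat S a x q)ᵀ * mcMat S a x p) i j := by
  have h2 : a x * (a x)ᵀ = 1 := mul_eq_one_comm.1 (h1 x)
  have e (p q : Fin 3) : (mcMat S a x p)ᵀ * mcMat S a x q = (dMat S a x p)ᵀ * dMat S a x q := by
    rw [mcMat, mcMat, transpose_mul, transpose_transpose, Matrix.mul_assoc,
      ← Matrix.mul_assoc (a x), h2, Matrix.one_mul]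
  rw [mcForm, extD_sum _ fun k _ ↦ IsSmoothForm.fsmul (ha k i) (IsSmoothForm.dfun (ha k j)), ev2_sum,
    e, e, Matrix.sub_apply, mul_apply, mul_apply, ← Finset.sum_sub_distrib, Finset.sum_apply,
    Finset.sum_apply]
  refine Finset.sum_congr rfl fun k _ ↦ ?_
  rw [extD_fsmul (ha k i) (IsSmoothForm.dfun (ha k j)), extD_dfun (ha k j), ev2_add, ev2_wedge]
  change dMat S a x p k i * dMat S a x q k j - dMat S a x q k i * dMat S a x p k j + a x k i * 0 = _
  rw [mul_zero, add_zero]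
  rfl

/-- The matrix of `1`-forms `aᵀ θ a`. -/
def conjForm (a : M → Matrix (Fin 3) (Fin 3) ℝ) (θ : Matrix (Fin 3) (Fin 3) (DiffForm M 1))
    (i j : Fin 3) : DiffForm M 1 :=
  ∑ k, ∑ l, fsmul (fun x ↦ a x k i * a x l j) (θ k l)

/-- The components of a matrix of `1`-forms. -/
def evMat (S : Fin 3 → VField M) (θ : Matrix (Fin 3) (Fin 3) (DiffForm M 1)) (x : M) (p : Fin 3) :
    Matrix (Fin 3) (Fin 3) ℝ := Matrix.of fun i j ↦ ev1 S x (θ i j) p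

/-- The components of the exterior derivative of a matrix of `1`-forms. -/
def evMatD (S : Fin 3 → VField M) (θ : Matrix (Fin 3) (Fin 3) (DiffForm M 1)) (x : M)
    (p q : Fin 3) :
    Matrix (Fin 3) (Fin 3) ℝ := Matrix.of fun i j ↦ ev2 S x (extD (θ i j)) p q

theorem isSmoothForm_conjForm {a : M → Matrix (Fin 3) (Fin 3) ℝ} (ha : SmoothMat a)
    {θ : Matrix (Fin 3) (Fin 3) (DiffForm M 1)} (hθ : ∀ i j, IsSmoothForm (θ i j)) (i j : Fin 3) :
    IsSmoothForm (conjForm a θ i j) :=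
  IsSmoothForm.sum _ fun k _ ↦ IsSmoothForm.sum _ fun l _ ↦
    IsSmoothForm.fsmul ((ha k i).mul (ha l j)) (hθ k l)

theorem mul_mul_apply_eq_sum (A B C : Matrix (Fin 3) (Fin 3) ℝ) (i j : Fin 3) :
    (Aᵀ * B * C) i j = ∑ k, ∑ l, A k i * B k l * C l j := by
  simp only [mul_apply, transpose_apply, Finset.sum_mul]
  exact Finset.sum_comm

theorem ev1_conjForm (a : M → Matrix (Fin 3) (Fin 3) ℝ)
    (θ : Matrix (Fin 3) (Fin 3) (DiffForm M 1)) (i j : Fin 3) (x : M) (p : Fin 3) :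
    ev1 S x (conjForm a θ i j) p = ((a x)ᵀ * evMat S θ x p * a x) i j := by
  rw [conjForm, ev1_sum, mul_mul_apply_eq_sum, Finset.sum_apply]
  simp only [ev1_sum, Finset.sum_apply]
  refine Finset.sum_congr rfl fun k _ ↦ Finset.sum_congr rfl fun l _ ↦ ?_
  change a x k i * a x l j * ev1 S x (θ k l) p = a x k i * ev1 S x (θ k l) p * a x l j
  ring

theorem ev2_extD_conjForm {a : M → Matrix (Fin 3) (Fin 3) ℝ} (ha : SmoothMat a)
    (h1 : ∀ x, (a x)ᵀ * a x = 1)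
    {θ : Matrix (Fin 3) (Fin 3) (DiffForm M 1)} (hθ : ∀ i j, IsSmoothForm (θ i j))
    (i j : Fin 3) (x : M) (p q : Fin 3) :
    ev2 S x (extD (conjForm a θ i j)) p q =
      ((mcMat S a x p)ᵀ * ((a x)ᵀ * evMat S θ x q * a x)
        - (mcMat S a x q)ᵀ * ((a x)ᵀ * evMat S θ x p * a x)
        + (a x)ᵀ * evMat S θ x q * a x * mcMat S a x p
        - (a x)ᵀ * evMat S θ x p * a x * mcMat S a x q
        + (a x)ᵀ * evMatD S θ x p q * a x) i j := by
  have h2 : a x * (a x)ᵀ = 1 := mul_eq_one_comm.1 (h1 x)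
  have e (p q : Fin 3) : (mcMat S a x p)ᵀ * ((a x)ᵀ * evMat S θ x q * a x) =
      (dMat S a x p)ᵀ * evMat S θ x q * a x := by
    rw [mcMat, transpose_mul, transpose_transpose]
    simp only [← Matrix.mul_assoc]
    rw [Matrix.mul_assoc _ (a x), h2, Matrix.mul_one]
  have e' (p q : Fin 3) : (a x)ᵀ * evMat S θ x q * a x * mcMat S a x p =
      (a x)ᵀ * evMat S θ x q * dMat S a x p := by
    rw [mcMat, Matrix.mul_assoc _ (a x), ← Matrix.mul_assoc (a x), h2, Matrix.one_mul]
  rw [e, e, e', e', Matrix.add_apply, Matrix.sub_apply, Matrix.add_apply, Matrix.sub_apply]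
  simp only [mul_mul_apply_eq_sum, ← Finset.sum_sub_distrib, ← Finset.sum_add_distrib]
  rw [conjForm, extD_sum _ fun k _ ↦ IsSmoothForm.sum _ fun l _ ↦
    IsSmoothForm.fsmul ((ha k i).mul (ha l j)) (hθ k l), ev2_sum, Finset.sum_apply, Finset.sum_apply]
  refine Finset.sum_congr rfl fun k _ ↦ ?_
  rw [extD_sum _ fun l _ ↦ IsSmoothForm.fsmul ((ha k i).mul (ha l j)) (hθ k l), ev2_sum,
    Finset.sum_apply, Finset.sum_apply]
  refine Finset.sum_congr rfl fun l _ ↦ ?_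
  rw [extD_fsmul ((ha k i).mul (ha l j)) (hθ k l), ev2_add, ev2_wedge]
  have hd (p : Fin 3) : ev1 S x (dfun fun y ↦ a y k i * a y l j) p =
      a x k i * dMat S a x p l j + dMat S a x p k i * a x l j :=
    mvfderiv_mul_fun (ha k i) (ha l j) x (S p x)
  change ev1 S x (dfun fun y ↦ a y k i * a y l j) p * ev1 S x (θ k l) q -
    ev1 S x (dfun fun y ↦ a y k i * a y l j) q * ev1 S x (θ k l) p +
    a x k i * a x l j * ev2 S x (extD (θ k l)) p q = _
  rw [hd, hd]
  change _ = dMat S a x p k i * ev1 S x (θ k l) q * a x l j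
    - dMat S a x q k i * ev1 S x (θ k l) p * a x l j
    + a x k i * ev1 S x (θ k l) q * dMat S a x p l j
    - a x k i * ev1 S x (θ k l) p * dMat S a x q l j
    + a x k i * ev2 S x (extD (θ k l)) p q * a x l j
  ring

/-! ### Change of frame -/

/-- The transition matrix between two frames. -/
def frameChange (g : Metric M) (S S' : Fin 3 → VField M) (x : M) : Matrix (Fin 3) (Fin 3) ℝ :=
  Matrix.of fun k j ↦ g.inner x (S k x) (S' j x)

theorem smoothMat_frameChange (hS : IsOrthonormalFrame g S) (hS' : IsOrthonormalFrame g S') :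
    SmoothMat (frameChange g S S') := fun i j ↦ smoothFun_inner g (hS.1 i) (hS'.1 j)

theorem inner_eq_sum (hS : IsOrthonormalFrame g S) (x : M) (v w : TangentSpace (𝓡 3) x) :
    g.inner x v w = ∑ k, g.inner x (S k x) v * g.inner x (S k x) w := by
  conv_lhs => rw [← sum_coframe_smul hS x v]
  simp

theorem frameChange_transpose_mul (hS : IsOrthonormalFrame g S) (hS' : IsOrthonormalFrame g S')
    (x : M) : (frameChange g S S' x)ᵀ * frameChange g S S' x = 1 := by
  ext i j
  rw [mul_apply, one_apply, ← hS'.2 x i j, inner_eq_sum hS]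
  rfl

theorem connectionForm_frameChange (hS : IsOrthonormalFrame g S) (hS' : IsOrthonormalFrame g S')
    (i j : Fin 3) : connectionForm g S' i j =
      conjForm (frameChange g S S') (connectionForm g S) i j
        + mcForm (frameChange g S S') i j := by
  refine one_form_ext_ev hS fun x ↦ ?_
  rw [ev1_add]
  funext p
  rw [Pi.add_apply, ev1_conjForm, ev1_mcForm, mcMat, Matrix.mul_assoc, ← Matrix.add_apply,
    ← Matrix.mul_add, mul_apply]
  refine (inner_eq_sum hS x _ _).trans (Finset.sum_congr rfl fun k _ ↦ ?_)
  congr 1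
  have h := (leviCivita_spec g).2 (S p) (S k) (S' j) x (SmoothField.diffAt (hS.1 k) x)
    (SmoothField.diffAt (hS'.1 j) x)
  rw [inner_eq_sum hS x _ (S' j x)] at h
  have h2 : g.inner x (S k x) (leviCivita g (S' j) x (S p x)) = dMat S (frameChange g S S') x p k j
      - ∑ l, connectionForm g S l k x ![S p x] * frameChange g S S' x l j := by
    simp only [connectionForm_apply]
    rw [eq_sub_iff_add_eq']
    exact h.symm
  refine h2.trans ?_
  have h3 (l : Fin 3) : connectionForm g S l k x ![S p x] = -evMat S (connectionForm g S) x p k l := by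
    rw [connectionForm_antisymm hS l k]; rfl
  simp only [h3, neg_mul, Finset.sum_neg_distrib, sub_neg_eq_add]
  rw [Matrix.add_apply, mul_apply, add_comm]

theorem trace_conj (a U V : Matrix (Fin 3) (Fin 3) ℝ) (h : a * aᵀ = 1) :
    ((aᵀ * U * a) * (aᵀ * V * a)).trace = (U * V).trace := by
  have : (aᵀ * U * a) * (aᵀ * V * a) = aᵀ * (U * V * a) := by
    simp only [Matrix.mul_assoc]
    rw [← Matrix.mul_assoc a, h, Matrix.one_mul]
  rw [this, trace_mul_comm, Matrix.mul_assoc, h, Matrix.mul_one]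

theorem trace_conj_three (a U V W : Matrix (Fin 3) (Fin 3) ℝ) (h : a * aᵀ = 1) :
    ((aᵀ * U * a) * ((aᵀ * V * a) * (aᵀ * W * a))).trace = (U * (V * W)).trace := by
  have : (aᵀ * V * a) * (aᵀ * W * a) = aᵀ * (V * W) * a := by
    simp only [Matrix.mul_assoc]
    rw [← Matrix.mul_assoc a, h, Matrix.one_mul]
  rw [this, trace_conj a _ _ h]

/-- The Chern-Simons polynomial in terms of traces. -/
theorem antisymm_entries {X : Matrix (Fin 3) (Fin 3) ℝ} (h : Xᵀ = -X) :
    X 0 0 = 0 ∧ X 1 1 = 0 ∧ X 2 2 = 0 ∧ X 1 0 = -X 0 1 ∧ X 2 0 = -X 0 2 ∧ X 2 1 = -X 1 2 := by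
  have h' (i j : Fin 3) : X j i = -X i j := congrFun (congrFun h i) j
  exact ⟨self_eq_neg.1 (h' 0 0), self_eq_neg.1 (h' 1 1), self_eq_neg.1 (h' 2 2), h' 0 1, h' 0 2,
    h' 1 2⟩

theorem cs3_eq_trace (W : Fin 3 → Matrix (Fin 3) (Fin 3) ℝ)
    (F : Fin 3 → Fin 3 → Matrix (Fin 3) (Fin 3) ℝ) (hW : ∀ p, (W p)ᵀ = -W p)
    (hF : ∀ p q, (F p q)ᵀ = -F p q) :
    cs3 (fun p ↦ W p 0 1) (fun p ↦ W p 0 2) (fun p ↦ W p 1 2)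
      (fun p q ↦ F p q 0 1) (fun p q ↦ F p q 0 2) (fun p q ↦ F p q 1 2) =
    (W 0 * F 1 2).trace - (W 1 * F 0 2).trace + (W 2 * F 0 1).trace
      + 4 * (W 0 * (W 1 * W 2)).trace := by
  obtain ⟨a1, a2, a3, a4, a5, a6⟩ := antisymm_entries (hW 0)
  obtain ⟨b1, b2, b3, b4, b5, b6⟩ := antisymm_entries (hW 1)
  obtain ⟨c1, c2, c3, c4, c5, c6⟩ := antisymm_entries (hW 2)
  obtain ⟨d1, d2, d3, d4, d5, d6⟩ := antisymm_entries (hF 1 2)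
  obtain ⟨e1, e2, e3, e4, e5, e6⟩ := antisymm_entries (hF 0 2)
  obtain ⟨f1, f2, f3, f4, f5, f6⟩ := antisymm_entries (hF 0 1)
  simp only [trace_fin_three, mul_apply, Fin.sum_univ_three, cs3, w12, w11, a1, a2, a3, a4, a5, a6,
    b1, b2, b3, b4, b5, b6, c1, c2, c3, c4, c5, c6, d1, d2, d3, d4, d5, d6, e1, e2, e3, e4, e5, e6,
    f1, f2, f3, f4, f5, f6]
  ring

/-- The change of the Chern-Simons form under a change of frame. -/
theorem exists_chernSimonsForm_frameChange (hS : IsOrthonormalFrame g S)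
    (hS' : IsOrthonormalFrame g S') : ∃ β : DiffForm M 2, IsSmoothForm β ∧
      chernSimonsForm g S' = chernSimonsForm g S
        + (-2 : ℝ) • wedge (mcForm (frameChange g S S') 0 1) (wedge (mcForm (frameChange g S S') 0 2)
          (mcForm (frameChange g S S') 1 2)) + extD β := by
  set a := frameChange g S S' with ha_def
  have ha : SmoothMat a := smoothMat_frameChange hS hS'
  have h1 : ∀ x, (a x)ᵀ * a x = 1 := frameChange_transpose_mul hS hS'
  have hω (i j : Fin 3) := isSmoothForm_connectionForm hS i j
  have hρ (i j : Fin 3) := isSmoothForm_conjForm ha hω i j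
  have hθ (i j : Fin 3) := isSmoothForm_mcForm ha i j
  have hw (i j : Fin 3) := (hρ i j).wedge (hθ i j)
  have hconn (i j : Fin 3) : connectionForm g S' i j =
      conjForm a (connectionForm g S) i j + mcForm a i j := connectionForm_frameChange hS hS' i j
  refine ⟨(-2 : ℝ) • (wedge (conjForm a (connectionForm g S) 0 1) (mcForm a 0 1)
    + wedge (conjForm a (connectionForm g S) 0 2) (mcForm a 0 2)
    + wedge (conjForm a (connectionForm g S) 1 2) (mcForm a 1 2)),
    (((hw _ _).add (hw _ _)).add (hw _ _)).const_smul (-2), three_form_ext hS fun x ↦ ?_⟩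
  change ev3 S x _ = ev3 S x _
  rw [ev3_add, ev3_add, ev3_smul, extD_const_smul (((hw _ _).add (hw _ _)).add (hw _ _)), ev3_smul,
    extD_add ((hw _ _).add (hw _ _)) (hw _ _), extD_add (hw _ _) (hw _ _), ev3_add, ev3_add,
    chernSimonsForm, chernSimonsForm, csForm_antisymm (connectionForm_antisymm hS) hω,
    csForm_antisymm (connectionForm_antisymm hS') (isSmoothForm_connectionForm hS')]
  simp only [hconn]
  rw [extD_add (hρ _ _) (hθ _ _), extD_add (hρ _ _) (hθ _ _), extD_add (hρ _ _) (hθ _ _),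
    extD_wedge (hρ _ _) (hθ _ _), extD_wedge (hρ _ _) (hθ _ _), extD_wedge (hρ _ _) (hθ _ _)]
  simp only [ev3_sub, ev3_wedge, ev2_wedge, ev1_add, ev2_add]
  have h2 : a x * (a x)ᵀ = 1 := mul_eq_one_comm.1 (h1 x)
  set W := evMat S (connectionForm g S) x with hW
  set F := evMatD S (connectionForm g S) x with hF
  set R : Fin 3 → Matrix (Fin 3) (Fin 3) ℝ := fun p ↦ (a x)ᵀ * W p * a x with hR
  set G : Fin 3 → Fin 3 → Matrix (Fin 3) (Fin 3) ℝ := fun p q ↦ (a x)ᵀ * F p q * a x with hG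
  set T := mcMat S a x with hT
  have aW (p : Fin 3) : (W p)ᵀ = -W p := by
    ext i j
    change ev1 S x (connectionForm g S j i) p = -ev1 S x (connectionForm g S i j) p
    rw [connectionForm_antisymm hS j i]; rfl
  have aF (p q : Fin 3) : (F p q)ᵀ = -F p q := by
    ext i j
    change ev2 S x (extD (connectionForm g S j i)) p q = -ev2 S x (extD (connectionForm g S i j)) p q
    rw [connectionForm_antisymm hS j i, extD_neg (hω i j)]; rfl
  have aR (p : Fin 3) : (R p)ᵀ = -R p := by
    simp [hR, transpose_mul, aW, Matrix.mul_assoc]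
  have aG (p q : Fin 3) : (G p q)ᵀ = -G p q := by
    simp [hG, transpose_mul, aF, Matrix.mul_assoc]
  have aT (p : Fin 3) : (T p)ᵀ = -T p := mcMat_transpose ha h1 x p
  have cs1 := cs3_eq_trace W F aW aF
  have cs2 := cs3_eq_trace R G aR aG
  simp only [hR, hG, trace_conj _ _ _ h2, trace_conj_three _ _ _ _ h2] at cs2
  rw [← cs1] at cs2
  have eρ (i j : Fin 3) : ev1 S x (conjForm a (connectionForm g S) i j) = fun p ↦ R p i j :=
    funext fun p ↦ ev1_conjForm a _ i j x p
  have eθ (i j : Fin 3) : ev1 S x (mcForm a i j) = fun p ↦ T p i j :=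
    funext fun p ↦ ev1_mcForm a i j x p
  have aT' (p : Fin 3) := antisymm_entries (aT p)
  have aR' (p : Fin 3) := antisymm_entries (aR p)
  have dθ (i j : Fin 3) : ev2 S x (extD (mcForm a i j)) = fun p q ↦
      ∑ m, (T p m i * T q m j - T q m i * T p m j) := by
    funext p q
    rw [ev2_extD_mcForm ha h1]
    simp only [Matrix.sub_apply, mul_apply, ← Finset.sum_sub_distrib]
    rfl
  have dρ (i j : Fin 3) : ev2 S x (extD (conjForm a (connectionForm g S) i j)) = fun p q ↦
      ∑ m, (T p m i * R q m j - T q m i * R p m j + R q i m * T p m j - R p i m * T q m j)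
        + G p q i j := by
    funext p q
    rw [ev2_extD_conjForm ha h1 hω, Matrix.add_apply]
    congr 1
    change ((T p)ᵀ * R q - (T q)ᵀ * R p + R q * T p - R p * T q) i j = _
    simp only [Matrix.sub_apply, Matrix.add_apply, mul_apply, ← Finset.sum_sub_distrib,
      ← Finset.sum_add_distrib]
    rfl
  have hc : ev1 S x (connectionForm g S 0 1) = (fun p ↦ W p 0 1) ∧
    ev1 S x (connectionForm g S 0 2) = (fun p ↦ W p 0 2) ∧
    ev1 S x (connectionForm g S 1 2) = (fun p ↦ W p 1 2) ∧
    ev2 S x (extD (connectionForm g S 0 1)) = (fun p q ↦ F p q 0 1) ∧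
    ev2 S x (extD (connectionForm g S 0 2)) = (fun p q ↦ F p q 0 2) ∧
    ev2 S x (extD (connectionForm g S 1 2)) = (fun p q ↦ F p q 1 2) := ⟨rfl, rfl, rfl, rfl, rfl, rfl⟩
  obtain ⟨c1, c2, c3, c4, c5, c6⟩ := hc
  rw [c1, c2, c3, c4, c5, c6, ← cs2]
  have key := gauge_identity (fun p ↦ R p 0 1) (fun p ↦ R p 0 2) (fun p ↦ R p 1 2)
    (fun p ↦ T p 0 1) (fun p ↦ T p 0 2) (fun p ↦ T p 1 2)
    (fun p q ↦ G p q 0 1) (fun p q ↦ G p q 0 2) (fun p q ↦ G p q 1 2)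
  have D01 : ev2 S x (extD (conjForm a (connectionForm g S) 0 1)) =
      (fun p q ↦ G p q 0 1) + (w11 (fun p ↦ R p 0 2) (fun p ↦ T p 1 2)
        - w11 (fun p ↦ R p 1 2) (fun p ↦ T p 0 2)) := by
    rw [dρ]
    funext p q
    simp only [Fin.sum_univ_three, aT', aR', w11, Pi.add_apply, Pi.sub_apply]
    ring
  have D02 : ev2 S x (extD (conjForm a (connectionForm g S) 0 2)) =
      (fun p q ↦ G p q 0 2) + (w11 (fun p ↦ R p 1 2) (fun p ↦ T p 0 1)
        - w11 (fun p ↦ R p 0 1) (fun p ↦ T p 1 2)) := by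
    rw [dρ]
    funext p q
    simp only [Fin.sum_univ_three, aT', aR', w11, Pi.add_apply, Pi.sub_apply]
    ring
  have D12 : ev2 S x (extD (conjForm a (connectionForm g S) 1 2)) =
      (fun p q ↦ G p q 1 2) + (w11 (fun p ↦ R p 0 1) (fun p ↦ T p 0 2)
        - w11 (fun p ↦ R p 0 2) (fun p ↦ T p 0 1)) := by
    rw [dρ]
    funext p q
    simp only [Fin.sum_univ_three, aT', aR', w11, Pi.add_apply, Pi.sub_apply]
    ring
  have E01 : ev2 S x (extD (mcForm a 0 1)) = w11 (fun p ↦ T p 0 2) (fun p ↦ T p 1 2) := by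
    rw [dθ]
    funext p q
    simp only [Fin.sum_univ_three, aT', w11]
    ring
  have E02 : ev2 S x (extD (mcForm a 0 2)) = -w11 (fun p ↦ T p 0 1) (fun p ↦ T p 1 2) := by
    rw [dθ]
    funext p q
    simp only [Fin.sum_univ_three, aT', w11, Pi.neg_apply]
    ring
  have E12 : ev2 S x (extD (mcForm a 1 2)) = w11 (fun p ↦ T p 0 1) (fun p ↦ T p 0 2) := by
    rw [dθ]
    funext p q
    simp only [Fin.sum_univ_three, aT', w11]
    ring
  have n (u : Fin 3 → ℝ) (V : Fin 3 → Fin 3 → ℝ) : w12 u (-V) = -w12 u V := by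
    simp only [w12, Pi.neg_apply]
    ring
  rw [D01, D02, D12, E01, E02, E12, eρ, eρ, eρ, eθ, eθ, eθ, n, ← sub_eq_add_neg _ (w11 _ _)]
  refine key.trans ?_
  simp only [hR, hG]
  ring

end

/-! ### Rotation matrices -/

/-- The cosine of the angle of a rotation matrix. -/
def rotCos (A : Matrix (Fin 3) (Fin 3) ℝ) : ℝ := (A 0 0 + A 1 1 + A 2 2 - 1) / 2

/-- The independent entries of the antisymmetric part of a matrix. -/
def axial (A : Matrix (Fin 3) (Fin 3) ℝ) : Fin 3 → ℝ :=
  ![(A 1 0 - A 0 1) / 2, (A 2 0 - A 0 2) / 2, (A 2 1 - A 1 2) / 2]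

open Matrix

/-- A matrix in the special orthogonal group. -/
def IsRotation (A : Matrix (Fin 3) (Fin 3) ℝ) : Prop := Aᵀ * A = 1 ∧ A.det = 1

theorem IsRotation.adjugate_eq {A : Matrix (Fin 3) (Fin 3) ℝ} (h : IsRotation A) :
    A.adjugate = Aᵀ := by
  have h1 := A.mul_adjugate
  rw [h.2, one_smul] at h1
  calc A.adjugate = Aᵀ * A * A.adjugate := by rw [h.1, Matrix.one_mul]
    _ = Aᵀ := by rw [Matrix.mul_assoc, h1, Matrix.mul_one]

theorem IsRotation.minors_diag {A : Matrix (Fin 3) (Fin 3) ℝ} (h : IsRotation A) :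
    A 1 1 * A 2 2 - A 1 2 * A 2 1 = A 0 0 ∧ A 0 0 * A 2 2 - A 0 2 * A 2 0 = A 1 1 ∧
      A 0 0 * A 1 1 - A 0 1 * A 1 0 = A 2 2 := by
  have h1 := h.adjugate_eq
  rw [adjugate_fin_three] at h1
  have e (i j : Fin 3) := congrFun (congrFun h1 i) j
  exact ⟨by simpa using e 0 0, by simpa using e 1 1, by simpa using e 2 2⟩

theorem sum_sq_of_transpose_mul {A : Matrix (Fin 3) (Fin 3) ℝ} (h : Aᵀ * A = 1) (j : Fin 3) :
    A 0 j ^ 2 + A 1 j ^ 2 + A 2 j ^ 2 = 1 := by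
  have := congrFun (congrFun h j) j
  rw [mul_apply, Fin.sum_univ_three, one_apply_eq] at this
  simp only [transpose_apply] at this
  linear_combination this

theorem IsRotation.axial_sq {A : Matrix (Fin 3) (Fin 3) ℝ} (h : IsRotation A) :
    axial A 0 ^ 2 + axial A 1 ^ 2 + axial A 2 ^ 2 = 1 - rotCos A ^ 2 := by
  obtain ⟨m0, m1, m2⟩ := h.minors_diag
  have s (j) := sum_sq_of_transpose_mul h.1 j
  simp only [axial, rotCos, cons_val_zero, cons_val_one, cons_val]
  linear_combination (s 0 + s 1 + s 2) / 4 + (m0 + m1 + m2) / 2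

theorem IsRotation.rotCos_mem {A : Matrix (Fin 3) (Fin 3) ℝ} (h : IsRotation A) :
    rotCos A ∈ Icc (-1 : ℝ) 1 := by
  have := h.axial_sq
  refine abs_le.1 ((sq_le_one_iff_abs_le_one _).1 ?_)
  nlinarith [sq_nonneg (axial A 0), sq_nonneg (axial A 1), sq_nonneg (axial A 2)]

section
variable {M : Type*} [TopologicalSpace M] [ChartedSpace E3 M] [IsManifold (𝓡 3) ∞ M]
variable {g : Metric M} {S : Fin 3 → VField M}

/-- The pull-back of the volume form of the rotation group. -/
def volForm (a : M → Matrix (Fin 3) (Fin 3) ℝ) : DiffForm M 3 :=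
  wedge (mcForm a 0 1) (wedge (mcForm a 0 2) (mcForm a 1 2))

theorem isSmoothForm_volForm {a : M → Matrix (Fin 3) (Fin 3) ℝ} (ha : SmoothMat a) :
    IsSmoothForm (volForm a) :=
  (isSmoothForm_mcForm ha _ _).wedge ((isSmoothForm_mcForm ha _ _).wedge (isSmoothForm_mcForm ha _ _))

theorem smoothFun_rotCos {a : M → Matrix (Fin 3) (Fin 3) ℝ} (ha : SmoothMat a) :
    SmoothFun fun x ↦ rotCos (a x) := by
  simp only [rotCos, sub_eq_add_neg, div_eq_mul_inv]
  exact (((ha 0 0).add (ha 1 1)).add (ha 2 2)).add (SmoothFun.const _) |>.mul (SmoothFun.const _)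

theorem smoothFun_axial {a : M → Matrix (Fin 3) (Fin 3) ℝ} (ha : SmoothMat a) (i : Fin 3) :
    SmoothFun fun x ↦ axial (a x) i := by
  have (i j k l : Fin 3) : SmoothFun fun x ↦ (a x i j - a x k l) / 2 := by
    simp only [sub_eq_add_neg, div_eq_mul_inv]
    exact ((ha i j).add (ContMDiff.neg (ha k l))).mul (SmoothFun.const _)
  fin_cases i
  · exact this 1 0 0 1
  · exact this 2 0 0 2
  · exact this 2 1 1 2

theorem mvfderiv_lin {f : Fin 3 → M → ℝ} (hf : ∀ i, SmoothFun (f i)) (c : Fin 3 → ℝ) (d : ℝ) (x : M)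
    (v : TangentSpace (𝓡 3) x) :
    mvfderiv (𝓡 3) (fun y ↦ (∑ i, c i * f i y) + d) x v =
      ∑ i, c i * mvfderiv (𝓡 3) (f i) x v := by
  have h1 (i : Fin 3) : SmoothFun fun y ↦ c i * f i y := (SmoothFun.const (c i)).mul (hf i)
  have := mvfderiv_add ((SmoothFun.sum Finset.univ h1).mdifferentiableAt (x := x) (by simp))
      ((SmoothFun.const (M := M) d).mdifferentiableAt (x := x) (by simp))
  refine congr($this v).trans ?_
  change mvfderiv (𝓡 3) (fun y ↦ ∑ i, c i * f i y) x v + mvfderiv (𝓡 3) (fun _ : M ↦ d) x v = _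
  rw [mvfderiv_const_fun, add_zero, mvfderiv_sum_fun _ h1]
  refine Finset.sum_congr rfl fun i _ ↦ ?_
  rw [mvfderiv_mul_fun (SmoothFun.const (c i)) (hf i), mvfderiv_const_fun]
  ring

theorem ev1_dfun_rotCos {a : M → Matrix (Fin 3) (Fin 3) ℝ} (ha : SmoothMat a) (x : M) (p : Fin 3) :
    ev1 S x (dfun fun x ↦ rotCos (a x)) p =
      (dMat S a x p 0 0 + dMat S a x p 1 1 + dMat S a x p 2 2) / 2 := by
  have := mvfderiv_lin (f := fun i y ↦ a y i i) (fun i ↦ ha i i) (fun _ ↦ 1 / 2) (-1 / 2) x (S p x)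
  have e : (fun y ↦ (∑ i, 1 / 2 * a y i i) + -1 / 2) = fun y ↦ rotCos (a y) := by
    funext y; simp only [rotCos, Fin.sum_univ_three]; ring
  rw [e] at this
  refine this.trans ?_
  simp only [Fin.sum_univ_three, dMat, of_apply]
  ring

theorem ev1_dfun_axial {a : M → Matrix (Fin 3) (Fin 3) ℝ} (ha : SmoothMat a) (i : Fin 3) (x : M)
    (p : Fin 3) : ev1 S x (dfun fun x ↦ axial (a x) i) p = axial (dMat S a x p) i := by
  have key (i j k l : Fin 3) : mvfderiv (𝓡 3) (fun y ↦ (a y i j - a y k l) / 2) x (S p x) =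
      (dMat S a x p i j - dMat S a x p k l) / 2 := by
    have := mvfderiv_lin (f := ![fun y ↦ a y i j, fun y ↦ a y k l, fun _ ↦ 0])
      (fun m ↦ by fin_cases m; exacts [ha i j, ha k l, SmoothFun.const 0])
      ![1 / 2, -1 / 2, 0] 0 x (S p x)
    have e : (fun y ↦ (∑ m, ![1 / 2, -1 / 2, (0 : ℝ)] m *
        ![fun y ↦ a y i j, fun y ↦ a y k l, fun _ ↦ 0] m y) + 0) =
        fun y ↦ (a y i j - a y k l) / 2 := by
      funext y
      simp only [Fin.sum_univ_three, cons_val_zero, cons_val_one, cons_val]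
      ring
    rw [e] at this
    refine this.trans ?_
    simp only [Fin.sum_univ_three, dMat, of_apply, cons_val_zero, cons_val_one, cons_val]
    ring
  fin_cases i
  · exact key 1 0 0 1
  · exact key 2 0 0 2
  · exact key 2 1 1 2

theorem dMat_eq_mul {a : M → Matrix (Fin 3) (Fin 3) ℝ} (h1 : ∀ x, (a x)ᵀ * a x = 1) (x : M)
    (p : Fin 3) : dMat S a x p = a x * mcMat S a x p := by
  rw [mcMat, ← Matrix.mul_assoc, mul_eq_one_comm.1 (h1 x), Matrix.one_mul]

theorem dMat_entry {a : M → Matrix (Fin 3) (Fin 3) ℝ} (h1 : ∀ x, (a x)ᵀ * a x = 1) (x : M)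
    (p i j : Fin 3) : dMat S a x p i j = a x i 0 * mcMat S a x p 0 j + a x i 1 * mcMat S a x p 1 j
      + a x i 2 * mcMat S a x p 2 j := by
  rw [dMat_eq_mul h1, mul_apply, Fin.sum_univ_three]

theorem ev1_dfun_axial_eq {a : M → Matrix (Fin 3) (Fin 3) ℝ} (ha : SmoothMat a)
    (h1 : ∀ x, (a x)ᵀ * a x = 1) (x : M) :
    (ev1 S x (dfun fun x ↦ axial (a x) 0) = fun p ↦
      (-(a x 0 0 + a x 1 1) * mcMat S a x p 0 1 - a x 1 2 * mcMat S a x p 0 2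
        + a x 0 2 * mcMat S a x p 1 2) / 2) ∧
    (ev1 S x (dfun fun x ↦ axial (a x) 1) = fun p ↦
      (-a x 2 1 * mcMat S a x p 0 1 - (a x 0 0 + a x 2 2) * mcMat S a x p 0 2
        - a x 0 1 * mcMat S a x p 1 2) / 2) ∧
    ev1 S x (dfun fun x ↦ axial (a x) 2) = fun p ↦
      (a x 2 0 * mcMat S a x p 0 1 - a x 1 0 * mcMat S a x p 0 2
        - (a x 1 1 + a x 2 2) * mcMat S a x p 1 2) / 2 := by
  have aT (p : Fin 3) := antisymm_entries (mcMat_transpose (S := S) ha h1 x p)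
  refine ⟨?_, ?_, ?_⟩ <;> funext p <;> rw [ev1_dfun_axial ha] <;>
    simp only [axial, cons_val_zero, cons_val_one, cons_val, dMat_entry h1, aT] <;> ring

theorem det_axial_identity {A : Matrix (Fin 3) (Fin 3) ℝ} (hA : IsRotation A) (u v w : Fin 3 → ℝ) :
    w12 (fun p ↦ (-(A 0 0 + A 1 1) * u p - A 1 2 * v p + A 0 2 * w p) / 2)
      (w11 (fun p ↦ (-A 2 1 * u p - (A 0 0 + A 2 2) * v p - A 0 1 * w p) / 2)
        (fun p ↦ (A 2 0 * u p - A 1 0 * v p - (A 1 1 + A 2 2) * w p) / 2)) =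
      -(rotCos A * (1 + rotCos A) / 2) * w12 u (w11 v w) := by
  obtain ⟨m0, m1, m2⟩ := hA.minors_diag
  have hd := hA.2
  rw [det_fin_three] at hd
  simp only [w12, w11, rotCos]
  linear_combination (-(A 0 0 + A 1 1 + A 2 2) * (m0 + m1 + m2) + hd) / 8 *
    (u 0 * (v 1 * w 2 - v 2 * w 1) - u 1 * (v 0 * w 2 - v 2 * w 0) + u 2 * (v 0 * w 1 - v 1 * w 0))

/-- The Jacobian of the chart of the rotation group given by the antisymmetric part. -/
theorem wedge_dfun_axial (hS : IsOrthonormalFrame g S) {a : M → Matrix (Fin 3) (Fin 3) ℝ}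
    (ha : SmoothMat a) (hr : ∀ x, IsRotation (a x)) :
    wedge (dfun fun x ↦ axial (a x) 0)
      (wedge (dfun fun x ↦ axial (a x) 1) (dfun fun x ↦ axial (a x) 2)) =
      fsmul (fun x ↦ -(rotCos (a x) * (1 + rotCos (a x)) / 2)) (volForm a) := by
  have h1 : ∀ x, (a x)ᵀ * a x = 1 := fun x ↦ (hr x).1
  refine three_form_ext hS fun x ↦ ?_
  change ev3 S x _ = -(rotCos (a x) * (1 + rotCos (a x)) / 2) * ev3 S x (volForm a)
  have aT (p : Fin 3) := antisymm_entries (mcMat_transpose (S := S) ha h1 x p)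
  have eθ (i j : Fin 3) : ev1 S x (mcForm a i j) = fun p ↦ mcMat S a x p i j :=
    funext fun p ↦ ev1_mcForm a i j x p
  rw [volForm, ev3_wedge, ev2_wedge, ev3_wedge, ev2_wedge, eθ, eθ, eθ, ← det_axial_identity (hr x)]
  obtain ⟨hX0, hX1, hX2⟩ := ev1_dfun_axial_eq (S := S) ha h1 x
  rw [hX0, hX1, hX2]

/-- The primitive whose derivative relates the moments of `rotCos`. -/
theorem exists_primitive (hS : IsOrthonormalFrame g S) {a : M → Matrix (Fin 3) (Fin 3) ℝ}
    (ha : SmoothMat a) (hr : ∀ x, IsRotation (a x)) (n : ℕ) :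
    ∃ η : DiffForm M 2, IsSmoothForm η ∧ extD η = fsmul (fun x ↦
      n * rotCos (a x) ^ (n - 1) * (1 - rotCos (a x) ^ 2)
        - (2 * rotCos (a x) + 1) * rotCos (a x) ^ n) (volForm a) := by
  have h1 : ∀ x, (a x)ᵀ * a x = 1 := fun x ↦ (hr x).1
  have hθ (i j : Fin 3) := isSmoothForm_mcForm ha i j
  have hw (i j k l : Fin 3) := (hθ i j).wedge (hθ k l)
  have hc : SmoothFun fun x ↦ rotCos (a x) ^ n := (smoothFun_rotCos ha).pow n
  have hX (i : Fin 3) := smoothFun_axial ha i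
  have s (m i j k l : Fin 3) := IsSmoothForm.fsmul (hX m) (hw i j k l)
  have hη := ((s 0 0 2 1 2).sub (s 1 0 1 1 2)).add (s 2 0 1 0 2)
  refine ⟨fsmul (fun x ↦ rotCos (a x) ^ n)
    (fsmul (fun x ↦ axial (a x) 0) (wedge (mcForm a 0 2) (mcForm a 1 2))
      - fsmul (fun x ↦ axial (a x) 1) (wedge (mcForm a 0 1) (mcForm a 1 2))
      + fsmul (fun x ↦ axial (a x) 2) (wedge (mcForm a 0 1) (mcForm a 0 2))),
    IsSmoothForm.fsmul hc hη, three_form_ext hS fun x ↦ ?_⟩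
  change ev3 S x _ = (n * rotCos (a x) ^ (n - 1) * (1 - rotCos (a x) ^ 2)
        - (2 * rotCos (a x) + 1) * rotCos (a x) ^ n) * ev3 S x (volForm a)
  have e3f (f : M → ℝ) (ζ : DiffForm M 3) : ev3 S x (fsmul f ζ) = f x * ev3 S x ζ := rfl
  rw [extD_fsmul hc hη, extD_add ((s 0 0 2 1 2).sub (s 1 0 1 1 2)) (s 2 0 1 0 2),
    extD_sub (s 0 0 2 1 2) (s 1 0 1 1 2), extD_fsmul (hX 0) (hw _ _ _ _),
    extD_fsmul (hX 1) (hw _ _ _ _), extD_fsmul (hX 2) (hw _ _ _ _), extD_wedge (hθ _ _) (hθ _ _),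
    extD_wedge (hθ _ _) (hθ _ _), extD_wedge (hθ _ _) (hθ _ _), volForm]
  simp only [ev3_add, ev3_sub, e3f, ev3_wedge, ev2_add, ev2_sub, ev2_fsmul, ev2_wedge]
  have aT (p : Fin 3) := antisymm_entries (mcMat_transpose (S := S) ha h1 x p)
  have eθ (i j : Fin 3) : ev1 S x (mcForm a i j) = fun p ↦ mcMat S a x p i j :=
    funext fun p ↦ ev1_mcForm a i j x p
  have dθ (i j : Fin 3) : ev2 S x (extD (mcForm a i j)) = fun p q ↦
      ∑ m, (mcMat S a x p m i * mcMat S a x q m j - mcMat S a x q m i * mcMat S a x p m j) := by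
    funext p q
    rw [ev2_extD_mcForm ha h1]
    simp only [Matrix.sub_apply, mul_apply, ← Finset.sum_sub_distrib]
    rfl
  have hdc : ev1 S x (dfun fun x ↦ rotCos (a x) ^ n) = fun p ↦ (n * rotCos (a x) ^ (n - 1)) *
      (axial (a x) 0 * mcMat S a x p 0 1 + axial (a x) 1 * mcMat S a x p 0 2
        + axial (a x) 2 * mcMat S a x p 1 2) := by
    rw [ev1_dfun_comp (φ := fun t ↦ t ^ n) (smoothFun_rotCos ha) x (by fun_prop), deriv_pow_field]
    funext p
    rw [Pi.smul_apply, ev1_dfun_rotCos ha, smul_eq_mul]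
    congr 1
    simp only [axial, cons_val_zero, cons_val_one, cons_val, dMat_entry h1, aT]
    ring
  obtain ⟨hX0, hX1, hX2⟩ := ev1_dfun_axial_eq (S := S) ha h1 x
  rw [hdc, hX0, hX1, hX2]
  simp only [eθ, dθ, Fin.sum_univ_three, aT]
  rw [← (hr x).axial_sq]
  simp only [w12, w11, rotCos, Pi.add_apply, Pi.sub_apply, Pi.smul_apply, smul_eq_mul]
  ring

end

/-! ### The distribution of the angle of a rotation -/

/-- The mean of a function of the cosine of the angle over the rotation group. -/
def rotMean (φ : ℝ → ℝ) : ℝ :=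
  (1 / Real.pi) * ∫ t in (0 : ℝ)..Real.pi, φ (Real.cos t) * (1 - Real.cos t)

theorem intervalIntegrable_rotMean {φ : ℝ → ℝ} (hφ : Continuous φ) :
    IntervalIntegrable (fun t ↦ φ (Real.cos t) * (1 - Real.cos t)) volume 0 Real.pi :=
  Continuous.intervalIntegrable (by fun_prop) _ _

theorem rotMean_add {φ ψ : ℝ → ℝ} (hφ : Continuous φ) (hψ : Continuous ψ) :
    rotMean (fun t ↦ φ t + ψ t) = rotMean φ + rotMean ψ := by
  simp only [rotMean, add_mul]
  rw [intervalIntegral.integral_add (intervalIntegrable_rotMean hφ) (intervalIntegrable_rotMean hψ)]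
  ring

theorem rotMean_const_mul (c : ℝ) (φ : ℝ → ℝ) : rotMean (fun t ↦ c * φ t) = c * rotMean φ := by
  simp only [rotMean, mul_assoc c]
  rw [intervalIntegral.integral_const_mul]
  ring

theorem rotMean_one : rotMean (fun _ ↦ 1) = 1 := by
  simp only [rotMean, one_mul]
  rw [intervalIntegral.integral_sub (by simp) (Continuous.intervalIntegrable (by fun_prop) _ _)]
  simp [Real.pi_ne_zero]

theorem abs_rotMean_le {φ : ℝ → ℝ} {ε : ℝ} (h : ∀ t ∈ Icc (-1 : ℝ) 1, |φ t| ≤ ε) :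
    |rotMean φ| ≤ 2 * ε := by
  have h1 : ‖∫ t in (0 : ℝ)..Real.pi, φ (Real.cos t) * (1 - Real.cos t)‖ ≤
      2 * ε * |Real.pi - 0| := by
    refine intervalIntegral.norm_integral_le_of_norm_le_const fun t _ ↦ ?_
    have h2 := h (Real.cos t) ⟨Real.neg_one_le_cos t, Real.cos_le_one t⟩
    rw [norm_mul, Real.norm_eq_abs, Real.norm_eq_abs,
      abs_of_nonneg (sub_nonneg.2 (Real.cos_le_one t))]
    nlinarith [Real.neg_one_le_cos t, abs_nonneg (φ (Real.cos t)), Real.cos_le_one t]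
  rw [sub_zero, abs_of_pos Real.pi_pos, Real.norm_eq_abs] at h1
  rw [rotMean, abs_mul, abs_of_pos (by positivity), one_div, inv_mul_le_iff₀ Real.pi_pos]
  linarith

theorem rotMean_pow_relation (n : ℕ) :
    rotMean (fun c ↦ n * c ^ (n - 1) * (1 - c ^ 2) - (2 * c + 1) * c ^ n) = 0 := by
  have h : ∀ t ∈ uIcc (0 : ℝ) Real.pi,
      HasDerivAt (fun t ↦ -(Real.cos t ^ n * Real.sin t * (1 - Real.cos t)))
        ((n * Real.cos t ^ (n - 1) * (1 - Real.cos t ^ 2)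
          - (2 * Real.cos t + 1) * Real.cos t ^ n) * (1 - Real.cos t)) t := by
    intro t _
    have h1 := (((Real.hasDerivAt_cos t).pow n).mul (Real.hasDerivAt_sin t)).mul
      ((Real.hasDerivAt_cos t).const_sub 1) |>.neg
    refine h1.congr_deriv ?_
    have h2 : Real.cos t ^ 2 = 1 - Real.sin t ^ 2 := by rw [← Real.sin_sq_add_cos_sq t]; ring
    simp only [Pi.mul_apply, Pi.pow_apply]
    linear_combination (n * Real.cos t ^ (n - 1) * (1 - Real.cos t) - Real.cos t ^ n) * h2
  rw [rotMean, intervalIntegral.integral_eq_sub_of_hasDerivAt h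
    (Continuous.intervalIntegrable (by fun_prop) _ _)]
  simp

section
variable {M : Type*} [TopologicalSpace M] [ChartedSpace E3 M] [IsManifold (𝓡 3) ∞ M]
variable [CompactSpace M] [T2Space M]
variable {g : Metric M} {S : Fin 3 → VField M}

theorem integrateForm_fsmul_add (o : MOrientation M) {η : DiffForm M 3} (hη : IsContForm η)
    {h k : M → ℝ} (hh : Continuous h) (hk : Continuous k) :
    integrateForm o (fsmul (fun x ↦ h x + k x) η) =
      integrateForm o (fsmul h η) + integrateForm o (fsmul k η) := by
  rw [← integrateForm_add o (hη.fsmul hh) (hη.fsmul hk)]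
  congr 1
  funext x
  exact add_smul (h x) (k x) (η x)

theorem integrateForm_fsmul_const_mul (o : MOrientation M) (η : DiffForm M 3) (c : ℝ) (h : M → ℝ) :
    integrateForm o (fsmul (fun x ↦ c * h x) η) = c * integrateForm o (fsmul h η) := by
  rw [← integrateForm_smul]
  congr 1
  funext x
  exact mul_smul c (h x) (η x)

theorem exists_integrateForm_bound (o : MOrientation M) {η : DiffForm M 3} (hη : IsContForm η) :
    ∃ C : ℝ, ∀ (h : M → ℝ) (ε : ℝ), (∀ x, |h x| ≤ ε) →
      |integrateForm o (fsmul h η)| ≤ C * ε := by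
  refine ⟨∑ x₀ ∈ partitionIndices M, ∫ y in (extChartAt (𝓡 3) x₀).target,
    ‖chartPartition x₀ ((extChartAt (𝓡 3) x₀).symm y) * density o η x₀ y‖, fun h ε hε ↦ ?_⟩
  rw [integrateForm_eq_sum, Finset.sum_mul]
  refine (Finset.abs_sum_le_sum_abs _ _).trans (Finset.sum_le_sum fun x₀ _ ↦ ?_)
  rw [← integral_mul_const, ← Real.norm_eq_abs]
  refine norm_integral_le_of_norm_le ((integrableOn_partition o hη x₀).norm.mul_const ε)
    (Filter.Eventually.of_forall fun y ↦ ?_)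
  have e : chartPartition x₀ ((extChartAt (𝓡 3) x₀).symm y) * density o (fsmul h η) x₀ y =
      chartPartition x₀ ((extChartAt (𝓡 3) x₀).symm y) * density o η x₀ y
        * h ((extChartAt (𝓡 3) x₀).symm y) := by
    rw [density, density, inChart_fsmul]
    simp only [ContinuousAlternatingMap.smul_apply, smul_eq_mul]
    ring
  rw [e, norm_mul]
  exact mul_le_mul_of_nonneg_left (hε _) (norm_nonneg _)

theorem continuous_rotCos {a : M → Matrix (Fin 3) (Fin 3) ℝ} (ha : SmoothMat a) :
    Continuous fun x ↦ rotCos (a x) := (smoothFun_rotCos ha).continuous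

theorem integrateForm_rotCos_pow (hS : IsOrthonormalFrame g S) (o : MOrientation M)
    {a : M → Matrix (Fin 3) (Fin 3) ℝ} (ha : SmoothMat a) (hr : ∀ x, IsRotation (a x)) (n : ℕ) :
    integrateForm o (fsmul (fun x ↦ rotCos (a x) ^ n) (volForm a)) =
      rotMean (fun c ↦ c ^ n) * integrateForm o (volForm a) := by
  have hη : IsContForm (volForm a) := (isSmoothForm_volForm ha).isContForm
  have hc := continuous_rotCos ha
  set I : ℕ → ℝ := fun n ↦ integrateForm o (fsmul (fun x ↦ rotCos (a x) ^ n) (volForm a)) with hI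
  set m : ℕ → ℝ := fun n ↦ rotMean (fun c ↦ c ^ n) with hm
  have hI0 : I 0 = integrateForm o (volForm a) := by
    simp only [hI, pow_zero]
    congr 1
    funext x
    exact one_smul ℝ (volForm a x)
  have hm0 : m 0 = 1 := by simp only [hm, pow_zero]; exact rotMean_one
  have relI (n : ℕ) := exists_primitive hS ha hr n
  have relI0 : 2 * I 1 + I 0 = 0 := by
    obtain ⟨η, hη', h⟩ := relI 0
    have h1 := integrateForm_extD o hη'
    rw [h] at h1
    have e : (fun x ↦ ((0 : ℕ) : ℝ) * rotCos (a x) ^ (0 - 1) * (1 - rotCos (a x) ^ 2)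
        - (2 * rotCos (a x) + 1) * rotCos (a x) ^ 0) =
        fun x ↦ (-2) * rotCos (a x) ^ 1 + (-1) * rotCos (a x) ^ 0 := by
      funext x; push_cast; ring
    rw [e, integrateForm_fsmul_add o hη (by fun_prop) (by fun_prop),
      integrateForm_fsmul_const_mul, integrateForm_fsmul_const_mul] at h1
    linarith
  have relm0 : 2 * m 1 + m 0 = 0 := by
    have h1 := rotMean_pow_relation 0
    have e : (fun c ↦ ((0 : ℕ) : ℝ) * c ^ (0 - 1) * (1 - c ^ 2) - (2 * c + 1) * c ^ 0) =
        fun c : ℝ ↦ (-2) * c ^ 1 + (-1) * c ^ 0 := by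
      funext x; push_cast; ring
    rw [e, rotMean_add (by fun_prop) (by fun_prop), rotMean_const_mul, rotMean_const_mul] at h1
    linarith
  have relI1 (n : ℕ) : (n + 3) * I (n + 2) = (n + 1) * I n - I (n + 1) := by
    obtain ⟨η, hη', h⟩ := relI (n + 1)
    have h1 := integrateForm_extD o hη'
    rw [h] at h1
    have e : (fun x ↦ ((n + 1 : ℕ) : ℝ) * rotCos (a x) ^ (n + 1 - 1) * (1 - rotCos (a x) ^ 2)
        - (2 * rotCos (a x) + 1) * rotCos (a x) ^ (n + 1)) =
        fun x ↦ (((n : ℝ) + 1) * rotCos (a x) ^ n + (-((n : ℝ) + 3)) * rotCos (a x) ^ (n + 2))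
          + (-1) * rotCos (a x) ^ (n + 1) := by
      funext x
      rw [Nat.add_sub_cancel]
      push_cast
      ring
    rw [e, integrateForm_fsmul_add o hη (by fun_prop) (by fun_prop),
      integrateForm_fsmul_add o hη (by fun_prop) (by fun_prop),
      integrateForm_fsmul_const_mul, integrateForm_fsmul_const_mul,
      integrateForm_fsmul_const_mul] at h1
    linarith
  have relm1 (n : ℕ) : (n + 3) * m (n + 2) = (n + 1) * m n - m (n + 1) := by
    have h1 := rotMean_pow_relation (n + 1)
    have e : (fun c : ℝ ↦ ((n + 1 : ℕ) : ℝ) * c ^ (n + 1 - 1) * (1 - c ^ 2)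
        - (2 * c + 1) * c ^ (n + 1)) =
        fun c ↦ (((n : ℝ) + 1) * c ^ n + (-((n : ℝ) + 3)) * c ^ (n + 2)) + (-1) * c ^ (n + 1) := by
      funext x
      rw [Nat.add_sub_cancel]
      push_cast
      ring
    rw [e, rotMean_add (by fun_prop) (by fun_prop), rotMean_add (by fun_prop) (by fun_prop),
      rotMean_const_mul, rotMean_const_mul, rotMean_const_mul] at h1
    linarith
  suffices h : ∀ n, I n = m n * I 0 ∧ I (n + 1) = m (n + 1) * I 0 by
    rw [← hI0]; exact (h n).1
  intro n
  induction n with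
  | zero =>
    refine ⟨by rw [hm0, one_mul], ?_⟩
    rw [zero_add]
    rw [hm0] at relm0
    linear_combination relI0 / 2 - I 0 / 2 * relm0
  | succ n ih =>
    refine ⟨ih.2, ?_⟩
    have h3 : (n + 3 : ℝ) ≠ 0 := by positivity
    refine mul_left_cancel₀ h3 ?_
    rw [relI1, ih.1, ih.2]
    linear_combination -I 0 * relm1 n

/-- The push-forward of the volume form under the cosine of the angle. -/
theorem integrateForm_rotCos (hS : IsOrthonormalFrame g S) (o : MOrientation M)
    {a : M → Matrix (Fin 3) (Fin 3) ℝ} (ha : SmoothMat a) (hr : ∀ x, IsRotation (a x))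
    {φ : ℝ → ℝ} (hφ : Continuous φ) :
    integrateForm o (fsmul (fun x ↦ φ (rotCos (a x))) (volForm a)) =
      rotMean φ * integrateForm o (volForm a) := by
  have hη : IsContForm (volForm a) := (isSmoothForm_volForm ha).isContForm
  have hc := continuous_rotCos ha
  have hpoly (p : Polynomial ℝ) :
      integrateForm o (fsmul (fun x ↦ p.eval (rotCos (a x))) (volForm a)) =
        rotMean (fun c ↦ p.eval c) * integrateForm o (volForm a) := by
    induction p using Polynomial.induction_on' with
    | add p q hp hq =>
      simp only [Polynomial.eval_add]
      rw [integrateForm_fsmul_add o hη (h := fun x ↦ p.eval (rotCos (a x)))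
        (k := fun x ↦ q.eval (rotCos (a x))) (p.continuous.comp hc) (q.continuous.comp hc), hp, hq,
        rotMean_add (φ := fun c ↦ p.eval c) (ψ := fun c ↦ q.eval c) p.continuous q.continuous,
        add_mul]
    | monomial n c =>
      simp only [Polynomial.eval_monomial]
      rw [integrateForm_fsmul_const_mul, rotMean_const_mul, integrateForm_rotCos_pow hS o ha hr,
        mul_assoc]
  obtain ⟨C, hC⟩ := exists_integrateForm_bound o hη
  set I1 := integrateForm o (volForm a) with hI1
  set D := integrateForm o (fsmul (fun x ↦ φ (rotCos (a x))) (volForm a)) - rotMean φ * I1 with hD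
  have key (ε : ℝ) (hε : 0 < ε) : |D| ≤ (|C| + 2 * |I1|) * ε := by
    obtain ⟨p, hp⟩ := exists_polynomial_near_of_continuousOn (-1) 1 φ hφ.continuousOn ε hε
    have e1 : integrateForm o (fsmul (fun x ↦ φ (rotCos (a x)) + -1 * p.eval (rotCos (a x)))
        (volForm a)) = integrateForm o (fsmul (fun x ↦ φ (rotCos (a x))) (volForm a))
          + -1 * (rotMean (fun c ↦ p.eval c) * I1) := by
      rw [integrateForm_fsmul_add o hη (h := fun x ↦ φ (rotCos (a x)))
        (k := fun x ↦ -1 * p.eval (rotCos (a x))) (hφ.comp hc)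
        (continuous_const.mul (p.continuous.comp hc)),
        integrateForm_fsmul_const_mul, hpoly]
    have e2 : rotMean (fun c ↦ φ c + -1 * p.eval c) = rotMean φ + -1 * rotMean fun c ↦ p.eval c := by
      rw [rotMean_add (ψ := fun c ↦ -1 * p.eval c) hφ (continuous_const.mul p.continuous),
        rotMean_const_mul]
    have b (t : ℝ) (ht : t ∈ Icc (-1 : ℝ) 1) : |φ t + -1 * p.eval t| ≤ ε := by
      have := (hp t ht).le
      rwa [abs_sub_comm, sub_eq_add_neg, ← neg_one_mul] at this
    have b1 := hC (fun x ↦ φ (rotCos (a x)) + -1 * p.eval (rotCos (a x))) ε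
      fun x ↦ b _ (hr x).rotCos_mem
    have b2 := abs_rotMean_le b
    rw [e1] at b1
    rw [e2] at b2
    have e3 : D = (integrateForm o (fsmul (fun x ↦ φ (rotCos (a x))) (volForm a))
        + -1 * (rotMean (fun c ↦ p.eval c) * I1))
        - (rotMean φ + -1 * rotMean fun c ↦ p.eval c) * I1 := by
      rw [hD]; ring
    rw [e3]
    refine (abs_sub _ _).trans ?_
    rw [abs_mul, add_mul]
    refine add_le_add (b1.trans (mul_le_mul_of_nonneg_right (le_abs_self C) hε.le)) ?_
    calc _ ≤ 2 * ε * |I1| := mul_le_mul_of_nonneg_right b2 (abs_nonneg _)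
      _ = _ := by ring
  have hD0 : D = 0 := by
    by_contra hne
    have hpos : 0 < |C| + 2 * |I1| + 1 := by positivity
    have h1 := key (|D| / (|C| + 2 * |I1| + 1) / 2) (by positivity)
    have h2 : (|C| + 2 * |I1|) * (|D| / (|C| + 2 * |I1| + 1) / 2) ≤ |D| / 2 := by
      rw [div_div, mul_div_assoc', div_le_div_iff₀ (by positivity) (by positivity)]
      nlinarith [abs_nonneg D]
    have h3 : 0 < |D| := abs_pos.2 hne
    linarith
  exact sub_eq_zero.1 hD0

end

/-- The mean over the rotation group, computed in the chart given by the antisymmetric part. -/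
theorem integral_eq_rotMean {φ : ℝ → ℝ} (hφ : ∀ t ≤ 0, φ t = 0) :
    ∫ z : E3, φ √(1 - ‖z‖ ^ 2) * (2 / (√(1 - ‖z‖ ^ 2) * (1 + √(1 - ‖z‖ ^ 2)))) =
      8 * Real.pi ^ 2 * rotMean φ := by
  have hvol : (volume : Measure E3).real (Metric.ball 0 1) = Real.pi * 4 / 3 := by
    rw [Measure.real, EuclideanSpace.volume_ball_fin_three]
    simp
    positivity
  have himg : Real.sin '' Ioo 0 (Real.pi / 2) = Ioo 0 1 := by
    ext r
    constructor
    · rintro ⟨t, ⟨h0, h1⟩, rfl⟩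
      refine ⟨Real.sin_pos_of_pos_of_lt_pi h0 (by linarith [Real.pi_pos]), ?_⟩
      rw [← Real.sin_pi_div_two]
      exact Real.sin_lt_sin_of_lt_of_le_pi_div_two (by linarith [Real.pi_pos]) le_rfl h1
    · rintro ⟨h0, h1⟩
      exact ⟨Real.arcsin r, ⟨Real.arcsin_pos.2 h0, Real.arcsin_lt_pi_div_two.2 h1⟩,
        Real.sin_arcsin (by linarith) h1.le⟩
  have hinj : InjOn Real.sin (Ioo 0 (Real.pi / 2)) := by
    refine Real.injOn_sin.mono fun t ht ↦ ?_
    exact ⟨by linarith [ht.1, Real.pi_pos], ht.2.le⟩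
  have h1 : ∫ r in Ioi (0 : ℝ), r ^ 2 • (φ √(1 - r ^ 2) * (2 / (√(1 - r ^ 2) * (1 + √(1 - r ^ 2))))) =
      2 * ∫ t in Ioo 0 (Real.pi / 2), φ (Real.cos t) * (1 - Real.cos t) := by
    rw [setIntegral_eq_of_subset_of_forall_sdiff_eq_zero (s := Ioo 0 1) measurableSet_Ioi
      Ioo_subset_Ioi_self, ← himg, integral_image_eq_integral_abs_deriv_smul measurableSet_Ioo
      (fun t _ ↦ (Real.hasDerivAt_sin t).hasDerivWithinAt) hinj, ← integral_const_mul]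
    · refine setIntegral_congr_fun measurableSet_Ioo fun t ht ↦ ?_
      have hc : 0 < Real.cos t := Real.cos_pos_of_mem_Ioo ⟨by linarith [ht.1, Real.pi_pos], ht.2⟩
      have hs : √(1 - Real.sin t ^ 2) = Real.cos t := by
        rw [← Real.cos_sq', Real.sqrt_sq hc.le]
      have hs' : Real.sin t ^ 2 = (1 - Real.cos t) * (1 + Real.cos t) := by rw [Real.sin_sq]; ring
      simp only [hs, smul_eq_mul, abs_of_pos hc]
      rw [hs']
      field_simp
    · intro r hr
      have h2 : 1 ≤ r := by
        by_contra h
        exact hr.2 ⟨hr.1, not_le.1 h⟩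
      have h3 : √(1 - r ^ 2) = 0 := Real.sqrt_eq_zero_of_nonpos (by nlinarith)
      rw [h3, hφ 0 le_rfl]
      simp
  have h2 : ∫ t in (0 : ℝ)..Real.pi, φ (Real.cos t) * (1 - Real.cos t) =
      ∫ t in Ioo 0 (Real.pi / 2), φ (Real.cos t) * (1 - Real.cos t) := by
    rw [intervalIntegral.integral_of_le Real.pi_pos.le]
    refine setIntegral_eq_of_subset_of_forall_sdiff_eq_zero measurableSet_Ioc
      (fun t ht ↦ ⟨ht.1, by linarith [ht.2, Real.pi_pos]⟩) fun t ht ↦ ?_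
    have h3 : Real.pi / 2 ≤ t := by
      by_contra h
      exact ht.2 ⟨ht.1.1, not_le.1 h⟩
    rw [hφ _ (Real.cos_nonpos_of_pi_div_two_le_of_le h3 (by linarith [ht.1.2, Real.pi_pos])),
      zero_mul]
  have h4 := integral_fun_norm_addHaar (volume : Measure E3)
    fun r ↦ φ √(1 - r ^ 2) * (2 / (√(1 - r ^ 2) * (1 + √(1 - r ^ 2))))
  rw [h4, finrank_euclideanSpace_fin, hvol, h1, rotMean, h2]
  simp only [nsmul_eq_mul, smul_eq_mul]
  have := Real.pi_ne_zero
  field_simp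
  push_cast
  ring

theorem rotMean_pos {δ : ℝ} (h0 : 0 < δ) (h1 : δ < 1) : 0 < rotMean fun c ↦ max 0 (c - (1 - δ)) := by
  refine mul_pos (by positivity) ?_
  have hc : Continuous fun t ↦ max 0 (Real.cos t - (1 - δ)) * (1 - Real.cos t) := by fun_prop
  refine intervalIntegral.integral_pos Real.pi_pos hc.continuousOn
    (fun t _ ↦ mul_nonneg (le_max_left _ _) (sub_nonneg.2 (Real.cos_le_one t)))
    ⟨Real.arccos (1 - δ / 2), ⟨Real.arccos_nonneg _, Real.arccos_le_pi _⟩, ?_⟩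
  rw [Real.cos_arccos (by linarith) (by linarith)]
  exact mul_pos (lt_max_of_lt_right (by linarith)) (by linarith)

/-! ### The antisymmetric part as a local chart of the rotation group -/

/-- The antisymmetric part of a matrix, as a vector of Euclidean space. -/
def axialE (A : Matrix (Fin 3) (Fin 3) ℝ) : E3 := WithLp.toLp 2 (axial A)

theorem IsRotation.norm_axialE_sq {A : Matrix (Fin 3) (Fin 3) ℝ} (h : IsRotation A) :
    ‖axialE A‖ ^ 2 = 1 - rotCos A ^ 2 := by
  rw [EuclideanSpace.norm_sq_eq, Fin.sum_univ_three, ← h.axial_sq]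
  simp [axialE]

theorem IsRotation.sqrt_axialE {A : Matrix (Fin 3) (Fin 3) ℝ} (h : IsRotation A)
    (hc : 0 ≤ rotCos A) : √(1 - ‖axialE A‖ ^ 2) = rotCos A := by
  rw [h.norm_axialE_sq, sub_sub_cancel, Real.sqrt_sq hc]

section
variable {M : Type*} [TopologicalSpace M] [ChartedSpace E3 M] [IsManifold (𝓡 3) ∞ M]
variable {g : Metric M} {S : Fin 3 → VField M} {a : M → Matrix (Fin 3) (Fin 3) ℝ}

/-- The antisymmetric part of a matrix-valued function, in a chart. -/
def axialInChart (a : M → Matrix (Fin 3) (Fin 3) ℝ) (x₀ : M) (y : E3) : E3 :=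
  axialE (a ((extChartAt (𝓡 3) x₀).symm y))

theorem contDiffOn_axialInChart (ha : SmoothMat a) (x₀ : M) :
    ContDiffOn ℝ ∞ (axialInChart a x₀) (extChartAt (𝓡 3) x₀).target := by
  refine contDiffOn_euclidean.2 fun i ↦ ?_
  exact SmoothFun.contDiffOn (smoothFun_axial ha i) x₀

theorem contDiffAt_axialInChart (ha : SmoothMat a) {x₀ : M} {y : E3}
    (hy : y ∈ (extChartAt (𝓡 3) x₀).target) : ContDiffAt ℝ ∞ (axialInChart a x₀) y :=
  (contDiffOn_axialInChart ha x₀).contDiffAt (chart_target_mem_nhds x₀ hy)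

theorem hasFDerivAt_axialInChart (ha : SmoothMat a) {x₀ : M} {y : E3}
    (hy : y ∈ (extChartAt (𝓡 3) x₀).target) :
    HasFDerivAt (axialInChart a x₀) (fderiv ℝ (axialInChart a x₀) y) y :=
  ((contDiffAt_axialInChart ha hy).differentiableAt (by simp)).hasFDerivAt

theorem det_fderiv_axialInChart (hS : IsOrthonormalFrame g S) (ha : SmoothMat a)
    (hr : ∀ x, IsRotation (a x)) {x₀ : M} {y : E3} (hy : y ∈ (extChartAt (𝓡 3) x₀).target) :
    (fderiv ℝ (axialInChart a x₀) y).det =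
      -(rotCos (a ((extChartAt (𝓡 3) x₀).symm y)) *
        (1 + rotCos (a ((extChartAt (𝓡 3) x₀).symm y))) / 2) *
        inChart (volForm a) x₀ y stdB := by
  have h := congrArg (fun η ↦ inChart η x₀ y stdB) (wedge_dfun_axial hS ha hr)
  have e : (stdB : Fin 3 → E3) = ![stdB 0, stdB 1, stdB 2] := by
    ext1 i; fin_cases i <;> rfl
  simp only [inChart_fsmul] at h
  rw [ContinuousAlternatingMap.smul_apply, smul_eq_mul] at h
  rw [← h, e, inChart_wedge_one_two, inChart_wedge_one_one, inChart_wedge_one_one,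
    inChart_wedge_one_one]
  have hd (i : Fin 3) (v : E3) : inChart (dfun fun x ↦ axial (a x) i) x₀ y ![v] =
      fderiv ℝ (axialInChart a x₀) y v i := by
    rw [inChart_dfun (smoothFun_axial ha i) hy]
    have h1 := (hasFDerivWithinAt_univ.1 (hasFDerivWithinAt_euclidean.1
      (hasFDerivAt_axialInChart ha hy).hasFDerivWithinAt i)).fderiv
    exact congr($h1 v)
  simp only [hd]
  have hdet : (fderiv ℝ (axialInChart a x₀) y).det =
      (Matrix.of fun i j ↦ fderiv ℝ (axialInChart a x₀) y (stdB j) i).det := by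
    rw [ContinuousLinearMap.det, ← LinearMap.det_toMatrix (EuclideanSpace.basisFun (Fin 3) ℝ).toBasis]
    congr 1
  rw [hdet, Matrix.det_fin_three]
  simp only [Matrix.of_apply]
  ring

/-- The form `volForm a` does not vanish at `x`. -/
def IsRegularAt (a : M → Matrix (Fin 3) (Fin 3) ℝ) (x : M) : Prop :=
  inChart (volForm a) x (extChartAt (𝓡 3) x x) stdB ≠ 0

theorem isRegularAt_of_inChart {x₀ : M} {y : E3} (hy : y ∈ (extChartAt (𝓡 3) x₀).target)
    (h : inChart (volForm a) x₀ y stdB ≠ 0) : IsRegularAt a ((extChartAt (𝓡 3) x₀).symm y) := by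
  intro h0
  apply h
  rw [inChart_stdB_transition _ x₀ ((extChartAt (𝓡 3) x₀).symm y) hy (mem_extChartAt_source _)]
  exact mul_eq_zero_of_right _ h0

/-- Near a regular point, the antisymmetric part is a local chart. -/
theorem exists_nhds_axialE (hS : IsOrthonormalFrame g S) (o : MOrientation M) (ha : SmoothMat a)
    (hr : ∀ x, IsRotation (a x)) {p : M} (hp : IsRegularAt a p) (hc : 0 < rotCos (a p)) :
    ∃ U : Set M, IsOpen U ∧ p ∈ U ∧ U ⊆ (extChartAt (𝓡 3) p).source ∧
      InjOn (fun x ↦ axialE (a x)) U ∧ (∀ x ∈ U, 0 < rotCos (a x)) ∧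
      (∀ V ∈ 𝓝 p, (fun x ↦ axialE (a x)) '' V ∈ 𝓝 (axialE (a p))) ∧
      ∃ σ : ℤ, ∀ y ∈ (extChartAt (𝓡 3) p).target, (extChartAt (𝓡 3) p).symm y ∈ U →
        density o (volForm a) p y = σ * |inChart (volForm a) p y stdB| := by
  set φ := extChartAt (𝓡 3) p with hφ
  have hy : φ p ∈ φ.target := mem_extChartAt_target p
  have hsymm : φ.symm (φ p) = p := extChartAt_to_inv p
  set F := axialInChart a p with hF
  have hstrict : HasStrictFDerivAt F (fderiv ℝ F (φ p)) (φ p) :=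
    (contDiffAt_axialInChart ha hy).hasStrictFDerivAt (by simp)
  have hdet : (fderiv ℝ F (φ p)).det ≠ 0 := by
    rw [det_fderiv_axialInChart hS ha hr hy, hsymm]
    refine mul_ne_zero (neg_ne_zero.2 ?_) hp
    positivity
  set L := (fderiv ℝ F (φ p)).toContinuousLinearEquivOfDetNeZero hdet with hL
  have hstrict' : HasStrictFDerivAt F (L : E3 →L[ℝ] E3) (φ p) := by
    convert hstrict using 1
    exact ContinuousLinearMap.coe_toContinuousLinearEquivOfDetNeZero _ hdet
  set e := hstrict'.toOpenPartialHomeomorph F with he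
  have heF : ∀ y, e y = F y := fun _ ↦ rfl
  have hsign : ∃ τ : ℤ, ∀ᶠ y in 𝓝 (φ p), coordSign o.orient p y * inChart (volForm a) p y stdB =
      τ * |inChart (volForm a) p y stdB| := by
    have hcont : ContinuousAt (fun y ↦ inChart (volForm a) p y stdB) (φ p) :=
      ((isSmoothForm_volForm ha).isContForm p).continuousAt (chart_target_mem_nhds p hy)
    have hs := coordSign_eventually_eq o p hy
    obtain ⟨ε, hε⟩ : ∃ ε : ℤ, coordSign o.orient p (φ p) = ε := by
      rcases coordSign_mul_self o p hy with h | h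
      · exact ⟨1, by rw [h]; simp⟩
      · exact ⟨-1, by rw [h]; simp⟩
    rcases lt_or_gt_of_ne hp with h | h
    · refine ⟨-ε, ?_⟩
      filter_upwards [hs, hcont.eventually_lt continuousAt_const h] with y h1 h2
      rw [h1, hε, abs_of_neg h2]
      push_cast
      ring
    · refine ⟨ε, ?_⟩
      filter_upwards [hs, continuousAt_const.eventually_lt hcont h] with y h1 h2
      rw [h1, hε, abs_of_pos h2]
  obtain ⟨σ, hσ⟩ := hsign
  obtain ⟨W, hWσ, hWo, hWp⟩ := eventually_nhds_iff.1 hσ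
  have hcc : Continuous fun x ↦ rotCos (a x) := (smoothFun_rotCos ha).continuous
  refine ⟨(φ.source ∩ φ ⁻¹' (e.source ∩ W)) ∩ {x | 0 < rotCos (a x)}, ?_, ?_, ?_, ?_, ?_, ?_, σ, ?_⟩
  · exact ((continuousOn_extChartAt p).isOpen_inter_preimage (isOpen_extChartAt_source p)
      (e.open_source.inter hWo)).inter (isOpen_lt continuous_const hcc)
  · exact ⟨⟨mem_extChartAt_source p, hstrict'.mem_toOpenPartialHomeomorph_source, hWp⟩, hc⟩
  · exact fun x hx ↦ hx.1.1
  · intro x hx z hz hxz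
    have h1 : e (φ x) = e (φ z) := by
      rw [heF, heF, hF, axialInChart, axialInChart, φ.left_inv hx.1.1, φ.left_inv hz.1.1]
      exact hxz
    exact φ.injOn hx.1.1 hz.1.1 (e.injOn hx.1.2.1 hz.1.2.1 h1)
  · exact fun x hx ↦ hx.2
  · intro V hV
    have h1 : φ.symm ⁻¹' V ∈ 𝓝 (φ p) := by
      refine (continuousAt_extChartAt_symm p).preimage_mem_nhds ?_
      rw [hsymm]
      exact hV
    have h2 := Filter.image_mem_map (m := F) h1
    rw [hstrict'.map_nhds_eq_of_equiv] at h2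
    have h3 : F (φ p) = axialE (a p) := by rw [hF, axialInChart, hsymm]
    rw [h3] at h2
    refine Filter.mem_of_superset h2 ?_
    rintro _ ⟨y, hy, rfl⟩
    exact ⟨φ.symm y, hy, rfl⟩
  · intro y hyt hyU
    have h1 := hyU.1.2.2
    rw [φ.right_inv hyt] at h1
    exact hWσ y h1

variable [CompactSpace M] [T2Space M]

/-- The integral of a form supported near a regular point. -/
theorem integrateForm_indicator (hS : IsOrthonormalFrame g S) (o : MOrientation M) (ha : SmoothMat a)
    (hr : ∀ x, IsRotation (a x)) {p : M} {U K : Set M} (hU : IsOpen U)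
    (hUs : U ⊆ (extChartAt (𝓡 3) p).source) (hinj : InjOn (fun x ↦ axialE (a x)) U)
    (hpos : ∀ x ∈ U, 0 < rotCos (a x)) {σ : ℤ}
    (hσ : ∀ y ∈ (extChartAt (𝓡 3) p).target, (extChartAt (𝓡 3) p).symm y ∈ U →
        density o (volForm a) p y = σ * |inChart (volForm a) p y stdB|)
    {φ : ℝ → ℝ} (hφ : Continuous φ) (hφ0 : ∀ t ≤ 0, φ t = 0) (hK : IsClosed K) (hKU : K ⊆ U)
    (h0 : ∀ x ∈ U, x ∉ K → φ (rotCos (a x)) = 0)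
    (himg : ∀ z ∉ (fun x ↦ axialE (a x)) '' U, φ √(1 - ‖z‖ ^ 2) = 0) :
    IsContForm (fsmul (U.indicator fun x ↦ φ (rotCos (a x))) (volForm a)) ∧
    integrateForm o (fsmul (U.indicator fun x ↦ φ (rotCos (a x))) (volForm a)) =
      σ * (8 * Real.pi ^ 2 * rotMean φ) := by
  set h : M → ℝ := U.indicator fun x ↦ φ (rotCos (a x)) with hh
  have hh0 (x : M) (hx : x ∉ K) : h x = 0 := by
    by_cases hxU : x ∈ U
    · rw [hh, indicator_of_mem hxU, h0 x hxU hx]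
    · rw [hh, indicator_of_notMem hxU]
  have hcont : Continuous h := by
    refine continuous_iff_continuousAt.2 fun x ↦ ?_
    by_cases hx : x ∈ K
    · have h1 : (fun x ↦ φ (rotCos (a x))) =ᶠ[𝓝 x] h := by
        filter_upwards [hU.mem_nhds (hKU hx)] with z hz
        rw [hh, indicator_of_mem hz]
      exact (hφ.comp (smoothFun_rotCos ha).continuous).continuousAt.congr h1
    · have h1 : (fun _ ↦ (0 : ℝ)) =ᶠ[𝓝 x] h := by
        filter_upwards [hK.isOpen_compl.mem_nhds hx] with z hz
        exact (hh0 z hz).symm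
      exact continuousAt_const.congr h1
  have hη : IsContForm (fsmul h (volForm a)) := (isSmoothForm_volForm ha).isContForm.fsmul hcont
  refine ⟨hη, ?_⟩
  set V : Set E3 := (extChartAt (𝓡 3) p).target ∩ (extChartAt (𝓡 3) p).symm ⁻¹' U with hV
  have hVo : IsOpen V := (continuousOn_extChartAt_symm p).isOpen_inter_preimage
    (isOpen_extChartAt_target p) hU
  have hFV : axialInChart a p '' V = (fun x ↦ axialE (a x)) '' U := by
    ext z
    constructor
    · rintro ⟨y, hy, rfl⟩
      exact ⟨_, hy.2, rfl⟩
    · rintro ⟨x, hx, rfl⟩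
      have h1 := (extChartAt (𝓡 3) p).left_inv (hUs hx)
      refine ⟨extChartAt (𝓡 3) p x, ⟨(extChartAt (𝓡 3) p).map_source (hUs hx), ?_⟩, ?_⟩
      · rw [mem_preimage, h1]; exact hx
      · rw [axialInChart, h1]
  have hFinj : InjOn (axialInChart a p) V := fun y hy z hz hyz ↦
    (extChartAt (𝓡 3) p).symm.injOn hy.1 hz.1 (hinj hy.2 hz.2 hyz)
  rw [integrateForm_eq_chart o hη p hK (hKU.trans hUs) fun x hx ↦ by
      change h x • volForm a x = 0
      rw [hh0 x hx, zero_smul],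
    setIntegral_eq_of_subset_of_forall_sdiff_eq_zero (s := V)
      (isOpen_extChartAt_target p).measurableSet inter_subset_left,
    ← integral_eq_rotMean hφ0,
    ← setIntegral_eq_integral_of_forall_compl_eq_zero (s := axialInChart a p '' V)
      (f := fun z : E3 ↦ φ √(1 - ‖z‖ ^ 2) * (2 / (√(1 - ‖z‖ ^ 2) * (1 + √(1 - ‖z‖ ^ 2))))),
    integral_image_eq_integral_abs_det_fderiv_smul volume hVo.measurableSet
      (fun y hy ↦ (hasFDerivAt_axialInChart ha hy.1).hasFDerivWithinAt) hFinj, ← integral_const_mul]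
  · refine setIntegral_congr_fun hVo.measurableSet fun y hy ↦ ?_
    have hc := hpos _ hy.2
    have h1 : density o (fsmul h (volForm a)) p y =
        φ (rotCos (a ((extChartAt (𝓡 3) p).symm y))) * density o (volForm a) p y := by
      rw [density, density, inChart_fsmul]
      simp only [ContinuousAlternatingMap.smul_apply, smul_eq_mul]
      have h3 : h ((extChartAt (𝓡 3) p).symm y) = φ (rotCos (a ((extChartAt (𝓡 3) p).symm y))) :=
        indicator_of_mem (s := U) hy.2 _
      rw [h3]
      ring
    have h2 : √(1 - ‖axialInChart a p y‖ ^ 2) = rotCos (a ((extChartAt (𝓡 3) p).symm y)) :=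
      (hr _).sqrt_axialE hc.le
    simp only [h1, hσ y hy.1 hy.2, h2, smul_eq_mul]
    have h3 : 0 < rotCos (a ((extChartAt (𝓡 3) p).symm y)) *
        (1 + rotCos (a ((extChartAt (𝓡 3) p).symm y))) / 2 := by positivity
    rw [det_fderiv_axialInChart hS ha hr hy.1, abs_mul, abs_neg, abs_of_pos h3]
    field_simp
  · intro z hz
    rw [hFV] at hz
    rw [himg z hz, zero_mul]
  · intro y hy
    have h1 : (extChartAt (𝓡 3) p).symm y ∉ U := fun h ↦ hy.2 ⟨hy.1, h⟩
    rw [density, inChart_fsmul]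
    simp only [ContinuousAlternatingMap.smul_apply, smul_eq_mul]
    rw [hh, indicator_of_notMem h1]
    ring

end

open Matrix

theorem IsRotation.axialE_eq_zero {A : Matrix (Fin 3) (Fin 3) ℝ} (h : IsRotation A)
    (hc : rotCos A = 1) : axialE A = 0 := by
  have := h.norm_axialE_sq
  rw [hc] at this
  exact norm_eq_zero.1 (pow_eq_zero_iff two_ne_zero |>.1 (by linarith))

section
variable {M : Type*} [TopologicalSpace M] [ChartedSpace E3 M] [IsManifold (𝓡 3) ∞ M]
variable {g : Metric M} {S : Fin 3 → VField M} {a : M → Matrix (Fin 3) (Fin 3) ℝ}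
variable [CompactSpace M] [T2Space M]

/-! ### The degree of a map to the rotation group -/

/-- Disjoint charts around the points of a regular fibre. -/
theorem exists_disjoint_nhds (hS : IsOrthonormalFrame g S) (o : MOrientation M) (ha : SmoothMat a)
    (hr : ∀ x, IsRotation (a x)) (hreg : ∀ x, rotCos (a x) = 1 → IsRegularAt a x) :
    ∃ (s : Finset M) (U : M → Set M) (σ : M → ℤ), (∀ x, rotCos (a x) = 1 → x ∈ s) ∧
      (s : Set M).PairwiseDisjoint U ∧ ∀ p ∈ s, IsOpen (U p) ∧ p ∈ U p ∧
      U p ⊆ (extChartAt (𝓡 3) p).source ∧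
      InjOn (fun x ↦ axialE (a x)) (U p) ∧ (∀ x ∈ U p, 0 < rotCos (a x)) ∧
      (fun x ↦ axialE (a x)) '' U p ∈ 𝓝 0 ∧
      ∀ y ∈ (extChartAt (𝓡 3) p).target, (extChartAt (𝓡 3) p).symm y ∈ U p →
        density o (volForm a) p y = σ p * |inChart (volForm a) p y stdB| := by
  set K : Set M := {x | rotCos (a x) = 1} with hK
  have hKc : IsClosed K := isClosed_eq (continuous_rotCos ha) continuous_const
  have hloc (p : M) (hp : p ∈ K) := exists_nhds_axialE hS o ha hr (hreg p hp) (by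
    rw [show rotCos (a p) = 1 from hp]; exact one_pos)
  choose! U hUo hpU hUs hinj hpos himg σ hσ using hloc
  have hsub (p : M) (hp : p ∈ K) : U p ∩ K ⊆ {p} := by
    rintro x ⟨hx, hxK⟩
    refine hinj p hp hx (hpU p hp) ?_
    change axialE (a x) = axialE (a p)
    rw [(hr x).axialE_eq_zero hxK, (hr p).axialE_eq_zero hp]
  have hfin : K.Finite := by
    obtain ⟨t, htK, ht⟩ := hKc.isCompact.elim_nhds_subcover U
      fun p hp ↦ (hUo p hp).mem_nhds (hpU p hp)
    refine t.finite_toSet.subset fun x hx ↦ ?_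
    obtain ⟨q, hq, hxq⟩ := mem_iUnion₂.1 (ht hx)
    rw [hsub q (htK q hq) ⟨hxq, hx⟩]
    exact hq
  obtain ⟨V, hV, hVd⟩ := hfin.t2_separation
  refine ⟨hfin.toFinset, fun p ↦ U p ∩ V p, σ, fun x hx ↦ hfin.mem_toFinset.2 hx, ?_, ?_⟩
  · rw [hfin.coe_toFinset]
    exact hVd.mono fun p ↦ inter_subset_right
  · intro p hp
    replace hp : p ∈ K := hfin.mem_toFinset.1 hp
    refine ⟨(hUo p hp).inter (hV p).2, ⟨hpU p hp, (hV p).1⟩, inter_subset_left.trans (hUs p hp),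
      (hinj p hp).mono inter_subset_left, fun x hx ↦ hpos p hp x hx.1, ?_,
      fun y hy hyU ↦ hσ p hp y hy hyU.1⟩
    have h1 := himg p hp _ (((hUo p hp).inter (hV p).2).mem_nhds ⟨hpU p hp, (hV p).1⟩)
    rwa [(hr p).axialE_eq_zero hp] at h1

theorem exists_integrateForm_volForm_of_regular (hS : IsOrthonormalFrame g S) (o : MOrientation M)
    (ha : SmoothMat a) (hr : ∀ x, IsRotation (a x))
    (hreg : ∀ x, rotCos (a x) = 1 → IsRegularAt a x) :
    ∃ N : ℤ, integrateForm o (volForm a) = 8 * Real.pi ^ 2 * N := by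
  classical
  obtain ⟨s, U, σ, hs, hd, hU⟩ := exists_disjoint_nhds hS o ha hr hreg
  have hc := continuous_rotCos ha
  obtain ⟨δ, hδ0, hδ⟩ : ∃ δ > 0, ∀ x, x ∉ ⋃ p ∈ s, U p → rotCos (a x) < 1 - δ := by
    have hCc : IsClosed (⋃ p ∈ s, U p)ᶜ :=
      (isOpen_biUnion fun p hp ↦ (hU p hp).1).isClosed_compl
    rcases (⋃ p ∈ s, U p)ᶜ.eq_empty_or_nonempty with he | hne
    · exact ⟨1, one_pos, fun x hx ↦ absurd (show x ∈ (⋃ p ∈ s, U p)ᶜ from hx) (by rw [he]; simp)⟩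
    · obtain ⟨x₀, hx₀, hmax⟩ := hCc.isCompact.exists_isMaxOn hne hc.continuousOn
      have hlt : rotCos (a x₀) < 1 := by
        refine lt_of_le_of_ne (hr x₀).rotCos_mem.2 fun h ↦ hx₀ ?_
        exact mem_biUnion (hs x₀ h) (hU x₀ (hs x₀ h)).2.1
      refine ⟨(1 - rotCos (a x₀)) / 2, by linarith, fun x hx ↦ ?_⟩
      have : rotCos (a x) ≤ rotCos (a x₀) := hmax hx
      linarith
  obtain ⟨ρ, hρ0, hρ⟩ : ∃ ρ > 0, ∀ p ∈ s, Metric.ball (0 : E3) ρ ⊆ (fun x ↦ axialE (a x)) '' U p := by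
    have h1 : (⋂ p ∈ s, (fun x ↦ axialE (a x)) '' U p) ∈ 𝓝 (0 : E3) :=
      (Filter.biInter_finset_mem s).2 fun p hp ↦ (hU p hp).2.2.2.2.2.1
    obtain ⟨ρ, hρ0, hρ⟩ := Metric.mem_nhds_iff.1 h1
    exact ⟨ρ, hρ0, fun p hp ↦ hρ.trans (biInter_subset_of_mem hp)⟩
  set ε := min (min δ (ρ ^ 2 / 2)) (1 / 2) with hε
  have hε0 : 0 < ε := by positivity
  have hεδ : ε ≤ δ := (min_le_left _ _).trans (min_le_left _ _)
  have hερ : ε ≤ ρ ^ 2 / 2 := (min_le_left _ _).trans (min_le_right _ _)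
  have hε1 : ε ≤ 1 / 2 := min_le_right _ _
  set φ : ℝ → ℝ := fun c ↦ max 0 (c - (1 - ε)) with hφ
  have hφc : Continuous φ := by fun_prop
  have hφ0 (t : ℝ) (ht : t ≤ 1 - ε) : φ t = 0 := max_eq_left (by linarith)
  have hsum : fsmul (fun x ↦ φ (rotCos (a x))) (volForm a) =
      ∑ p ∈ s, fsmul ((U p).indicator fun x ↦ φ (rotCos (a x))) (volForm a) := by
    funext x
    rw [Finset.sum_apply]
    by_cases hx : x ∈ ⋃ p ∈ s, U p
    · obtain ⟨p, hp, hxp⟩ := mem_iUnion₂.1 hx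
      rw [Finset.sum_eq_single_of_mem p hp]
      · simp only [fsmul, indicator_of_mem hxp]
      · intro q hq hqp
        have : x ∉ U q := fun hxq ↦ (disjoint_left.1 (hd hq hp hqp)) hxq hxp
        simp only [fsmul, indicator_of_notMem this, zero_smul]
    · have h1 := hφ0 _ ((hδ x hx).le.trans (by linarith))
      rw [Finset.sum_eq_zero]
      · simp only [fsmul, h1, zero_smul]
      · intro q _
        have : (U q).indicator (fun x ↦ φ (rotCos (a x))) x = 0 := by
          by_cases hq : x ∈ U q
          · rw [indicator_of_mem hq, h1]
          · rw [indicator_of_notMem hq]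
        simp only [fsmul, this, zero_smul]
  have hterm (p : M) (hp : p ∈ s) := by
    obtain ⟨h1, h2, h3, h4, h5, h6, h7⟩ := hU p hp
    have hK : IsClosed ({x | 1 - ε ≤ rotCos (a x)} ∩ (⋃ q ∈ s.erase p, U q)ᶜ) := by
      refine (isClosed_le continuous_const hc).inter ?_
      exact (isOpen_biUnion fun q hq ↦ (hU q (Finset.mem_of_mem_erase hq)).1).isClosed_compl
    refine integrateForm_indicator hS o ha hr h1 h3 h4 h5 h7 hφc
      (fun t ht ↦ hφ0 t (by linarith)) hK ?_ ?_ ?_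
    · rintro x ⟨hx, hx'⟩
      have hx2 : x ∈ ⋃ p ∈ s, U p := by
        by_contra h
        have := hδ x h
        have hx3 : 1 - ε ≤ rotCos (a x) := hx
        linarith
      obtain ⟨q, hq, hxq⟩ := mem_iUnion₂.1 hx2
      by_cases hqp : q = p
      · rwa [← hqp]
      · exact absurd (mem_biUnion (Finset.mem_erase.2 ⟨hqp, hq⟩) hxq) hx'
    · intro x hx hxK
      refine hφ0 _ ?_
      by_contra h
      refine hxK ⟨(not_le.1 h).le, fun h' ↦ ?_⟩
      obtain ⟨q, hq, hxq⟩ := mem_iUnion₂.1 h'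
      exact disjoint_left.1 (hd (Finset.mem_of_mem_erase hq) hp (Finset.ne_of_mem_erase hq)) hxq hx
    · intro z hz
      refine hφ0 _ ?_
      have h8 : ρ ≤ ‖z‖ := by
        by_contra h
        exact hz (hρ p hp (by simpa using h))
      refine Real.sqrt_le_iff.2 ⟨by linarith, ?_⟩
      nlinarith
  have hI := integrateForm_rotCos hS o ha hr hφc
  rw [hsum, integrateForm_sum o s fun p hp ↦ (hterm p hp).1,
    Finset.sum_congr rfl fun p hp ↦ (hterm p hp).2, ← Finset.sum_mul] at hI
  have hpos : 0 < rotMean φ := rotMean_pos hε0 (by linarith)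
  refine ⟨∑ p ∈ s, σ p, mul_left_cancel₀ hpos.ne' ?_⟩
  rw [← hI]
  push_cast
  ring

/-! ### Regular values -/

/-- The rotation with a given antisymmetric part and positive cosine. -/
def rotOfAxial (w : E3) : Matrix (Fin 3) (Fin 3) ℝ :=
  let c := √(1 - ‖w‖ ^ 2)
  let k := 1 / (1 + c)
  !![c + k * w 2 ^ 2, -w 0 - k * (w 1 * w 2), -w 1 + k * (w 0 * w 2);
    w 0 - k * (w 1 * w 2), c + k * w 1 ^ 2, -w 2 - k * (w 0 * w 1);
    w 1 + k * (w 0 * w 2), w 2 - k * (w 0 * w 1), c + k * w 0 ^ 2]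

theorem isRotation_of_axial {X Y Z c k : ℝ} (hkc : k * (1 + c) = 1)
    (hc2 : c ^ 2 = 1 - (X ^ 2 + Y ^ 2 + Z ^ 2)) :
    IsRotation !![c + k * Z ^ 2, -X - k * (Y * Z), -Y + k * (X * Z);
      X - k * (Y * Z), c + k * Y ^ 2, -Z - k * (X * Y);
      Y + k * (X * Z), Z - k * (X * Y), c + k * X ^ 2] := by
  have hkw : k * (X ^ 2 + Y ^ 2 + Z ^ 2) = 1 - c := by
    linear_combination (1 - c) * hkc + k * hc2
  have h : k * (k * (X ^ 2 + Y ^ 2 + Z ^ 2)) + 2 * (k * c) = 1 := by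
    linear_combination k * hkw + hkc
  refine ⟨?_, ?_⟩
  · ext i j
    fin_cases i <;> fin_cases j <;> simp [mul_apply, Fin.sum_univ_three]
    · linear_combination hc2 + Z ^ 2 * h
    · linear_combination -(Y * Z) * h
    · linear_combination X * Z * h
    · linear_combination -(Y * Z) * h
    · linear_combination hc2 + Y ^ 2 * h
    · linear_combination -(X * Y) * h
    · linear_combination X * Z * h
    · linear_combination -(X * Y) * h
    · linear_combination hc2 + X ^ 2 * h
  · rw [det_fin_three]
    simp
    linear_combination (c + k * (X ^ 2 + Y ^ 2 + Z ^ 2)) * hc2 + hkw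

theorem rotOfAxial_spec {w : E3} (hw : ‖w‖ < 1) : IsRotation (rotOfAxial w) ∧
    axialE (rotOfAxial w) = w ∧ 0 < rotCos (rotOfAxial w) := by
  have hpos : 0 < 1 - ‖w‖ ^ 2 := by nlinarith [norm_nonneg w]
  set c := √(1 - ‖w‖ ^ 2) with hc
  have hc0 : 0 < c := Real.sqrt_pos.2 hpos
  have hc2 : c ^ 2 = 1 - (w 0 ^ 2 + w 1 ^ 2 + w 2 ^ 2) := by
    rw [hc, Real.sq_sqrt hpos.le, EuclideanSpace.norm_sq_eq, Fin.sum_univ_three]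
    simp
  set k := 1 / (1 + c) with hk
  have hkc : k * (1 + c) = 1 := by rw [hk]; field_simp
  have hkw : k * (w 0 ^ 2 + w 1 ^ 2 + w 2 ^ 2) = 1 - c := by
    linear_combination (1 - c) * hkc + k * hc2
  have he : rotOfAxial w = !![c + k * w 2 ^ 2, -w 0 - k * (w 1 * w 2), -w 1 + k * (w 0 * w 2);
    w 0 - k * (w 1 * w 2), c + k * w 1 ^ 2, -w 2 - k * (w 0 * w 1);
    w 1 + k * (w 0 * w 2), w 2 - k * (w 0 * w 1), c + k * w 0 ^ 2] := rfl
  have hcos : rotCos (rotOfAxial w) = c := by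
    rw [he]
    simp [rotCos]
    linear_combination hkw / 2
  refine ⟨he ▸ isRotation_of_axial hkc hc2, ?_, by rwa [hcos]⟩
  · ext i
    fin_cases i <;> simp [axialE, axial, he]

theorem rotCos_transpose_mul {A Q : Matrix (Fin 3) (Fin 3) ℝ} (hA : IsRotation A)
    (hQ : IsRotation Q) (h : rotCos (Qᵀ * A) = 1) : A = Q := by
  have hs : ∑ i, ∑ j, (A i j - Q i j) ^ 2 = 0 := by
    simp only [rotCos, mul_apply, transpose_apply, Fin.sum_univ_three] at h ⊢
    have sA (j) := sum_sq_of_transpose_mul hA.1 j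
    have sQ (j) := sum_sq_of_transpose_mul hQ.1 j
    linear_combination sA 0 + sA 1 + sA 2 + sQ 0 + sQ 1 + sQ 2 - 4 * h
  ext i j
  rw [Finset.sum_eq_zero_iff_of_nonneg fun i _ ↦ Finset.sum_nonneg fun j _ ↦ sq_nonneg _] at hs
  have h1 := hs i (Finset.mem_univ i)
  rw [Finset.sum_eq_zero_iff_of_nonneg fun j _ ↦ sq_nonneg _] at h1
  exact sub_eq_zero.1 (pow_eq_zero_iff two_ne_zero |>.1 (h1 j (Finset.mem_univ j)))

/-- Sard's theorem for the antisymmetric part. -/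
theorem exists_regular_value (hS : IsOrthonormalFrame g S) (ha : SmoothMat a)
    (hr : ∀ x, IsRotation (a x)) : ∃ w : E3, ‖w‖ < 1 ∧
      ∀ x, 0 < rotCos (a x) → axialE (a x) = w → IsRegularAt a x := by
  obtain ⟨t, ht⟩ := isCompact_univ.elim_finite_subcover (fun x₀ : M ↦ (extChartAt (𝓡 3) x₀).source)
    (fun x₀ ↦ isOpen_extChartAt_source x₀) fun x _ ↦ mem_iUnion.2 ⟨x, mem_extChartAt_source x⟩
  set C : M → Set E3 := fun x₀ ↦ axialInChart a x₀ '' {y | y ∈ (extChartAt (𝓡 3) x₀).target ∧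
    (fderiv ℝ (axialInChart a x₀) y).det = 0} with hC
  have hC0 : volume (⋃ x₀ ∈ t, C x₀) = 0 := by
    refine (measure_biUnion_null_iff t.countable_toSet).2 fun x₀ _ ↦ ?_
    exact addHaar_image_eq_zero_of_det_fderivWithin_eq_zero volume
      (fun y hy ↦ (hasFDerivAt_axialInChart ha hy.1).hasFDerivWithinAt) fun y hy ↦ hy.2
  obtain ⟨w, hw, hwC⟩ : ∃ w ∈ Metric.ball (0 : E3) 1, w ∉ ⋃ x₀ ∈ t, C x₀ := by
    by_contra! h
    have h1 := measure_mono_null (μ := (volume : Measure E3)) (fun w hw ↦ h w hw) hC0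
    exact (Metric.measure_ball_pos volume (0 : E3) one_pos).ne' h1
  refine ⟨w, by simpa using hw, fun x hx hxw ↦ ?_⟩
  obtain ⟨x₀, hx₀t, hx₀⟩ := mem_iUnion₂.1 (ht (mem_univ x))
  have hy := (extChartAt (𝓡 3) x₀).map_source hx₀
  have hxy := (extChartAt (𝓡 3) x₀).left_inv hx₀
  have h1 := isRegularAt_of_inChart (a := a) hy
  rw [hxy] at h1
  refine h1 fun h0 ↦ hwC (mem_biUnion hx₀t ⟨_, ⟨hy, ?_⟩, ?_⟩)
  · rw [det_fderiv_axialInChart hS ha hr hy, h0, mul_zero]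
  · rw [axialInChart, hxy, hxw]

theorem dfun_transpose_mul {x : M} (Q : Matrix (Fin 3) (Fin 3) ℝ) (ha : SmoothMat a) (p : Fin 3) :
    dMat S (fun y ↦ Qᵀ * a y) x p = Qᵀ * dMat S a x p := by
  rw [dMat_mul (a := fun _ ↦ Qᵀ) (fun i j ↦ SmoothFun.const _) ha, dMat_const, Matrix.zero_mul,
    zero_add]

theorem mcForm_congr (hS : IsOrthonormalFrame g S) {a b : M → Matrix (Fin 3) (Fin 3) ℝ}
    (h : ∀ x p, mcMat S a x p = mcMat S b x p) (i j : Fin 3) : mcForm a i j = mcForm b i j := by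
  refine one_form_ext_ev hS fun x ↦ funext fun p ↦ ?_
  rw [ev1_mcForm, ev1_mcForm, h]

theorem SmoothMat.transpose_mul (Q : Matrix (Fin 3) (Fin 3) ℝ) (ha : SmoothMat a) :
    SmoothMat fun x ↦ Qᵀ * a x := by
  intro i j
  simp only [mul_apply]
  exact SmoothFun.sum _ fun k ↦ (SmoothFun.const _).mul (ha k j)

/-- The volume form of the rotation group has integral periods. -/
theorem exists_integrateForm_volForm (hS : IsOrthonormalFrame g S) (o : MOrientation M)
    (ha : SmoothMat a) (hr : ∀ x, IsRotation (a x)) :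
    ∃ N : ℤ, integrateForm o (volForm a) = 8 * Real.pi ^ 2 * N := by
  obtain ⟨w, hw, hreg⟩ := exists_regular_value hS ha hr
  obtain ⟨hQ, hQw, hQc⟩ := rotOfAxial_spec hw
  set Q := rotOfAxial w
  have hQQ : Q * Qᵀ = 1 := mul_eq_one_comm.1 hQ.1
  have hbs : SmoothMat fun x ↦ Qᵀ * a x := SmoothMat.transpose_mul Q ha
  have hb : ∀ x, IsRotation (Qᵀ * a x) := fun x ↦ by
    refine ⟨?_, by rw [det_mul, det_transpose, hQ.2, (hr x).2, one_mul]⟩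
    rw [Matrix.transpose_mul, transpose_transpose, Matrix.mul_assoc, ← Matrix.mul_assoc Q, hQQ,
      Matrix.one_mul, (hr x).1]
  have hmc (i j : Fin 3) : mcForm (fun x ↦ Qᵀ * a x) i j = mcForm a i j := by
    refine mcForm_congr hS (fun x p ↦ ?_) i j
    rw [mcMat, mcMat, dfun_transpose_mul Q ha, Matrix.transpose_mul, transpose_transpose,
      Matrix.mul_assoc, ← Matrix.mul_assoc Q, hQQ, Matrix.one_mul]
  have hvol : volForm (fun x ↦ Qᵀ * a x) = volForm a := by simp only [volForm, hmc]
  rw [← hvol]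
  refine exists_integrateForm_volForm_of_regular hS o hbs hb fun x hx ↦ ?_
  have hxQ := rotCos_transpose_mul (hr x) hQ hx
  have := hreg x (by rwa [hxQ]) (by rwa [hxQ])
  rwa [IsRegularAt, ← hvol] at this

/-- The same for the orthogonal group. -/
theorem exists_integrateForm_volForm_orthogonal (hS : IsOrthonormalFrame g S) (o : MOrientation M)
    (ha : SmoothMat a) (h1 : ∀ x, (a x)ᵀ * a x = 1) :
    ∃ N : ℤ, integrateForm o (volForm a) = 8 * Real.pi ^ 2 * N := by
  have hdet (x : M) : (a x).det * (a x).det = 1 := by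
    have := congrArg det (h1 x)
    rwa [det_mul, det_transpose, det_one] at this
  have hds : SmoothFun fun x ↦ (a x).det := by
    simp only [det_fin_three, sub_eq_add_neg]
    have h (i j k l m n : Fin 3) : SmoothFun fun x ↦ a x i j * a x k l * a x m n :=
      ((ha i j).mul (ha k l)).mul (ha m n)
    exact (((((h _ _ _ _ _ _).add (ContMDiff.neg (h _ _ _ _ _ _))).add
      (ContMDiff.neg (h _ _ _ _ _ _))).add (h _ _ _ _ _ _)).add (h _ _ _ _ _ _)).add
      (ContMDiff.neg (h _ _ _ _ _ _))
  have hd0 (x : M) (v : TangentSpace (𝓡 3) x) : mvfderiv (𝓡 3) (fun x ↦ (a x).det) x v = 0 := by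
    have h2 := mvfderiv_mul_fun hds hds x v
    simp only [hdet] at h2
    rw [mvfderiv_const_fun] at h2
    have h3 : (a x).det ≠ 0 := left_ne_zero_of_mul_eq_one (hdet x)
    have h4 : (a x).det * mvfderiv (𝓡 3) (fun x ↦ (a x).det) x v = 0 := by linarith
    exact (mul_eq_zero.1 h4).resolve_left h3
  have hbs : SmoothMat fun x ↦ (a x).det • a x := fun i j ↦ hds.mul (ha i j)
  have hb : ∀ x, IsRotation ((a x).det • a x) := fun x ↦ by
    refine ⟨?_, ?_⟩
    · rw [transpose_smul, Matrix.smul_mul, Matrix.mul_smul, smul_smul, hdet, one_smul, h1]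
    · rw [det_smul, Fintype.card_fin]
      linear_combination ((a x).det * (a x).det + 1) * hdet x
  have hmc (i j : Fin 3) : mcForm (fun x ↦ (a x).det • a x) i j = mcForm a i j := by
    refine mcForm_congr hS (fun x p ↦ ?_) i j
    have h2 : dMat S (fun x ↦ (a x).det • a x) x p = (a x).det • dMat S a x p := by
      ext i j
      refine (mvfderiv_mul_fun hds (ha i j) x (S p x)).trans ?_
      rw [hd0, zero_mul, add_zero]
      rfl
    rw [mcMat, mcMat, h2, transpose_smul, Matrix.smul_mul, Matrix.mul_smul, smul_smul, hdet,
      one_smul]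
  have hvol : volForm (fun x ↦ (a x).det • a x) = volForm a := by simp only [volForm, hmc]
  rw [← hvol]
  exact exists_integrateForm_volForm hS o hbs hb

end

/-! ### Conformal invariance -/

section
variable {M : Type*} [TopologicalSpace M] [ChartedSpace E3 M] [IsManifold (𝓡 3) ∞ M]
  {g : Metric M} {S S' : Fin 3 → VField M}

theorem isSmoothForm_csForm {θ : Matrix (Fin 3) (Fin 3) (DiffForm M 1)}
    (h : ∀ i j, IsSmoothForm (θ i j)) : IsSmoothForm (csForm θ) := by
  have e : csForm θ = ∑ i, ((∑ l, wedge (θ i l) (extD (θ l i))) +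
      (2 / 3 : ℝ) • ∑ l, wedge (θ i l) (∑ m, wedge (θ l m) (θ m i))) := rfl
  rw [e]
  refine IsSmoothForm.sum _ fun i _ ↦ IsSmoothForm.add
    (IsSmoothForm.sum _ fun l _ ↦ (h i l).wedge (h l i).extD)
    (IsSmoothForm.const_smul (IsSmoothForm.sum _ fun l _ ↦ (h i l).wedge
      (IsSmoothForm.sum _ fun m _ ↦ (h l m).wedge (h m i))) _)

theorem isSmoothForm_chernSimonsForm (hS : IsOrthonormalFrame g S) :
    IsSmoothForm (chernSimonsForm g S) :=
  isSmoothForm_csForm (isSmoothForm_connectionForm hS)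

theorem exists_isOrthonormalFrame_conformalChange (f : C^∞⟮𝓡 3, M; 𝓘(ℝ, ℝ), ℝ⟯) :
    (∃ S, IsOrthonormalFrame (conformalChange f g) S) ↔ ∃ S, IsOrthonormalFrame g S := by
  refine ⟨fun ⟨S, hS⟩ ↦ ⟨fun i x ↦ Real.exp (f x) • S i x, fun i ↦
    smoothField_smul (smoothFun_exp f) (hS.1 i), fun x i j ↦ ?_⟩,
    fun ⟨S, hS⟩ ↦ ⟨_, isOrthonormalFrame_rescaleFrame f hS⟩⟩
  have h := hS.2 x i j
  rw [conformalChange_inner, two_mul, Real.exp_add] at h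
  rw [← h]
  simp only [map_smul, _root_.smul_apply, smul_eq_mul]
  ring

variable [CompactSpace M] [T2Space M]

theorem integrateForm_add_extD (o : MOrientation M) {η : DiffForm M 3} (hη : IsSmoothForm η)
    {β : DiffForm M 2} (hβ : IsSmoothForm β) :
    integrateForm o (η + extD β) = integrateForm o η := by
  rw [integrateForm_add o hη.isContForm hβ.extD.isContForm, integrateForm_extD o hβ, add_zero]

/-- The Chern-Simons number modulo `1` does not depend on the orthonormal frame. -/
theorem coe_chernSimonsNumber_eq (hS : IsOrthonormalFrame g S) (hS' : IsOrthonormalFrame g S')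
    (o : MOrientation M) :
    (chernSimonsNumber o g S : UnitAddCircle) = (chernSimonsNumber o g S' : UnitAddCircle) := by
  have ha := smoothMat_frameChange hS hS'
  obtain ⟨β, hβ, h⟩ := exists_chernSimonsForm_frameChange hS hS'
  obtain ⟨N, hN⟩ := exists_integrateForm_volForm_orthogonal hS o ha
    (frameChange_transpose_mul hS hS')
  have hv := isSmoothForm_volForm ha
  replace h : chernSimonsForm g S' =
    chernSimonsForm g S + (-2 : ℝ) • volForm (frameChange g S S') + extD β := h
  have hc := isSmoothForm_chernSimonsForm hS
  have h1 : chernSimonsNumber o g S' - chernSimonsNumber o g S = N := by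
    rw [chernSimonsNumber, chernSimonsNumber, h, integrateForm_add_extD o (hc.add (hv.const_smul _)) hβ,
      integrateForm_add o hc.isContForm (hv.const_smul _).isContForm, integrateForm_smul, hN]
    field_simp
    ring
  refine (QuotientAddGroup.eq.2 ?_)
  refine AddSubgroup.mem_zmultiples_iff.2 ⟨N, ?_⟩
  rw [zsmul_one, ← h1]
  ring

theorem chernSimonsNumber_conformalChange (hS : IsOrthonormalFrame g S) (o : MOrientation M)
    (f : C^∞⟮𝓡 3, M; 𝓘(ℝ, ℝ), ℝ⟯) :
    chernSimonsNumber o (conformalChange f g) (rescaleFrame f S) = chernSimonsNumber o g S := by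
  obtain ⟨β, hβ, h⟩ := exists_chernSimonsForm_conformal f hS
  rw [chernSimonsNumber, h, integrateForm_add_extD o (isSmoothForm_chernSimonsForm hS) hβ,
    chernSimonsNumber]

theorem coe_chernSimonsNumber_conformalChange (hS : IsOrthonormalFrame g S)
    (o : MOrientation M) (f : C^∞⟮𝓡 3, M; 𝓘(ℝ, ℝ), ℝ⟯)
    (hS' : IsOrthonormalFrame (conformalChange f g) S') :
    (chernSimonsNumber o g S : UnitAddCircle) =
      (chernSimonsNumber o (conformalChange f g) S' : UnitAddCircle) := by
  rw [← chernSimonsNumber_conformalChange hS o f]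
  exact coe_chernSimonsNumber_eq (isOrthonormalFrame_rescaleFrame f hS) hS' o

theorem chernSimonsInvariant_conformalChange (o : MOrientation M) (g : Metric M)
    (f : C^∞⟮𝓡 3, M; 𝓘(ℝ, ℝ), ℝ⟯) :
    chernSimonsInvariant o g = chernSimonsInvariant o (conformalChange f g) := by
  by_cases h : ∃ S, IsOrthonormalFrame g S
  · have h' := (exists_isOrthonormalFrame_conformalChange f).2 h
    rw [chernSimonsInvariant, chernSimonsInvariant, dif_pos h, dif_pos h']
    exact coe_chernSimonsNumber_conformalChange h.choose_spec o f h'.choose_spec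
  · have h' := mt (exists_isOrthonormalFrame_conformalChange f).1 h
    rw [chernSimonsInvariant, chernSimonsInvariant, dif_neg h, dif_neg h']

end

end ChernSimons

end

theorem mainTheorem2 {M : Type*} [TopologicalSpace M] [T2Space M] [CompactSpace M]
    [ChartedSpace (EuclideanSpace ℝ (Fin 3)) M] [IsManifold (𝓡 3) ∞ M]
    (o : ChernSimons.MOrientation M) (g : ChernSimons.Metric M)
    (f : C^∞⟮𝓡 3, M; 𝓘(ℝ, ℝ), ℝ⟯) :
    -- conformal invariance in `ℝ/ℤ`
    ChernSimons.chernSimonsInvariant o g =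
        ChernSimons.chernSimonsInvariant o (ChernSimons.conformalChange f g) ∧
    -- the same, for arbitrary orthonormal frames of the two metrics
    (∀ S S' : Fin 3 → ChernSimons.VField M,
      ChernSimons.IsOrthonormalFrame g S →
      ChernSimons.IsOrthonormalFrame (ChernSimons.conformalChange f g) S' →
        (ChernSimons.chernSimonsNumber o g S : UnitAddCircle) =
          (ChernSimons.chernSimonsNumber o (ChernSimons.conformalChange f g) S' :
            UnitAddCircle)) ∧
    -- for corresponding frames, the Chern-Simons forms differ by an exact form
    ∀ S : Fin 3 → ChernSimons.VField M, ChernSimons.IsOrthonormalFrame g S →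
      ChernSimons.IsOrthonormalFrame (ChernSimons.conformalChange f g)
          (ChernSimons.rescaleFrame f S) ∧
        ∃ β : ChernSimons.DiffForm M 2, ChernSimons.IsSmoothForm β ∧
          ChernSimons.chernSimonsForm (ChernSimons.conformalChange f g)
              (ChernSimons.rescaleFrame f S) =
            ChernSimons.chernSimonsForm g S + ChernSimons.extD β := by
  exact ⟨ChernSimons.chernSimonsInvariant_conformalChange o g f,
    fun S S' hS hS' ↦ ChernSimons.coe_chernSimonsNumber_conformalChange hS o f hS',
    fun S hS ↦ ⟨ChernSimons.isOrthonormalFrame_rescaleFrame f hS,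
      ChernSimons.exists_chernSimonsForm_conformal f hS⟩⟩
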